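/- Let $\Bbbk$ be a field of characteristic $0$. A $\mathbb Z$-graded Lie (super)algebra over $\Bbbk$ is a vector space $\mathfrak g=\bigoplus_{(n,\epsilon)\in\mathbb Z\times\mathbb Z/2}\mathfrak g_{n,\epsilon}$ (degree $n$, parity $p=\epsilon$; the parity need not be the degree mod 2) with a bilinear bracket satisfying $[\mathfrak g_{n,\epsilon},\mathfrak g_{n',\epsilon'}]\subseteq\mathfrak g_{n+n',\epsilon+\epsilon'}$ and, for homogeneous $x,y,z$, $[x,y]=-(-1)^{p(x)p(y)}[y,x]$ and $[x,[y,z]]=[[x,y],z]+(-1)^{p(x)p(y)}[y,[x,z]]$. Its universal enveloping algebra $\mathscr U(\mathfrak g)$ is the quotient of the tensor algebra $T(\mathfrak g)$ by the two-sided ideal generated by $x\otimes y-(-1)^{p(x)p(y)}y\otimes x-[x,y]$ for homogeneous $x,y$, and $\iota:\mathfrak g\to\mathscr U(\mathfrak g)$ is the canonical map. It is a $\mathbb Z\times\mathbb Z/2$-graded algebra, and a coalgebra: the comultiplication is the algebra map $\Delta:\mathscr U(\mathfrak g)\to\mathscr U(\mathfrak g)\otimes\mathscr U(\mathfrak g)$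 with $\Delta(\iota x)=\iota x\otimes1+1\otimes\iota x$, where $(a\otimes b)(a'\otimes b')=(-1)^{p(b)p(a')}aa'\otimes bb'$, and the counit is the algebra map $\mathscr U(\mathfrak g)\to\Bbbk$ killing $\iota(\mathfrak g)$. For a graded superspace $V$, $\mathrm{Sym}(V)$ is the quotient of $T(V)$ by the ideal generated by $x\otimes y-(-1)^{p(x)p(y)}y\otimes x$ (i.e. $\mathscr U(V)$ for the zero bracket), with product $\odot$ and with the corresponding grading and coalgebra structure. The tensor product of graded coalgebras carries $\Delta(a\otimes b)=\sum(-1)^{p(a_{(2)})p(b_{(1)})}(a_{(1)}\otimes b_{(1)})\otimes(a_{(2)}\otimes b_{(2)})$ and $\varepsilon(a\otimes b)=\varepsilon(a)\varepsilon(b)$. Let $\mathfrak g$ be a $\mathbb Z$-graded Lie superalgebra over $\Bbbk$ which admits a countable basis of elements homogeneous in degree and parity, let $\mathfrak h\subseteq\mathfrak g$ be a graded Lie subalgebra, and let $\mathfrak m\subseteq\mathfrak g$ be a graded subspace with $\mathfrak g=\mathfrak h\oplus\mathfrak m$. Let $j:\mathscr U(\mathfrak h)\to\mathscr U(\mathfrak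 g)$ be the algebra map induced by the inclusion. Then there is an isomorphism of $\Bbbk$-coalgebras $$\varphi:\mathscr U(\mathfrak h)\otimes\mathrm{Sym}(\mathfrak m)\xrightarrow{\ \sim\ }\mathscr U(\mathfrak g)$$ given, for all $a\in\mathscr U(\mathfrak h)$, $p\ge0$ and homogeneous $y_1,\dots,y_p\in\mathfrak m$, by $$\varphi(a\otimes y_1\odot\cdots\odot y_p)=j(a)\cdot\frac1{p!}\sum_{\sigma\in S_p}\epsilon(\sigma)\,\iota y_{\sigma(1)}\cdots\iota y_{\sigma(p)},\qquad \epsilon(\sigma)=\prod_{r<s,\ \sigma(s)<\sigma(r)}(-1)^{p(y_{\sigma(r)})p(y_{\sigma(s)})}.$$ Moreover $\varphi$ preserves degree and parity, and it is a morphism of left $\mathscr U(\mathfrak h)$-modules, where $\mathscr U(\mathfrak h)$ acts on the source by multiplication on the first factor and on $\mathscr U(\mathfrak g)$ by left multiplication through $j$. -/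

import Mathlib

open scoped TensorProduct DirectSum

noncomputable section

/-- Bidegrees `(degree, parity)`: the `ℤ`-degree and the super parity are independent, so this
covers in particular every situation in which the parity is a function of the degree. -/
abbrev Bideg : Type := ℤ × ZMod 2

/-- Bidegrees act on signs through the parity, so that `(-1) ^ (i * j) = (-1) ^ (i.2 * j.2)`. -/
instance Bideg.signModule : Module Bideg (Additive ℤˣ) :=
  Module.compHom (Additive ℤˣ) (RingHom.snd ℤ (ZMod 2))

/-- The Koszul sign `(-1) ^ (p(x) p(y))` of two elements of bidegrees `i` and `j`. -/
def koszulSign (i j : Bideg) : ℤˣ := (-1 : ℤˣ) ^ (i.2 * j.2)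

theorem uzpow_bideg (i j : Bideg) : (-1 : ℤˣ) ^ (i * j) = koszulSign i j := rfl

/-- For homogeneous elements `y 0, …, y (p-1)` of bidegrees `d 0, …, d (p-1)`, the sign `ε(σ)` with
`y 0 ⊙ … ⊙ y (p-1) = ε(σ) y (σ 0) ⊙ … ⊙ y (σ (p-1))`: the product of the Koszul signs of the
inversions of `σ`. -/
def permSign {p : ℕ} (d : Fin p → Bideg) (σ : Equiv.Perm (Fin p)) : ℤˣ :=
  ∏ i : Fin p, ∏ j : Fin p, if i < j ∧ σ j < σ i then koszulSign (d (σ i)) (d (σ j)) else 1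

/-- A `ℤ`-graded vector superspace structure on `V`: a direct sum decomposition
into the subspaces `comp (n, ε)` of elements of degree `n` and parity `ε`. -/
structure GradedSuperspace (k V : Type*) [Field k] [AddCommGroup V] [Module k V] where
  comp : Bideg → Submodule k V
  isInternal : DirectSum.IsInternal comp

/-- A graded subspace: a subspace which is the sum of its homogeneous parts. -/
structure GradedSubspace {k V : Type*} [Field k] [AddCommGroup V] [Module k V]
    (G : GradedSuperspace k V) where
  carrier : Submodule k V
  graded : carrier ≤ ⨆ d, carrier ⊓ G.comp d

/-- A `ℤ`-graded Lie superalgebra structure on `g`. -/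
structure GradedLieSuperalgebra (k g : Type*) [Field k] [AddCommGroup g] [Module k g] extends
    GradedSuperspace k g where
  bracket : g →ₗ[k] g →ₗ[k] g
  bracket_mem : ∀ {i j : Bideg} {x y : g}, x ∈ comp i → y ∈ comp j → bracket x y ∈ comp (i + j)
  skew : ∀ {i j : Bideg} {x y : g}, x ∈ comp i → y ∈ comp j →
    bracket x y = -(koszulSign i j • bracket y x)
  jacobi : ∀ {i j l : Bideg} {x y z : g}, x ∈ comp i → y ∈ comp j → z ∈ comp l →
    bracket x (bracket y z) =
      bracket (bracket x y) z + koszulSign i j • bracket y (bracket x z)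

/-- A graded Lie subalgebra. -/
structure GradedLieSubalgebra {k g : Type*} [Field k] [AddCommGroup g] [Module k g]
    (L : GradedLieSuperalgebra k g) extends GradedSubspace L.toGradedSuperspace where
  bracket_mem : ∀ {x y : g}, x ∈ carrier → y ∈ carrier → L.bracket x y ∈ carrier

/-- A graded subspace is itself a graded superspace. -/
def GradedSubspace.toSuperspace {k V : Type*} [Field k] [AddCommGroup V] [Module k V]
    {G : GradedSuperspace k V} (W : GradedSubspace G) : GradedSuperspace k W.carrier where
  comp d := (G.comp d).comap W.carrier.subtype
  isInternal := by
    have hG := (DirectSum.isInternal_submodule_iff_iSupIndep_and_iSup_eq_top _).1 G.isInternal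
    refine (DirectSum.isInternal_submodule_iff_iSupIndep_and_iSup_eq_top _).2 ⟨?_, ?_⟩
    · rw [iSupIndep_iff_finsetSum_eq_zero_imp_eq_zero]
      intro s v hv h0 i hi
      have := (iSupIndep_iff_finsetSum_eq_zero_imp_eq_zero _).1 hG.1 s (fun i => (v i : V))
        (fun i hi => hv i hi) (by
          have := congrArg W.carrier.subtype h0
          simpa using this) i hi
      exact Subtype.ext this
    · apply Submodule.map_injective_of_injective W.carrier.subtype_injective
      rw [Submodule.map_iSup, Submodule.map_top, Submodule.range_subtype]
      simp only [Submodule.map_comap_subtype]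
      exact le_antisymm (iSup_le fun d => inf_le_left) W.graded

/-- A graded Lie subalgebra is itself a graded Lie superalgebra. -/
def GradedLieSubalgebra.toLie {k g : Type*} [Field k] [AddCommGroup g] [Module k g]
    {L : GradedLieSuperalgebra k g} (H : GradedLieSubalgebra L) :
    GradedLieSuperalgebra k H.carrier where
  toGradedSuperspace := H.toGradedSubspace.toSuperspace
  bracket := LinearMap.mk₂ k (fun x y => ⟨L.bracket x y, H.bracket_mem x.2 y.2⟩)
    (fun _ _ _ => Subtype.ext (by simp)) (fun _ _ _ => Subtype.ext (by simp))
    (fun _ _ _ => Subtype.ext (by simp)) (fun _ _ _ => Subtype.ext (by simp))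
  bracket_mem hx hy := L.bracket_mem hx hy
  skew hx hy := Subtype.ext (L.skew hx hy)
  jacobi hx hy hz := Subtype.ext (L.jacobi hx hy hz)

/-- The abelian graded Lie superalgebra on a graded superspace: all brackets vanish. -/
def GradedSuperspace.abelian {k V : Type*} [Field k] [AddCommGroup V] [Module k V]
    (G : GradedSuperspace k V) : GradedLieSuperalgebra k V where
  toGradedSuperspace := G
  bracket := 0
  bracket_mem _ _ := by simp
  skew _ _ := by simp
  jacobi _ _ _ := by simp

namespace GradedLieSuperalgebra

variable {k g : Type*} [Field k] [AddCommGroup g] [Module k g] (L : GradedLieSuperalgebra k g)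

/-- The defining relations `x ⊗ y = (-1) ^ (p(x) p(y)) y ⊗ x + [x, y]` (for homogeneous `x`, `y`)
of the universal enveloping algebra. -/
inductive Rel : TensorAlgebra k g → TensorAlgebra k g → Prop
  | of {i j : Bideg} {x y : g} (hx : x ∈ L.comp i) (hy : y ∈ L.comp j) :
    Rel (TensorAlgebra.ι k x * TensorAlgebra.ι k y)
      (koszulSign i j • (TensorAlgebra.ι k y * TensorAlgebra.ι k x) +
        TensorAlgebra.ι k (L.bracket x y))

/-- The universal enveloping algebra `U(g)`: the quotient of the tensor algebra of `g` by the
two-sided ideal generated by `x ⊗ y - (-1) ^ (p(x) p(y)) y ⊗ x - [x, y]`. -/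
def U : Type _ := RingQuot L.Rel

instance : Ring L.U := inferInstanceAs (Ring (RingQuot L.Rel))
instance : Algebra k L.U := inferInstanceAs (Algebra k (RingQuot L.Rel))

/-- The canonical map `g → U(g)`. -/
def ι : g →ₗ[k] L.U := (RingQuot.mkAlgHom k L.Rel).toLinearMap ∘ₗ TensorAlgebra.ι k

theorem ι_mul_ι {i j : Bideg} {x y : g} (hx : x ∈ L.comp i) (hy : y ∈ L.comp j) :
    L.ι x * L.ι y = koszulSign i j • (L.ι y * L.ι x) + L.ι (L.bracket x y) := by
  have := RingQuot.mkAlgHom_rel k (Rel.of (L := L) hx hy)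
  rw [map_mul, map_add, Units.smul_def, map_zsmul, map_mul] at this
  rw [Units.smul_def]
  exact this

/-- The universal property of `U(g)`. -/
def lift {A : Type*} [Ring A] [Algebra k A] (f : g →ₗ[k] A)
    (hf : ∀ {i j : Bideg} {x y : g}, x ∈ L.comp i → y ∈ L.comp j →
      f x * f y = koszulSign i j • (f y * f x) + f (L.bracket x y)) : L.U →ₐ[k] A :=
  RingQuot.liftAlgHom k ⟨TensorAlgebra.lift k f, by
    rintro _ _ ⟨hx, hy⟩
    rw [map_mul, map_add, Units.smul_def, map_zsmul, map_mul]
    simp only [TensorAlgebra.lift_ι_apply]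
    rw [hf hx hy, Units.smul_def]⟩

@[simp]
theorem lift_ι {A : Type*} [Ring A] [Algebra k A] (f : g →ₗ[k] A)
    (hf : ∀ {i j : Bideg} {x y : g}, x ∈ L.comp i → y ∈ L.comp j →
      f x * f y = koszulSign i j • (f y * f x) + f (L.bracket x y)) (x : g) :
    L.lift f hf (L.ι x) = f x := by
  change RingQuot.liftAlgHom k _ (RingQuot.mkAlgHom k L.Rel (TensorAlgebra.ι k x)) = f x
  rw [RingQuot.liftAlgHom_mkAlgHom_apply, TensorAlgebra.lift_ι_apply]

theorem hom_ext {A : Type*} [Ring A] [Algebra k A] {f f' : L.U →ₐ[k] A}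
    (h : ∀ x, f (L.ι x) = f' (L.ι x)) : f = f' := by
  apply RingQuot.ringQuot_ext'
  apply TensorAlgebra.hom_ext
  ext x
  exact h x

/-- The grading of `U(g)`: the component of bidegree `d` is spanned by the products
`x₁ ⋯ xₙ` of homogeneous elements of `g` whose bidegrees add up to `d`. -/
def grading (d : Bideg) : Submodule k L.U :=
  Submodule.span k {u | ∃ l : List (Bideg × g), (∀ a ∈ l, a.2 ∈ L.comp a.1) ∧
    (l.map Prod.fst).sum = d ∧ u = (l.map fun a => L.ι a.2).prod}

theorem ι_mem {d : Bideg} {x : g} (hx : x ∈ L.comp d) : L.ι x ∈ L.grading d :=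
  Submodule.subset_span ⟨[(d, x)], by simpa using hx, by simp, by simp⟩

instance : SetLike.GradedMonoid L.grading where
  one_mem := Submodule.subset_span ⟨[], by simp, by simp, by simp⟩
  mul_mem i j a b ha hb := by
    have h := Submodule.mul_mem_mul ha hb
    rw [grading, grading, Submodule.span_mul_span] at h
    refine Submodule.span_mono ?_ h
    rintro _ ⟨_, ⟨l, hl, rfl, rfl⟩, _, ⟨l', hl', rfl, rfl⟩, rfl⟩
    refine ⟨l ++ l', ?_, by simp, by simp⟩
    intro a ha
    rcases List.mem_append.1 ha with h | h
    · exact hl a h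
    · exact hl' a h

theorem coe_bijective : Function.Bijective (DirectSum.coeLinearMap L.comp) := L.isInternal

/-- The canonical map `g → U(g)`, seen componentwise. -/
def ιGraded : g →ₗ[k] ⨁ d, L.grading d :=
  (DirectSum.toModule k Bideg _ fun d =>
    DirectSum.lof k Bideg (fun d => L.grading d) d ∘ₗ
      (L.ι.restrict fun _ hx => L.ι_mem hx : L.comp d →ₗ[k] L.grading d)) ∘ₗ
    (LinearEquiv.ofBijective (DirectSum.coeLinearMap L.comp) L.coe_bijective).symm.toLinearMap

theorem ιGraded_of_mem {d : Bideg} {x : g} (hx : x ∈ L.comp d) :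
    L.ιGraded x = DirectSum.of (fun d => L.grading d) d ⟨L.ι x, L.ι_mem hx⟩ := by
  have : (LinearEquiv.ofBijective (DirectSum.coeLinearMap L.comp) L.coe_bijective).symm x =
      DirectSum.lof k Bideg (fun d => L.comp d) d ⟨x, hx⟩ := by
    rw [LinearEquiv.symm_apply_eq, LinearEquiv.ofBijective_apply, DirectSum.coeLinearMap_lof]
  simp only [ιGraded, LinearMap.comp_apply, LinearEquiv.coe_coe, this, DirectSum.toModule_lof]
  rfl

theorem of_smul_eq {d : Bideg} (s : ℤˣ) (a : L.grading d) :
    DirectSum.of (fun d => L.grading d) d (s • a) =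
      s • DirectSum.of (fun d => L.grading d) d a := by
  rw [Units.smul_def, Units.smul_def, map_zsmul]

theorem comp_hom_ext {M : Type*} [AddCommGroup M] [Module k M] {f f' : g →ₗ[k] M}
    (h : ∀ (d : Bideg) (x : g), x ∈ L.comp d → f x = f' x) : f = f' := by
  ext x
  have hx : x ∈ ⨆ d, L.comp d := L.isInternal.submodule_iSup_eq_top ▸ Submodule.mem_top
  induction hx using Submodule.iSup_induction' with
  | mem d x hx => exact h d x hx
  | zero => simp
  | add x y _ _ hx hy => rw [map_add, map_add, hx, hy]

theorem ιGraded_mul {i j : Bideg} {x y : g} (hx : x ∈ L.comp i) (hy : y ∈ L.comp j) :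
    L.ιGraded x * L.ιGraded y =
      koszulSign i j • (L.ιGraded y * L.ιGraded x) + L.ιGraded (L.bracket x y) := by
  have e : L.ιGraded y * L.ιGraded x = DirectSum.of (fun d => L.grading d) (i + j)
      ⟨L.ι y * L.ι x, add_comm j i ▸ SetLike.mul_mem_graded (L.ι_mem hy) (L.ι_mem hx)⟩ := by
    rw [L.ιGraded_of_mem hx, L.ιGraded_of_mem hy, DirectSum.of_mul_of]
    exact DirectSum.of_eq_of_gradedMonoid_eq (Sigma.subtype_ext (add_comm j i) rfl)
  rw [e, L.ιGraded_of_mem hx, L.ιGraded_of_mem hy, L.ιGraded_of_mem (L.bracket_mem hx hy),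
    DirectSum.of_mul_of, ← of_smul_eq, ← map_add]
  congr 1
  exact Subtype.ext (L.ι_mul_ι hx hy)

/-- The canonical map from `U(g)` to the direct sum of its components. -/
def liftGraded : L.U →ₐ[k] ⨁ d, L.grading d :=
  L.lift (A := ⨁ d, L.grading d) L.ιGraded fun hx hy => L.ιGraded_mul hx hy

/-- `U(g)` is a graded algebra. -/
instance gradedAlgebra : GradedAlgebra L.grading :=
  GradedAlgebra.ofAlgHom L.grading L.liftGraded
    (by
      apply L.hom_ext
      intro x
      refine LinearMap.congr_fun (f := (DirectSum.coeAlgHom L.grading).toLinearMap ∘ₗ L.ιGraded)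
        (g := L.ι) (L.comp_hom_ext fun d x hx => ?_) x |> (Eq.trans (by simp [liftGraded]))
      simp [L.ιGraded_of_mem hx])
    (by
      rintro d ⟨u, hu⟩
      induction hu using Submodule.span_induction with
      | mem u hu =>
        obtain ⟨l, hl, rfl, rfl⟩ := hu
        induction l with
        | nil => simp; rfl
        | cons a l ih =>
          have ih' := ih (fun b hb => hl b (List.mem_cons_of_mem a hb))
          have ha := hl a (List.mem_cons_self ..)
          simp only [List.map_cons, List.prod_cons, map_mul] at ih' ⊢
          rw [ih', liftGraded, lift_ι, L.ιGraded_of_mem ha, DirectSum.of_mul_of]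
          exact DirectSum.of_eq_of_gradedMonoid_eq (Sigma.subtype_ext List.sum_cons.symm rfl)
      | zero =>
        rw [map_zero]
        exact (map_zero (DirectSum.of (fun d => L.grading d) d)).symm
      | add x y hx hy ihx ihy =>
        simp only [map_add, ihx, ihy]
        rw [← map_add]; rfl
      | smul c x hx ihx =>
        simp only [map_smul, ihx]
        exact ((DirectSum.lof k Bideg (fun d => L.grading d) d).map_smul c _).symm)

/-- The map `x ↦ x ⊗ 1 + 1 ⊗ x` from `g` to the superalgebra `U(g) ⊗ U(g)`, whose product is
`(a ⊗ b)(a' ⊗ b') = (-1) ^ (p(b) p(a')) aa' ⊗ bb'`. -/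
def primitive : g →ₗ[k] (L.grading ᵍ⊗[k] L.grading) :=
  (GradedTensorProduct.includeLeft L.grading L.grading).toLinearMap ∘ₗ L.ι +
    (GradedTensorProduct.includeRight L.grading L.grading).toLinearMap ∘ₗ L.ι

theorem primitive_mul {i j : Bideg} {x y : g} (hx : x ∈ L.comp i) (hy : y ∈ L.comp j) :
    L.primitive x * L.primitive y =
      koszulSign i j • (L.primitive y * L.primitive x) + L.primitive (L.bracket x y) := by
  have h1 := GradedTensorProduct.tmul_coe_mul_coe_tmul (R := k) L.grading L.grading 1
    ⟨L.ι x, L.ι_mem hx⟩ ⟨L.ι y, L.ι_mem hy⟩ 1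
  have h2 := GradedTensorProduct.tmul_coe_mul_coe_tmul (R := k) L.grading L.grading 1
    ⟨L.ι y, L.ι_mem hy⟩ ⟨L.ι x, L.ι_mem hx⟩ 1
  have h3 := GradedTensorProduct.tmul_one_mul_one_tmul (R := k) L.grading L.grading
    (L.ι x) (L.ι y)
  have h4 := GradedTensorProduct.tmul_one_mul_one_tmul (R := k) L.grading L.grading
    (L.ι y) (L.ι x)
  have h5 := congrArg (GradedTensorProduct.includeLeft L.grading L.grading) (L.ι_mul_ι hx hy)
  have h6 := congrArg (GradedTensorProduct.includeRight L.grading L.grading) (L.ι_mul_ι hx hy)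
  rw [Units.smul_def, map_add, map_zsmul, map_mul, map_mul] at h5 h6
  rw [uzpow_bideg] at h1 h2
  have hs : koszulSign j i = koszulSign i j := by rw [koszulSign, koszulSign, mul_comm]
  rw [hs] at h2
  simp only [one_mul, mul_one] at h1 h2
  simp only [primitive, LinearMap.add_apply, LinearMap.comp_apply, AlgHom.toLinearMap_apply,
    mul_add, add_mul, h5, h6, Units.smul_def]
  simp only [GradedTensorProduct.includeLeft_apply, GradedTensorProduct.includeRight_apply]
  rw [h1, h2, h3, h4, Units.smul_def, smul_add, smul_add, smul_add]
  have hss : ((koszulSign i j : ℤˣ) : ℤ) * ((koszulSign i j : ℤˣ) : ℤ) = 1 := by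
    rw [← Units.val_mul, Int.units_mul_self, Units.val_one]
  simp only [Units.smul_def, smul_smul, hss, one_smul]
  abel

/-- The comultiplication of `U(g)` as a map of superalgebras `U(g) → U(g) ⊗ U(g)`: it is determined
by `x ↦ x ⊗ 1 + 1 ⊗ x` for `x ∈ g`. -/
def comulAlgHom : L.U →ₐ[k] (L.grading ᵍ⊗[k] L.grading) :=
  L.lift (A := L.grading ᵍ⊗[k] L.grading) L.primitive fun hx hy => L.primitive_mul hx hy

@[simp]
theorem comulAlgHom_ι (x : g) : L.comulAlgHom (L.ι x) = L.primitive x :=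
  L.lift_ι (A := L.grading ᵍ⊗[k] L.grading) _ _ x

/-- The counit of `U(g)`: the algebra map which kills `g`. -/
def counitAlgHom : L.U →ₐ[k] k := L.lift 0 (by intros; simp)

/-- The coalgebra structure of `U(g)`. -/
instance : CoalgebraStruct k L.U where
  comul := (GradedTensorProduct.of k L.grading L.grading).symm.toLinearMap ∘ₗ
    L.comulAlgHom.toLinearMap
  counit := L.counitAlgHom.toLinearMap

end GradedLieSuperalgebra

/-- The algebra map `U(h) → U(g)` induced by the inclusion of a graded Lie subalgebra. -/
def GradedLieSubalgebra.incl {k g : Type*} [Field k] [AddCommGroup g] [Module k g]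
    {L : GradedLieSuperalgebra k g} (H : GradedLieSubalgebra L) : H.toLie.U →ₐ[k] L.U :=
  H.toLie.lift (L.ι ∘ₗ H.carrier.subtype) fun hx hy => L.ι_mul_ι hx hy

/-- `U(g)` is a left `U(h)`-module, `a` acting as left multiplication by its image in `U(g)`. -/
instance GradedLieSubalgebra.moduleU {k g : Type*} [Field k] [AddCommGroup g] [Module k g]
    {L : GradedLieSuperalgebra k g} (H : GradedLieSubalgebra L) : Module H.toLie.U L.U :=
  Module.compHom L.U H.incl.toRingHom

namespace GradedSuperspace

variable {k V : Type*} [Field k] [AddCommGroup V] [Module k V] (G : GradedSuperspace k V)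

/-- The graded symmetric algebra `Sym(V)`, together with its grading and its coalgebra structure:
the quotient of the tensor algebra by `x ⊗ y - (-1) ^ (p(x) p(y)) y ⊗ x`, which is the enveloping
algebra for the zero bracket. Its product is written `⊙` on paper and `*` here. -/
abbrev Sym : Type _ := G.abelian.U

/-- The components of `Sym(V)`. -/
abbrev symGrading : Bideg → Submodule k G.Sym := G.abelian.grading

/-- The canonical map `V → Sym(V)`. -/
abbrev symι : V →ₗ[k] G.Sym := G.abelian.ι

end GradedSuperspace

section GradedTensor

variable {k A B : Type*} [Field k] [Ring A] [Ring B] [Algebra k A] [Algebra k B]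
  (𝒜 : Bideg → Submodule k A) (ℬ : Bideg → Submodule k B) [GradedAlgebra 𝒜] [GradedAlgebra ℬ]

/-- The braiding `a ⊗ b ↦ (-1) ^ (p(a) p(b)) b ⊗ a`. -/
def superSwap : A ⊗[k] B ≃ₗ[k] B ⊗[k] A :=
  GradedTensorProduct.of k 𝒜 ℬ ≪≫ₗ (GradedTensorProduct.comm 𝒜 ℬ).toLinearEquiv ≪≫ₗ
    (GradedTensorProduct.of k ℬ 𝒜).symm

/-- The map `(a ⊗ a') ⊗ (b ⊗ b') ↦ (-1) ^ (p(a') p(b)) (a ⊗ b) ⊗ (a' ⊗ b')`. -/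
def superMiddleSwap : (A ⊗[k] A) ⊗[k] (B ⊗[k] B) ≃ₗ[k] (A ⊗[k] B) ⊗[k] (A ⊗[k] B) :=
  TensorProduct.assoc k A A (B ⊗[k] B) ≪≫ₗ
    (TensorProduct.congr (LinearEquiv.refl k A)
      ((TensorProduct.assoc k A B B).symm ≪≫ₗ
        TensorProduct.congr (superSwap 𝒜 ℬ) (LinearEquiv.refl k B) ≪≫ₗ
        TensorProduct.assoc k B A B)) ≪≫ₗ
    (TensorProduct.assoc k A B (A ⊗[k] B)).symm

/-- The tensor product of two graded coalgebras:
`Δ(a ⊗ b) = ∑ (-1) ^ (p(a₂) p(b₁)) (a₁ ⊗ b₁) ⊗ (a₂ ⊗ b₂)` and `ε(a ⊗ b) = ε(a) ε(b)`. -/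
instance gradedTensorCoalgebra [CoalgebraStruct k A] [CoalgebraStruct k B] :
    CoalgebraStruct k (𝒜 ᵍ⊗[k] ℬ) where
  comul :=
    (TensorProduct.congr (GradedTensorProduct.of k 𝒜 ℬ)
        (GradedTensorProduct.of k 𝒜 ℬ)).toLinearMap ∘ₗ
      (superMiddleSwap 𝒜 ℬ).toLinearMap ∘ₗ
      TensorProduct.map CoalgebraStruct.comul CoalgebraStruct.comul ∘ₗ
      (GradedTensorProduct.of k 𝒜 ℬ).symm.toLinearMap
  counit :=
    LinearMap.mul' k k ∘ₗ
      TensorProduct.map CoalgebraStruct.counit CoalgebraStruct.counit ∘ₗ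
      (GradedTensorProduct.of k 𝒜 ℬ).symm.toLinearMap

/-- The left `A`-module structure `a • (a' ⊗ b) = aa' ⊗ b` on `A ⊗ B`. -/
instance gradedTensorLeftModule : Module A (𝒜 ᵍ⊗[k] ℬ) :=
  inferInstanceAs (Module A (A ⊗[k] B))

end GradedTensor

end

/-! Bijectivity and compatibility with the coalgebra structures are proved separately.

Bijectivity comes from filtering by the number of factors. Modulo shorter products, homogeneous
elements of `g` supercommute, so symmetrization does not change leading terms, and the map sends the
product of the `x`'s tensor the product of the `y`'s to `x₁ ⋯ x_q y₁ ⋯ y_p` plus shorter products.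
Since factors from `h` can be moved to the front, surjectivity follows by induction on length
(`mulSymmetrize_surjective`). Injectivity needs a linear map `P : U(g) → Sym(g)` that preserves
leading terms (`exists_pbw`). Placing `P` and the algebra map `Sym(g) → Sym(h) ⊗ Sym(m)` after the
map in question, and symmetrization `Sym(h) → U(h)` before it, gives an endomorphism of `Sym(h) ⊗
Sym(m)` which is the identity up to lower filtration and hence injective
(`mulSymmetrize_injective`).

The map `P` is built on the tensor algebra by induction on the degree, as the projection to `Sym(g)`
plus a correction `c`. Respecting the relations in degree `n + 1` means `c(w) = ± c(sᵢ w) + P(w with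
its letters i, i + 1 bracketed)` for each word `w` in a homogeneous basis. So `c` must be fixed by
certain affine maps. These are involutions by skew symmetry, commute at a distance by the relations
in degree `n`, and satisfy the braid relations by the Jacobi identity. In characteristic `0`, an
affine action of a symmetric group has a fixed point, by averaging (`exists_fixed_of_coxeter`). No
ordering of the basis and no normal form is involved.

For the coalgebra part, linear maps from `Sym(V)` to an algebra form an algebra under convolution,
and the symmetrization of `f : V → A` is the convolution exponential of `f` composed with the
projection `Sym(V) → V`. Exponentials turn sums of supercommuting maps into products
(`symmetrize_add`). Applied to `Δ ∘ ι = ι ⊗ 1 + 1 ⊗ ι`, this shows that symmetrization is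
comultiplicative (`comul_symmetrize`); the theorem follows because `Δ` is multiplicative. -/

noncomputable section

/-! ### Koszul signs as scalars -/

section Signs

variable (k : Type*) [Field k]

/-- The scalar in `k` given by a sign. -/
def unitCast : ℤˣ →* k := (Int.castRingHom k).toMonoidHom.comp (Units.coeHom ℤ)

/-- The Koszul sign, as a scalar in `k`. -/
def ksign (i j : Bideg) : k := unitCast k (koszulSign i j)

theorem unitCast_smul {M : Type*} [AddCommGroup M] [Module k M] (s : ℤˣ) (x : M) :
    unitCast k s • x = s • x := by
  rw [Units.smul_def, ← Int.cast_smul_eq_zsmul k]; rfl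

theorem ksign_smul {M : Type*} [AddCommGroup M] [Module k M] (i j : Bideg) (x : M) :
    ksign k i j • x = koszulSign i j • x := unitCast_smul k _ x

theorem unitCast_mul_self (s : ℤˣ) : unitCast k s * unitCast k s = 1 := by
  rw [← map_mul, Int.units_mul_self, map_one]

theorem ksign_mul_self (i j : Bideg) : ksign k i j * ksign k i j = 1 := unitCast_mul_self k _

theorem ksign_comm (i j : Bideg) : ksign k i j = ksign k j i := by
  rw [ksign, ksign, koszulSign, koszulSign, mul_comm]

theorem ksign_add_left (i i' j : Bideg) : ksign k (i + i') j = ksign k i j * ksign k i' j := by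
  rw [ksign, ksign, ksign, ← map_mul, koszulSign, koszulSign, koszulSign, Prod.snd_add, add_mul,
    uzpow_add]

theorem ksign_add_right (i j j' : Bideg) : ksign k i (j + j') = ksign k i j * ksign k i j' := by
  rw [ksign_comm, ksign_add_left, ksign_comm, ksign_comm k j']

theorem ksign_zero_right (i : Bideg) : ksign k i 0 = 1 := by
  simp [ksign, koszulSign]

theorem ksign_zero_left (i : Bideg) : ksign k 0 i = 1 := by
  rw [ksign_comm, ksign_zero_right]

end Signs

/-! ### The filtration of the enveloping algebra by number of factors -/

namespace GradedLieSuperalgebra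

variable {k g : Type*} [Field k] [AddCommGroup g] [Module k g] (L : GradedLieSuperalgebra k g)

theorem bracket_skew {i j : Bideg} {x y : g} (hx : x ∈ L.comp i) (hy : y ∈ L.comp j) :
    L.bracket x y = -(ksign k i j • L.bracket y x) := by
  rw [ksign_smul]; exact L.skew hx hy

theorem bracket_jacobi {i j l : Bideg} {x y z : g} (hx : x ∈ L.comp i) (hy : y ∈ L.comp j)
    (hz : z ∈ L.comp l) : L.bracket x (L.bracket y z) =
      L.bracket (L.bracket x y) z + ksign k i j • L.bracket y (L.bracket x z) := by
  rw [ksign_smul]; exact L.jacobi hx hy hz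

theorem ι_mul_ι_eq {i j : Bideg} {x y : g} (hx : x ∈ L.comp i) (hy : y ∈ L.comp j) :
    L.ι x * L.ι y = ksign k i j • (L.ι y * L.ι x) + L.ι (L.bracket x y) := by
  rw [ksign_smul]; exact L.ι_mul_ι hx hy

/-- A list of elements of `g`, each homogeneous of the indicated bidegree. -/
def IsHomog (l : List (Bideg × g)) : Prop := ∀ a ∈ l, a.2 ∈ L.comp a.1

/-- The product in `U(g)` of a list of elements of `g`. -/
def prodι (l : List (Bideg × g)) : L.U := (l.map fun a => L.ι a.2).prod

variable {L} in
theorem isHomog_cons {a : Bideg × g} {l : List (Bideg × g)} :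
    L.IsHomog (a :: l) ↔ a.2 ∈ L.comp a.1 ∧ L.IsHomog l := by simp [IsHomog]

variable {L} in
theorem isHomog_append {l l' : List (Bideg × g)} :
    L.IsHomog (l ++ l') ↔ L.IsHomog l ∧ L.IsHomog l' := by
  simp [IsHomog, or_imp, forall_and]

variable {L} in
theorem isHomog_nil : L.IsHomog [] := by simp [IsHomog]

@[simp] theorem prodι_nil : L.prodι [] = 1 := rfl

@[simp] theorem prodι_cons (a : Bideg × g) (l : List (Bideg × g)) :
    L.prodι (a :: l) = L.ι a.2 * L.prodι l := by simp [prodι]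

@[simp] theorem prodι_append (l l' : List (Bideg × g)) :
    L.prodι (l ++ l') = L.prodι l * L.prodι l' := by simp [prodι]

theorem prodι_mem_grading {l : List (Bideg × g)} (hl : L.IsHomog l) :
    L.prodι l ∈ L.grading (l.map Prod.fst).sum :=
  Submodule.subset_span ⟨l, hl, rfl, rfl⟩

theorem span_prodι : Submodule.span k {u | ∃ l, L.IsHomog l ∧ u = L.prodι l} = ⊤ := by
  rw [eq_top_iff, ← (DirectSum.Decomposition.isInternal L.grading).submodule_iSup_eq_top]
  refine iSup_le fun d => Submodule.span_mono ?_
  rintro _ ⟨l, hl, -, rfl⟩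
  exact ⟨l, hl, rfl⟩

/-- Linear maps from `U(g)` are determined by their values on products of homogeneous elements. -/
theorem linearMap_ext {M : Type*} [AddCommGroup M] [Module k M] {f f' : L.U →ₗ[k] M}
    (h : ∀ l, L.IsHomog l → f (L.prodι l) = f' (L.prodι l)) : f = f' :=
  LinearMap.ext_on L.span_prodι (by rintro _ ⟨l, hl, rfl⟩; exact h l hl)

/-- Two linear maps from `U(g)` which agree on `1` agree if their agreement on `a` implies their
agreement on `ι x * a`. -/
theorem linearMap_ext_mul {M : Type*} [AddCommGroup M] [Module k M] {f f' : L.U →ₗ[k] M}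
    (h1 : f 1 = f' 1)
    (h : ∀ (d e : Bideg) (x : g) (a : L.U), x ∈ L.comp d → a ∈ L.grading e → f a = f' a →
      f (L.ι x * a) = f' (L.ι x * a)) : f = f' := by
  refine L.linearMap_ext fun l hl => ?_
  induction l with
  | nil => exact h1
  | cons a l ih =>
    rw [isHomog_cons] at hl
    rw [prodι_cons]
    exact h a.1 _ a.2 _ hl.1 (L.prodι_mem_grading hl.2) (ih hl.2)

/-- The span of the products of fewer than `n` homogeneous elements of `g`. -/
def fil (n : ℕ) : Submodule k L.U :=
  Submodule.span k {u | ∃ l, L.IsHomog l ∧ l.length < n ∧ u = L.prodι l}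

theorem fil_zero : L.fil 0 = ⊥ := by simp [fil]

theorem prodι_mem_fil {l : List (Bideg × g)} (hl : L.IsHomog l) {n : ℕ} (hn : l.length < n) :
    L.prodι l ∈ L.fil n := Submodule.subset_span ⟨l, hl, hn, rfl⟩

theorem fil_mono : Monotone L.fil := fun m n h => Submodule.span_mono (by
  rintro _ ⟨l, hl, hn, rfl⟩; exact ⟨l, hl, hn.trans_le h, rfl⟩)

/-- The index of `fil` is a strict bound on the length, so one unit is lost in a product. This form
and the mirrored one let the index of either factor be `0`, which is how error terms occur. -/
theorem mul_mem_fil {m n : ℕ} {a b : L.U} (ha : a ∈ L.fil m) (hb : b ∈ L.fil (n + 1)) :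
    a * b ∈ L.fil (m + n) := by
  have h := Submodule.mul_mem_mul ha hb
  rw [fil, fil, Submodule.span_mul_span] at h
  refine Submodule.span_mono ?_ h
  rintro _ ⟨_, ⟨l, hl, hn, rfl⟩, _, ⟨l', hl', hn', rfl⟩, rfl⟩
  exact ⟨l ++ l', isHomog_append.2 ⟨hl, hl'⟩, by rw [List.length_append]; omega, by simp⟩

theorem mul_mem_fil' {m n : ℕ} {a b : L.U} (ha : a ∈ L.fil (m + 1)) (hb : b ∈ L.fil n) :
    a * b ∈ L.fil (m + n) := by
  have h := Submodule.mul_mem_mul ha hb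
  rw [fil, fil, Submodule.span_mul_span] at h
  refine Submodule.span_mono ?_ h
  rintro _ ⟨_, ⟨l, hl, hn, rfl⟩, _, ⟨l', hl', hn', rfl⟩, rfl⟩
  exact ⟨l ++ l', isHomog_append.2 ⟨hl, hl'⟩, by rw [List.length_append]; omega, by simp⟩

theorem exists_mem_fil (u : L.U) : ∃ n, u ∈ L.fil n := by
  have hu : u ∈ Submodule.span k {u | ∃ l, L.IsHomog l ∧ u = L.prodι l} := by
    rw [span_prodι]; trivial
  induction hu using Submodule.span_induction with
  | mem u hu =>
    obtain ⟨l, hl, rfl⟩ := hu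
    exact ⟨_, L.prodι_mem_fil hl (Nat.lt_succ_self _)⟩
  | zero => exact ⟨0, zero_mem _⟩
  | add a b _ _ ha hb =>
    obtain ⟨m, hm⟩ := ha
    obtain ⟨n, hn⟩ := hb
    exact ⟨max m n, add_mem (L.fil_mono (le_max_left ..) hm) (L.fil_mono (le_max_right ..) hn)⟩
  | smul c a _ ha =>
    obtain ⟨m, hm⟩ := ha
    exact ⟨m, Submodule.smul_mem _ _ hm⟩

theorem ι_mem_fil (x : g) : L.ι x ∈ L.fil 2 := by
  have hx : x ∈ ⨆ d, L.comp d := L.isInternal.submodule_iSup_eq_top ▸ Submodule.mem_top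
  induction hx using Submodule.iSup_induction' with
  | mem d x hx =>
    have := L.prodι_mem_fil (l := [(d, x)]) (n := 2) (by simpa [IsHomog] using hx) (by simp)
    simpa using this
  | zero => simp
  | add x y _ _ hx hy => rw [map_add]; exact add_mem hx hy

/-- Leading terms multiply: telescoping leaves one error term in each summand. -/
theorem mul_sub_mul_mem_fil {m n : ℕ} {a a' b b' : L.U} (hb : b ∈ L.fil (n + 1))
    (ha' : a' ∈ L.fil (m + 1)) (ha : a - a' ∈ L.fil m) (hbb : b - b' ∈ L.fil n) :
    a * b - a' * b' ∈ L.fil (m + n) := by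
  have : a * b - a' * b' = (a - a') * b + a' * (b - b') := by noncomm_ring
  rw [this]
  exact add_mem (L.mul_mem_fil ha hb) (L.mul_mem_fil' ha' hbb)

/-- Homogeneous elements supercommute up to shorter products. -/
theorem ι_mul_swap_mem_fil {i j : Bideg} {x y : g} (hx : x ∈ L.comp i) (hy : y ∈ L.comp j)
    {n : ℕ} {a : L.U} (ha : a ∈ L.fil (n + 1)) :
    ksign k i j • (L.ι x * (L.ι y * a)) - L.ι y * (L.ι x * a) ∈ L.fil (n + 2) := by
  have : ksign k i j • (L.ι x * (L.ι y * a)) - L.ι y * (L.ι x * a) =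
      ksign k i j • (L.ι (L.bracket x y) * a) := by
    rw [← mul_assoc, L.ι_mul_ι_eq hx hy, add_mul, smul_add, smul_mul_assoc, smul_smul,
      ksign_mul_self, one_smul, mul_assoc]
    abel
  rw [this, add_comm]
  exact Submodule.smul_mem _ _ (L.mul_mem_fil (L.ι_mem_fil _) ha)

/-- A permutation is a chain of adjacent swaps, each costing a sign and a shorter product.
Surjectivity only needs some scalar, so the sign is not tracked here. -/
theorem exists_smul_prodι_sub_mem_fil {l l' : List (Bideg × g)} (h : l.Perm l')
    (hl : L.IsHomog l) : ∃ c : k, L.prodι l - c • L.prodι l' ∈ L.fil l.length := by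
  induction h with
  | nil => exact ⟨1, by simp⟩
  | @cons a l l' h ih =>
    rw [isHomog_cons] at hl
    obtain ⟨c, hc⟩ := ih hl.2
    refine ⟨c, ?_⟩
    rw [prodι_cons, prodι_cons, ← mul_smul_comm, ← mul_sub, List.length_cons, add_comm]
    exact L.mul_mem_fil' (L.ι_mem_fil _) hc
  | swap a b l =>
    rw [isHomog_cons, isHomog_cons] at hl
    refine ⟨ksign k a.1 b.1, ?_⟩
    have := L.ι_mul_swap_mem_fil hl.2.1 hl.1 (L.prodι_mem_fil hl.2.2 (Nat.lt_succ_self _))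
    rw [← neg_mem_iff, neg_sub]
    simpa using this
  | @trans l l' l'' h h' ih ih' =>
    obtain ⟨c, hc⟩ := ih hl
    obtain ⟨c', hc'⟩ := ih' (fun a ha => hl a (h.mem_iff.2 ha))
    refine ⟨c * c', ?_⟩
    rw [← h.length_eq] at hc'
    have : L.prodι l - (c * c') • L.prodι l'' =
      (L.prodι l - c • L.prodι l') + c • (L.prodι l' - c' • L.prodι l'') := by module
    rw [this]
    exact add_mem hc (Submodule.smul_mem _ _ hc')

end GradedLieSuperalgebra

/-! ### Fixed points of affine actions of symmetric groups -/

section Averaging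

variable {k X : Type*} [Field k] [CharZero k] [AddCommGroup X] [Module k X]

/-- Affine maps which satisfy the relations of the simple transpositions of a symmetric group have
a common fixed point. -/
theorem exists_fixed_of_coxeter (s : ℕ → X →ₗ[k] X) (β : ℕ → X) (σ : ℕ → X → X)
    (hσ : ∀ i x, σ i x = s i x + β i) (N : Submodule k X) (n : ℕ)
    (h1 : ∀ i < n, ∀ x, σ i (σ i x) = x)
    (h2 : ∀ i j, i + 1 < j → j < n → ∀ x, σ i (σ j x) = σ j (σ i x))
    (h3 : ∀ i, i + 1 < n → ∀ x, σ i (σ (i + 1) (σ i x)) = σ (i + 1) (σ i (σ (i + 1) x)))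
    (hN : ∀ i < n, ∀ x ∈ N, σ i x ∈ N) : ∃ x ∈ N, ∀ i < n, σ i x = x := by
  suffices h : ∀ m ≤ n, ∃ x ∈ N, ∀ i < m, σ i x = x from h n le_rfl
  intro m
  induction m with
  | zero => exact fun _ => ⟨0, zero_mem _, by simp⟩
  | succ m ih =>
    intro hm
    obtain ⟨x, hxN, hx⟩ := ih (by omega)
    -- The point `x` is fixed by the subgroup generated by `σ 0, …, σ (m - 1)`, so its orbit under
    -- one more generator is given by `m + 2` coset representatives; `t r` is the image of `x` under
    -- the `r`-th one. The map `σ i` exchanges `t (m - i)` with `t (m - i + 1)` and fixes the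
    -- others.
    let t : ℕ → X := fun r => Nat.rec x (fun r y => σ (m - r) y) r
    have t_zero : t 0 = x := rfl
    have t_succ : ∀ r, t (r + 1) = σ (m - r) (t r) := fun r => rfl
    have low : ∀ r i, i + r < m → σ i (t r) = t r := by
      intro r
      induction r with
      | zero => intro i hi; rw [t_zero, hx i (by omega)]
      | succ r ihr =>
        intro i hi
        rw [t_succ, h2 i (m - r) (by omega) (by omega), ihr i (by omega)]
    have at0 : ∀ r, r ≤ m → σ (m - r) (t r) = t (r + 1) := fun r _ => rfl
    have at1 : ∀ r, r ≤ m → σ (m - r) (t (r + 1)) = t r := by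
      intro r hr
      rw [t_succ, h1 _ (by omega)]
    -- For `e = 0` this is the braid relation at `t r₀`, which is fixed by `σ (m - r₀ - 1)`; beyond
    -- that, distant generators commute.
    have high : ∀ r₀ e, r₀ + 2 + e ≤ m + 1 → σ (m - r₀) (t (r₀ + 2 + e)) = t (r₀ + 2 + e) := by
      intro r₀ e
      induction e with
      | zero =>
        intro he
        have h := h3 (m - (r₀ + 1)) (by omega) (t r₀)
        rw [low r₀ _ (by omega), show m - (r₀ + 1) + 1 = m - r₀ by omega] at h
        rw [add_zero, t_succ, t_succ, ← h]
      | succ e ihe =>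
        intro he
        rw [← add_assoc, t_succ, ← h2 _ _ (by omega) (by omega), ihe (by omega)]
    have tN : ∀ r, r ≤ m + 1 → t r ∈ N := by
      intro r
      induction r with
      | zero => exact fun _ => hxN
      | succ r ihr => exact fun hr => hN _ (by omega) _ (ihr (by omega))
    have hc : ((m + 2 : ℕ) : k) ≠ 0 := Nat.cast_ne_zero.2 (by omega)
    refine ⟨((m + 2 : ℕ) : k)⁻¹ • ∑ r : Fin (m + 2), t r,
      Submodule.smul_mem _ _ (Submodule.sum_mem _ fun r _ => tN r (by omega)), ?_⟩
    intro i hi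
    -- An affine map commutes with an average because the weights add up to `1`.
    have key : σ i (((m + 2 : ℕ) : k)⁻¹ • ∑ r : Fin (m + 2), t r) =
        ((m + 2 : ℕ) : k)⁻¹ • ∑ r : Fin (m + 2), σ i (t r) := by
      simp only [hσ, map_smul, map_sum, Finset.sum_add_distrib, smul_add, Finset.sum_const,
        Finset.card_univ, Fintype.card_fin]
      rw [← Nat.cast_smul_eq_nsmul k, smul_smul, inv_mul_cancel₀ hc, one_smul]
    rw [key]
    congr 1
    have ha : m - i < m + 2 := by omega
    have hb : m - i + 1 < m + 2 := by omega
    rw [← Equiv.sum_comp (Equiv.swap (⟨m - i, ha⟩ : Fin (m + 2)) ⟨m - i + 1, hb⟩)]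
    refine Finset.sum_congr rfl fun r _ => ?_
    have him : i = m - (m - i) := by omega
    by_cases hr0 : r = ⟨m - i, ha⟩
    · subst hr0
      rw [Equiv.swap_apply_left]
      have := at1 (m - i) (by omega)
      rwa [← him] at this
    by_cases hr1 : r = ⟨m - i + 1, hb⟩
    · subst hr1
      rw [Equiv.swap_apply_right]
      have := at0 (m - i) (by omega)
      rwa [← him] at this
    rw [Equiv.swap_apply_of_ne_of_ne hr0 hr1]
    rw [Fin.ext_iff] at hr0 hr1
    simp only at hr0 hr1
    rcases lt_or_ge r.val (m - i) with h | h
    · exact low _ _ (by omega)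
    · have := high (m - i) (r - (m - i) - 2) (by omega)
      rwa [← him, show m - i + 2 + (r.val - (m - i) - 2) = r by omega] at this

end Averaging

/-! ### Adjacent transpositions of words, and words in the tensor algebra -/

namespace List

variable {I : Type*}

/-- Exchange the entries of a list in positions `i` and `i + 1`. -/
def swapAdj : ℕ → List I → List I
  | 0, a :: b :: l => b :: a :: l
  | i + 1, a :: l => a :: swapAdj i l
  | _, l => l

theorem swapAdj_append (u : List I) (a b : I) (v : List I) :
    swapAdj u.length (u ++ a :: b :: v) = u ++ b :: a :: v := by
  induction u with
  | nil => rfl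
  | cons c u ih => simp [swapAdj, ih]

theorem length_swapAdj (i : ℕ) (l : List I) : (swapAdj i l).length = l.length := by
  fun_induction swapAdj i l <;> simp_all

theorem exists_eq_append_of_lt {i : ℕ} {l : List I} (h : i + 1 < l.length) :
    ∃ (u : List I) (a b : I) (v : List I), l = u ++ a :: b :: v ∧ u.length = i := by
  induction i generalizing l with
  | zero =>
    match l, h with
    | a :: b :: v, _ => exact ⟨[], a, b, v, rfl, rfl⟩
  | succ i ih =>
    match l, h with
    | c :: l, h =>
      obtain ⟨u, a, b, v, rfl, rfl⟩ := ih (l := l) (by simpa using h)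
      exact ⟨c :: u, a, b, v, rfl, rfl⟩

end List

section TensorWords

variable {k g I : Type*} [Field k] [AddCommGroup g] [Module k g]

variable (k g) in
/-- The span in the tensor algebra of the products of `n` elements of `g`. -/
def tensorDeg (n : ℕ) : Submodule k (TensorAlgebra k g) :=
  LinearMap.range (TensorAlgebra.ι k : g →ₗ[k] TensorAlgebra k g) ^ n

theorem ι_mem_tensorDeg (x : g) : TensorAlgebra.ι k x ∈ tensorDeg k g 1 := by
  rw [tensorDeg, pow_one]; exact LinearMap.mem_range_self _ x

theorem mul_mem_tensorDeg {m n : ℕ} {a b : TensorAlgebra k g} (ha : a ∈ tensorDeg k g m)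
    (hb : b ∈ tensorDeg k g n) : a * b ∈ tensorDeg k g (m + n) := by
  rw [tensorDeg, pow_add]; exact Submodule.mul_mem_mul ha hb

theorem ι_mul_mem_tensorDeg {n : ℕ} (x : g) {a : TensorAlgebra k g} (ha : a ∈ tensorDeg k g n) :
    TensorAlgebra.ι k x * a ∈ tensorDeg k g (n + 1) := by
  rw [add_comm]; exact mul_mem_tensorDeg (ι_mem_tensorDeg x) ha

/-- The product in the tensor algebra of a list of basis vectors. -/
def tensorWord (b : Module.Basis I k g) (w : List I) : TensorAlgebra k g :=
  (w.map fun i => TensorAlgebra.ι k (b i)).prod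

variable (b : Module.Basis I k g)

@[simp] theorem tensorWord_nil : tensorWord b [] = 1 := rfl

@[simp] theorem tensorWord_cons (i : I) (w : List I) :
    tensorWord b (i :: w) = TensorAlgebra.ι k (b i) * tensorWord b w := by simp [tensorWord]

@[simp] theorem tensorWord_append (w w' : List I) :
    tensorWord b (w ++ w') = tensorWord b w * tensorWord b w' := by simp [tensorWord]

theorem tensorWord_mem (w : List I) : tensorWord b w ∈ tensorDeg k g w.length := by
  induction w with
  | nil => simp [tensorDeg]
  | cons i w ih => rw [tensorWord_cons, List.length_cons]; exact ι_mul_mem_tensorDeg _ ih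

theorem tensorDeg_le_span (n : ℕ) :
    tensorDeg k g n ≤ Submodule.span k {t | ∃ w : List I, w.length = n ∧ t = tensorWord b w} := by
  induction n with
  | zero =>
    rw [tensorDeg, pow_zero, Submodule.one_eq_span]
    exact Submodule.span_mono (by rintro _ rfl; exact ⟨[], rfl, rfl⟩)
  | succ n ih =>
    intro t ht
    rw [tensorDeg, pow_succ'] at ht
    refine Submodule.mul_induction_on ht ?_ fun _ _ ha hb => add_mem ha hb
    rintro _ ⟨x, rfl⟩ a ha
    have hx : TensorAlgebra.ι k x ∈
        Submodule.span k (Set.range fun i => TensorAlgebra.ι k (b i)) := by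
      have := Submodule.mem_map_of_mem (f := TensorAlgebra.ι k) (b.mem_span x)
      rwa [Submodule.map_span, ← Set.range_comp] at this
    have h := Submodule.mul_mem_mul hx (ih ha)
    rw [Submodule.span_mul_span] at h
    refine Submodule.span_mono ?_ h
    rintro _ ⟨_, ⟨i, rfl⟩, _, ⟨w, rfl, rfl⟩, rfl⟩
    exact ⟨i :: w, rfl, by simp⟩

/-- The library basis is indexed by the free monoid; once it is known to consist of the words,
linear maps can be prescribed on words. -/
theorem basis_tensorAlgebra_apply (w : List I) :
    b.tensorAlgebra (FreeMonoid.ofList w) = tensorWord b w := by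
  have h : ∀ w : FreeMonoid I, b.tensorAlgebra w = (TensorAlgebra.equivFreeAlgebra b).symm
      (FreeAlgebra.equivMonoidAlgebraFreeMonoid.symm (MonoidAlgebra.of k _ w)) := fun w => by
    simp [Module.Basis.tensorAlgebra, FreeAlgebra.basisFreeMonoid]
  rw [h]
  induction w with
  | nil => rw [FreeMonoid.ofList_nil, map_one, map_one, map_one, tensorWord_nil]
  | cons i w ih =>
    rw [FreeMonoid.ofList_cons, map_mul, map_mul, map_mul, ih, tensorWord_cons]
    congr 1
    simp [FreeAlgebra.equivMonoidAlgebraFreeMonoid]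

/-- A linear map from the tensor algebra may be prescribed on the products of basis vectors. -/
theorem exists_linearMap_tensorWord {S : Type*} [AddCommGroup S] [Module k S] (f : List I → S) :
    ∃ F : TensorAlgebra k g →ₗ[k] S, ∀ w, F (tensorWord b w) = f w :=
  ⟨b.tensorAlgebra.constr k fun w => f (FreeMonoid.toList w), fun w => by
    rw [← basis_tensorAlgebra_apply, Module.Basis.constr_basis, FreeMonoid.toList_ofList]⟩

theorem span_tensorWord :
    Submodule.span k {t | ∃ w : List I, t = tensorWord b w} = ⊤ := by
  rw [eq_top_iff, ← b.tensorAlgebra.span_eq]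
  refine Submodule.span_mono ?_
  rintro _ ⟨w, rfl⟩
  exact ⟨w.toList, basis_tensorAlgebra_apply b w.toList⟩

end TensorWords

/-! ### Relations in bounded tensor degree and the affine swaps -/

namespace GradedLieSuperalgebra

variable {k g I S : Type*} [Field k] [AddCommGroup g] [Module k g] (L : GradedLieSuperalgebra k g)
  [AddCommGroup S] [Module k S]

/-- A linear map on the tensor algebra respects, in tensor degrees at most `n`, the defining
relations of the enveloping algebra. -/
def RespectsRel (n : ℕ) (P : TensorAlgebra k g →ₗ[k] S) : Prop :=
  ∀ p q, p + q + 2 ≤ n → ∀ u ∈ tensorDeg k g p, ∀ v ∈ tensorDeg k g q, ∀ (i j : Bideg) (x y : g),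
    x ∈ L.comp i → y ∈ L.comp j →
      P (u * (TensorAlgebra.ι k x * (TensorAlgebra.ι k y * v))) =
        ksign k i j • P (u * (TensorAlgebra.ι k y * (TensorAlgebra.ι k x * v))) +
          P (u * (TensorAlgebra.ι k (L.bracket x y) * v))

/-- A homogeneous basis of `g`, with the bidegrees of its elements. -/
structure HomogBasis (I : Type*) where
  basis : Module.Basis I k g
  deg : I → Bideg
  mem : ∀ i, basis i ∈ L.comp (deg i)
  le_span : ∀ d, L.comp d ≤ Submodule.span k {x | ∃ i, deg i = d ∧ x = basis i}

/-- Bases of the components are collected into one basis; the elements coming from the component of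
bidegree `d` already span it. -/
theorem exists_homogBasis :
    Nonempty (L.HomogBasis (Σ d : Bideg, Module.Basis.ofVectorSpaceIndex k (L.comp d))) := by
  let v := fun d : Bideg => Module.Basis.ofVectorSpace k (L.comp d)
  refine ⟨⟨L.isInternal.collectedBasis v, Sigma.fst, fun i => L.isInternal.collectedBasis_mem v i,
    fun d x hx => ?_⟩⟩
  have h : (⟨x, hx⟩ : L.comp d) ∈ Submodule.span k (Set.range (v d)) := by
    rw [(v d).span_eq]; trivial
  have h' := Submodule.mem_map_of_mem (f := (L.comp d).subtype) h
  rw [Submodule.map_span] at h'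
  refine Submodule.span_mono ?_ h'
  rintro _ ⟨_, ⟨j, rfl⟩, rfl⟩
  exact ⟨⟨d, j⟩, rfl, by rw [L.isInternal.collectedBasis_coe]; rfl⟩

variable {L} (B : L.HomogBasis I)

/-- The relation is linear in each of `u`, `v`, `x`, `y`, with a fixed sign once the bidegrees are
fixed, so it can be tested on basis vectors. -/
theorem HomogBasis.respectsRel_of_tensorWord {n : ℕ} {P : TensorAlgebra k g →ₗ[k] S}
    (h : ∀ (u v : List I) (a b : I), u.length + v.length + 2 ≤ n →
      P (tensorWord B.basis (u ++ a :: b :: v)) =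
        ksign k (B.deg a) (B.deg b) • P (tensorWord B.basis (u ++ b :: a :: v)) +
          P (tensorWord B.basis u * (TensorAlgebra.ι k (L.bracket (B.basis a) (B.basis b)) *
            tensorWord B.basis v))) : L.RespectsRel n P := by
  intro p q hpq u hu v hv i j x y hx hy
  have hu' := tensorDeg_le_span B.basis p hu
  clear hu
  induction hu' using Submodule.span_induction with
  | zero => simp
  | add u u' _ _ hu hu' => simp only [add_mul, map_add, hu, hu']; module
  | smul c u _ hu => simp only [smul_mul_assoc, map_smul, hu]; module
  | mem u hu =>
  obtain ⟨u, rfl, rfl⟩ := hu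
  have hv' := tensorDeg_le_span B.basis q hv
  clear hv
  induction hv' using Submodule.span_induction with
  | zero => simp
  | add u u' _ _ hu hu' => simp only [mul_add, map_add, hu, hu']; module
  | smul c u _ hu => simp only [mul_smul_comm, map_smul, hu]; module
  | mem v hv =>
  obtain ⟨v, rfl, rfl⟩ := hv
  have hx' := B.le_span i hx
  clear hx
  induction hx' using Submodule.span_induction with
  | zero => simp
  | add u u' _ _ hu hu' =>
    simp only [mul_add, add_mul, map_add, LinearMap.add_apply, hu, hu']; module
  | smul c u _ hu =>
    simp only [mul_smul_comm, smul_mul_assoc, map_smul, LinearMap.smul_apply, hu]; module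
  | mem x hx =>
  obtain ⟨a, rfl, rfl⟩ := hx
  have hy' := B.le_span j hy
  clear hy
  induction hy' using Submodule.span_induction with
  | zero => simp
  | add u u' _ _ hu hu' => simp only [mul_add, add_mul, map_add, hu, hu']; module
  | smul c u _ hu => simp only [mul_smul_comm, smul_mul_assoc, map_smul, hu]; module
  | mem y hy =>
  obtain ⟨b, rfl, rfl⟩ := hy
  simpa using h u v a b hpq

/-- The Koszul sign of the entries of a word in positions `i` and `i + 1`. -/
def HomogBasis.signAdj (B : L.HomogBasis I) : ℕ → List I → k
  | 0, a :: b :: _ => ksign k (B.deg a) (B.deg b)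
  | i + 1, _ :: l => B.signAdj i l
  -- Out of range, this default and the `0` of `bracketAdj` make `affineSwap` the identity; the
  -- relations are only used for positions inside the word.
  | _, _ => 1

/-- Replace the entries of a word in positions `i` and `i + 1` by their bracket. -/
def HomogBasis.bracketAdj (B : L.HomogBasis I) : ℕ → List I → TensorAlgebra k g
  | 0, a :: b :: l =>
    TensorAlgebra.ι k (L.bracket (B.basis a) (B.basis b)) * tensorWord B.basis l
  | i + 1, a :: l => TensorAlgebra.ι k (B.basis a) * B.bracketAdj i l
  | _, _ => 0

theorem HomogBasis.signAdj_append (u v : List I) (a b : I) :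
    B.signAdj u.length (u ++ a :: b :: v) = ksign k (B.deg a) (B.deg b) := by
  induction u with
  | nil => rfl
  | cons c u ih => simpa [HomogBasis.signAdj] using ih

theorem HomogBasis.bracketAdj_append (u v : List I) (a b : I) :
    B.bracketAdj u.length (u ++ a :: b :: v) = tensorWord B.basis u *
      (TensorAlgebra.ι k (L.bracket (B.basis a) (B.basis b)) * tensorWord B.basis v) := by
  induction u with
  | nil => simp [HomogBasis.bracketAdj]
  | cons c u ih => simp [HomogBasis.bracketAdj, ih, mul_assoc]

theorem HomogBasis.bracketAdj_mem (i n : ℕ) (l : List I) (hl : l.length = n + 1) :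
    B.bracketAdj i l ∈ tensorDeg k g n := by
  by_cases h : i + 1 < l.length
  · obtain ⟨u, a, b, v, rfl, rfl⟩ := List.exists_eq_append_of_lt h
    rw [bracketAdj_append]
    have := mul_mem_tensorDeg (tensorWord_mem B.basis u)
      (ι_mul_mem_tensorDeg (L.bracket (B.basis a) (B.basis b)) (tensorWord_mem B.basis v))
    simp only [List.length_append, List.length_cons] at hl
    rwa [show u.length + (v.length + 1) = n by omega] at this
  · suffices B.bracketAdj i l = 0 by rw [this]; exact zero_mem _
    clear hl
    fun_induction HomogBasis.bracketAdj B i l <;> simp_all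

/-- The affine maps whose common fixed points are the corrections, in tensor degree `n`, which make
a linear map on the tensor algebra respect the relations of the enveloping algebra. -/
def HomogBasis.affineSwap (P : TensorAlgebra k g →ₗ[k] S) (n i : ℕ)
    (c : {w : List I // w.length = n} → S) : {w : List I // w.length = n} → S := fun w =>
  B.signAdj i w.1 • c ⟨w.1.swapAdj i, (List.length_swapAdj i w.1).trans w.2⟩ +
    P (B.bracketAdj i w.1)

theorem HomogBasis.affineSwap_append (P : TensorAlgebra k g →ₗ[k] S) (n i : ℕ)
    (c : {w : List I // w.length = n} → S) (u v : List I) (a b : I) (hu : u.length = i)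
    (h : (u ++ a :: b :: v).length = n) (h' : (u ++ b :: a :: v).length = n) :
    B.affineSwap P n i c ⟨u ++ a :: b :: v, h⟩ =
      ksign k (B.deg a) (B.deg b) • c ⟨u ++ b :: a :: v, h'⟩ +
        P (tensorWord B.basis u * (TensorAlgebra.ι k (L.bracket (B.basis a) (B.basis b)) *
          tensorWord B.basis v)) := by
  subst hu
  simp only [affineSwap, signAdj_append, bracketAdj_append, List.swapAdj_append]

/-- The two Koszul signs cancel, and so do the two bracket terms, by skew symmetry. No hypothesis on
`P` is needed. -/
theorem HomogBasis.affineSwap_self (P : TensorAlgebra k g →ₗ[k] S) (n i : ℕ)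
    (hi : i + 1 < n) (c : {w : List I // w.length = n} → S) :
    B.affineSwap P n i (B.affineSwap P n i c) = c := by
  funext ⟨w, hw⟩
  obtain ⟨u, a, b, v, rfl, hu⟩ := List.exists_eq_append_of_lt (hw ▸ hi)
  have hw' : (u ++ b :: a :: v).length = n := by simpa using hw
  rw [affineSwap_append B P n i _ u v a b hu hw hw', affineSwap_append B P n i _ u v b a hu hw' hw,
    L.bracket_skew (B.mem a) (B.mem b), ksign_comm k (B.deg b)]
  simp only [map_neg, map_smul, neg_mul, mul_neg, smul_mul_assoc, mul_smul_comm, smul_add,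
    smul_smul, ksign_mul_self, one_smul]
  abel

/-- The two orders differ by values of `P` on words with one pair bracketed and the other pair
exchanged. These have length `n`, where `P` respects the relations, and both sides acquire the same
word with both pairs bracketed. -/
theorem HomogBasis.affineSwap_comm {P : TensorAlgebra k g →ₗ[k] S} {n : ℕ}
    (hP : L.RespectsRel n P) (i j : ℕ) (hij : i + 1 < j) (hj : j < n)
    (c : {w : List I // w.length = n + 1} → S) :
    B.affineSwap P (n + 1) i (B.affineSwap P (n + 1) j c) =
      B.affineSwap P (n + 1) j (B.affineSwap P (n + 1) i c) := by
  funext ⟨w, hw⟩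
  obtain ⟨w, e, f, r, rfl, hu⟩ := List.exists_eq_append_of_lt (l := w) (i := j) (by omega)
  obtain ⟨u, a, b, v, rfl, hi⟩ := List.exists_eq_append_of_lt (l := w) (i := i) (by omega)
  have hj : ∀ x y, (u ++ x :: y :: v).length = j := fun x y => by simpa using hu
  have e1 : ∀ x y z t, (u ++ x :: y :: v) ++ z :: t :: r = u ++ x :: y :: (v ++ z :: t :: r) := by
    simp
  have hl : ∀ x y z t, (u ++ x :: y :: (v ++ z :: t :: r)).length = n + 1 := by
    intro x y z t; simpa using hw
  have hl' : ∀ x y z t, ((u ++ x :: y :: v) ++ z :: t :: r).length = n + 1 := by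
    intro x y z t; simpa using hw
  have S1 := fun (c : {w : List I // w.length = n + 1} → S) x y z t =>
    B.affineSwap_append P (n + 1) i c u (v ++ z :: t :: r) x y hi (hl x y z t) (hl y x z t)
  have S2 := fun (c : {w : List I // w.length = n + 1} → S) x y z t =>
    B.affineSwap_append P (n + 1) j c (u ++ x :: y :: v) r z t (hj x y) (hl' x y z t)
      (hl' x y t z)
  simp only [e1] at S2 ⊢
  rw [S1, S2, S2, S1]
  have hn : u.length + v.length + r.length + 4 = n + 1 := by
    have := hl a b e f
    simp only [List.length_append, List.length_cons] at this
    omega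
  have r1 := hP u.length (v.length + (r.length + 1)) (by omega) _ (tensorWord_mem B.basis u) _
    (mul_mem_tensorDeg (tensorWord_mem B.basis v)
      (ι_mul_mem_tensorDeg (L.bracket (B.basis e) (B.basis f)) (tensorWord_mem B.basis r)))
    _ _ _ _ (B.mem a) (B.mem b)
  have r2 := hP (u.length + (v.length + 1)) r.length (by omega) _
    (mul_mem_tensorDeg (tensorWord_mem B.basis u)
      (ι_mul_mem_tensorDeg (L.bracket (B.basis a) (B.basis b)) (tensorWord_mem B.basis v)))
    _ (tensorWord_mem B.basis r) _ _ _ _ (B.mem e) (B.mem f)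
  simp only [tensorWord_append, tensorWord_cons, mul_assoc] at r1 r2 ⊢
  rw [r1, r2]
  module

/-- This is where the Jacobi identity enters. -/
theorem HomogBasis.affineSwap_braid {P : TensorAlgebra k g →ₗ[k] S} {n : ℕ}
    (hP : L.RespectsRel n P) (i : ℕ) (hi : i + 1 < n)
    (c : {w : List I // w.length = n + 1} → S) :
    B.affineSwap P (n + 1) i (B.affineSwap P (n + 1) (i + 1) (B.affineSwap P (n + 1) i c)) =
      B.affineSwap P (n + 1) (i + 1)
        (B.affineSwap P (n + 1) i (B.affineSwap P (n + 1) (i + 1) c)) := by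
  funext ⟨w, hw⟩
  obtain ⟨w, b, d, v, rfl, hu⟩ := List.exists_eq_append_of_lt (l := w) (i := i + 1) (by omega)
  obtain ⟨u, a, rfl⟩ : ∃ u a, w = u ++ [a] :=
    ⟨w.dropLast, w.getLast (by rintro rfl; simp at hu), (List.dropLast_append_getLast _).symm⟩
  have hu' : u.length = i := by simpa using hu
  have e1 : ∀ x y z, (u ++ [x]) ++ y :: z :: v = u ++ x :: y :: (z :: v) := by simp
  have hl : ∀ x y z, (u ++ x :: y :: (z :: v)).length = n + 1 := by
    intro x y z; simpa using hw
  have hl' : ∀ x y z, ((u ++ [x]) ++ y :: z :: v).length = n + 1 := by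
    intro x y z; simpa using hw
  have S1 := fun (c : {w : List I // w.length = n + 1} → S) x y z =>
    B.affineSwap_append P (n + 1) i c u (z :: v) x y hu' (hl x y z) (hl y x z)
  have S2 := fun (c : {w : List I // w.length = n + 1} → S) x y z =>
    B.affineSwap_append P (n + 1) (i + 1) c (u ++ [x]) v y z (by simpa using hu) (hl' x y z)
      (hl' x z y)
  simp only [e1] at S2 ⊢
  rw [S1, S2, S1, S2, S1, S2]
  have hn : u.length + v.length + 3 = n + 1 := by
    have := hl a b d
    simp only [List.length_append, List.length_cons] at this
    omega
  have r := fun (i j : Bideg) (x y : g) (hx : x ∈ L.comp i) (hy : y ∈ L.comp j) =>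
    hP u.length v.length (by omega) _ (tensorWord_mem B.basis u) _ (tensorWord_mem B.basis v)
      i j x y hx hy
  -- The two sides are compared by three relations in degree `n`, each moving the bracket of two of
  -- the letters past the third. The double brackets that these produce cancel by Jacobi.
  have r1 := r _ _ _ _ (L.bracket_mem (B.mem a) (B.mem b)) (B.mem d)
  have r2 := r _ _ _ _ (B.mem b) (L.bracket_mem (B.mem a) (B.mem d))
  have r3 := r _ _ _ _ (B.mem a) (L.bracket_mem (B.mem b) (B.mem d))
  have hJ := congrArg (fun x => P (tensorWord B.basis u * (TensorAlgebra.ι k x *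
    tensorWord B.basis v))) (L.bracket_jacobi (B.mem a) (B.mem b) (B.mem d))
  simp only [map_add, map_smul, add_mul, mul_add, smul_mul_assoc, mul_smul_comm] at hJ
  simp only [ksign_add_left, ksign_add_right] at r1 r2 r3
  rw [ksign_comm k (B.deg b) (B.deg a)] at r2
  simp only [tensorWord_append, tensorWord_cons, tensorWord_nil, mul_assoc, one_mul]
  rw [r1, r3, hJ, r2]
  simp only [smul_add, smul_smul, ← mul_assoc, ksign_mul_self]
  simp only [mul_comm, mul_left_comm, mul_assoc]
  module

end GradedLieSuperalgebra

/-! ### Construction of the Poincaré–Birkhoff–Witt map -/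

namespace GradedLieSuperalgebra

variable {k g I S : Type*} [Field k] [AddCommGroup g] [Module k g] {L : GradedLieSuperalgebra k g}
  [AddCommGroup S] [Module k S]

/-- The averaging argument on the space of functions on words of length `n + 1`. Functions with
values in `F` are preserved because the affine maps only add values of `P` in degree `n`. -/
theorem HomogBasis.exists_correction [CharZero k] (B : L.HomogBasis I) (F : Submodule k S) {n : ℕ}
    {P : TensorAlgebra k g →ₗ[k] S} (hP : L.RespectsRel n P)
    (hF : ∀ t ∈ tensorDeg k g n, P t ∈ F) :
    ∃ c : {w : List I // w.length = n + 1} → S, (∀ w, c w ∈ F) ∧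
      ∀ i < n, B.affineSwap P (n + 1) i c = c := by
  let s : ℕ → ({w : List I // w.length = n + 1} → S) →ₗ[k] ({w : List I // w.length = n + 1} → S) :=
    fun i => LinearMap.pi fun w => B.signAdj i w.1 •
      LinearMap.proj ⟨w.1.swapAdj i, (List.length_swapAdj i w.1).trans w.2⟩
  obtain ⟨c, hcF, hc⟩ := exists_fixed_of_coxeter s (fun i w => P (B.bracketAdj i w.1))
    (B.affineSwap P (n + 1)) (fun i x => rfl) (Submodule.pi Set.univ fun _ => F) n
    (fun i hi x => B.affineSwap_self P (n + 1) i (by omega) x)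
    (fun i j hij hj x => B.affineSwap_comm hP i j hij hj x)
    (fun i hi x => B.affineSwap_braid hP i hi x)
    (fun i hi x hx w _ => add_mem (Submodule.smul_mem _ _ (hx _ trivial))
      (hF _ (B.bracketAdj_mem i n w.1 w.2)))
  exact ⟨c, fun w => hcF w trivial, hc⟩

theorem HomogBasis.exists_respectsRel_succ [CharZero k] (B : L.HomogBasis I) (F : ℕ → Submodule k S)
    (hFm : Monotone F) (π : TensorAlgebra k g →ₗ[k] S)
    (hπ : ∀ u v i j x y, x ∈ L.comp i → y ∈ L.comp j →
      π (u * (TensorAlgebra.ι k x * (TensorAlgebra.ι k y * v))) =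
        ksign k i j • π (u * (TensorAlgebra.ι k y * (TensorAlgebra.ι k x * v))))
    (hπF : ∀ n, ∀ t ∈ tensorDeg k g n, π t ∈ F (n + 1)) {n : ℕ} {P : TensorAlgebra k g →ₗ[k] S}
    (hP : L.RespectsRel n P) (hPF : ∀ n, ∀ t ∈ tensorDeg k g n, P t - π t ∈ F n) :
    ∃ P' : TensorAlgebra k g →ₗ[k] S, L.RespectsRel (n + 1) P' ∧
      (∀ n, ∀ t ∈ tensorDeg k g n, P' t - π t ∈ F n) ∧
        ∀ m ≤ n, ∀ t ∈ tensorDeg k g m, P' t = P t := by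
  obtain ⟨c, hcF, hc⟩ := B.exists_correction (F (n + 1)) hP (fun t ht => by
    rw [← sub_add_cancel (P t) (π t)]
    exact add_mem (hFm (Nat.le_succ n) (hPF n t ht)) (hπF n t ht))
  -- Only the values on words of length `n + 1` are changed. There `π` satisfies the relations
  -- without bracket term, so `π + c` satisfies them exactly when `c` is a common fixed point.
  obtain ⟨P', hP'⟩ := exists_linearMap_tensorWord B.basis fun w =>
    if h : w.length = n + 1 then π (tensorWord B.basis w) + c ⟨w, h⟩ else P (tensorWord B.basis w)
  have hP1 : ∀ w (h : w.length = n + 1),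
      P' (tensorWord B.basis w) = π (tensorWord B.basis w) + c ⟨w, h⟩ := fun w h => by
    rw [hP', dif_pos h]
  have hP2 : ∀ w, w.length ≠ n + 1 → P' (tensorWord B.basis w) = P (tensorWord B.basis w) :=
    fun w h => by rw [hP', dif_neg h]
  have hagree : ∀ m ≤ n, ∀ t ∈ tensorDeg k g m, P' t = P t := by
    intro m hm t ht
    have ht' := tensorDeg_le_span B.basis m ht
    refine LinearMap.eqOn_span ?_ ht'
    rintro _ ⟨w, rfl, rfl⟩
    exact hP2 w (by omega)
  refine ⟨P', B.respectsRel_of_tensorWord fun u v a b huv => ?_, fun m t ht => ?_, hagree⟩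
  · have hbr := mul_mem_tensorDeg (tensorWord_mem B.basis u)
      (ι_mul_mem_tensorDeg (L.bracket (B.basis a) (B.basis b)) (tensorWord_mem B.basis v))
    rw [hagree _ (by omega) _ hbr]
    by_cases h : u.length + v.length + 2 = n + 1
    · have h1 : (u ++ a :: b :: v).length = n + 1 := by
        simp only [List.length_append, List.length_cons]; omega
      have h2 : (u ++ b :: a :: v).length = n + 1 := by
        simp only [List.length_append, List.length_cons]; omega
      rw [hP1 _ h1, hP1 _ h2]
      have := B.affineSwap_append P (n + 1) _ c u v a b rfl h1 h2
      rw [hc _ (by omega)] at this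
      rw [this]
      simp only [tensorWord_append, tensorWord_cons]
      rw [hπ _ _ _ _ _ _ (B.mem a) (B.mem b)]
      module
    · rw [hP2 _ (by simp only [List.length_append, List.length_cons]; omega),
        hP2 _ (by simp only [List.length_append, List.length_cons]; omega)]
      simpa using hP u.length v.length (by omega) _ (tensorWord_mem B.basis u) _
        (tensorWord_mem B.basis v) _ _ _ _ (B.mem a) (B.mem b)
  · have ht' := tensorDeg_le_span B.basis m ht
    suffices h : Submodule.span k {t | ∃ w : List I, w.length = m ∧ t = tensorWord B.basis w} ≤
        (F m).comap (P' - π) from h ht'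
    rw [Submodule.span_le]
    rintro _ ⟨w, rfl, rfl⟩
    simp only [SetLike.mem_coe, Submodule.mem_comap, LinearMap.sub_apply]
    by_cases h : w.length = n + 1
    · rw [hP1 _ h, add_sub_cancel_left, h]
      exact hcF _
    · rw [hP2 _ h]
      exact hPF _ _ (tensorWord_mem B.basis w)

/-- Each stage leaves all degrees already treated unchanged, so the successive corrections have a
limit. -/
theorem HomogBasis.exists_respectsRel [CharZero k] (B : L.HomogBasis I) (F : ℕ → Submodule k S)
    (hFm : Monotone F) (π : TensorAlgebra k g →ₗ[k] S)
    (hπ : ∀ u v i j x y, x ∈ L.comp i → y ∈ L.comp j →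
      π (u * (TensorAlgebra.ι k x * (TensorAlgebra.ι k y * v))) =
        ksign k i j • π (u * (TensorAlgebra.ι k y * (TensorAlgebra.ι k x * v))))
    (hπF : ∀ n, ∀ t ∈ tensorDeg k g n, π t ∈ F (n + 1)) :
    ∃ P : TensorAlgebra k g →ₗ[k] S, (∀ n, L.RespectsRel n P) ∧
      ∀ n, ∀ t ∈ tensorDeg k g n, P t - π t ∈ F n := by
  let Good : ℕ → Type _ := fun n => {P : TensorAlgebra k g →ₗ[k] S //
    L.RespectsRel n P ∧ ∀ n, ∀ t ∈ tensorDeg k g n, P t - π t ∈ F n}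
  have step : ∀ n (P : Good n), ∃ P' : Good (n + 1),
      ∀ m ≤ n, ∀ t ∈ tensorDeg k g m, P'.1 t = P.1 t := fun n P => by
    obtain ⟨P', h1, h2, h3⟩ := B.exists_respectsRel_succ F hFm π hπ hπF P.2.1 P.2.2
    exact ⟨⟨P', h1, h2⟩, h3⟩
  choose next hnext using step
  -- The sequence starts at `π`: every relation involves two letters, so nothing is required in
  -- degree `0`.
  let Q : ∀ n, Good n := fun n => Nat.rec ⟨π, fun p q h => absurd h (Nat.not_succ_le_zero _), by simp⟩
    next n
  have hQ : ∀ n m, n ≤ m → ∀ t ∈ tensorDeg k g n, (Q m).1 t = (Q n).1 t := by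
    intro n m hnm t ht
    induction m, hnm using Nat.le_induction with
    | base => rfl
    | succ m hm ih => rw [← ih]; exact hnext m (Q m) n hm t ht
  obtain ⟨P, hP⟩ := exists_linearMap_tensorWord B.basis fun w =>
    (Q w.length).1 (tensorWord B.basis w)
  have hPQ : ∀ n, ∀ t ∈ tensorDeg k g n, P t = (Q n).1 t := by
    intro n t ht
    refine LinearMap.eqOn_span ?_ (tensorDeg_le_span B.basis n ht)
    rintro _ ⟨w, rfl, rfl⟩
    exact hP w
  refine ⟨P, fun n p q _ u hu v hv i j x y hx hy => ?_, fun n t ht => ?_⟩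
  · have e : ∀ x y : g, u * (TensorAlgebra.ι k x * (TensorAlgebra.ι k y * v)) ∈
        tensorDeg k g (p + (q + 1 + 1)) := fun x y =>
      mul_mem_tensorDeg hu (ι_mul_mem_tensorDeg _ (ι_mul_mem_tensorDeg _ hv))
    have e' := mul_mem_tensorDeg hu (ι_mul_mem_tensorDeg (L.bracket x y) hv)
    rw [hPQ _ _ (e x y), hPQ _ _ (e y x), hPQ _ _ e', ← hQ _ (p + (q + 1 + 1)) (by omega) _ e']
    exact (Q (p + (q + 1 + 1))).2.1 p q (by omega) u hu v hv i j x y hx hy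
  · rw [hPQ n t ht]
    exact (Q n).2.2 n t ht

variable (L) in
/-- The canonical map from the tensor algebra to the enveloping algebra. -/
def mkU : TensorAlgebra k g →ₐ[k] L.U := RingQuot.mkAlgHom k L.Rel

theorem mkU_ι (x : g) : L.mkU (TensorAlgebra.ι k x) = L.ι x := rfl

theorem mkU_surjective : Function.Surjective L.mkU := RingQuot.mkAlgHom_surjective k L.Rel

/-- `RingQuot` is the plain quotient by the closure of the relation under addition and
multiplication, so a function invariant under that closure descends, even if it is not
multiplicative. -/
theorem eq_of_mkU_eq {α : Type*} (P : TensorAlgebra k g → α)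
    (hP : ∀ a b, RingQuot.Rel L.Rel a b → P a = P b) {a b : TensorAlgebra k g}
    (h : L.mkU a = L.mkU b) : P a = P b := by
  have h' : RingQuot.mkRingHom L.Rel a = RingQuot.mkRingHom L.Rel b := by
    rw [← RingQuot.mkAlgHom_coe k L.Rel]; exact h
  simp only [RingQuot.mkRingHom_def] at h'
  have h'' : Quot.mk (RingQuot.Rel L.Rel) a = Quot.mk (RingQuot.Rel L.Rel) b := by
    injection h'
  exact congrArg (Quot.lift P hP) h''

/-- A linear map on the tensor algebra which respects the relations descends to the enveloping
algebra. -/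
theorem exists_linearMap_mkU (P : TensorAlgebra k g →ₗ[k] S)
    (hP : ∀ u v i j x y, x ∈ L.comp i → y ∈ L.comp j →
      P (u * (TensorAlgebra.ι k x * (TensorAlgebra.ι k y * v))) =
        ksign k i j • P (u * (TensorAlgebra.ι k y * (TensorAlgebra.ι k x * v))) +
          P (u * (TensorAlgebra.ι k (L.bracket x y) * v))) :
    ∃ P' : L.U →ₗ[k] S, ∀ t, P' (L.mkU t) = P t := by
  -- The outer factors `u` and `v` make the statement stable under multiplication on either side.
  have hrel : ∀ a b, RingQuot.Rel L.Rel a b → ∀ u v, P (u * a * v) = P (u * b * v) := by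
    intro a b h
    induction h with
    | of h =>
      obtain ⟨hx, hy⟩ := h
      intro u v
      have := hP u v _ _ _ _ hx hy
      rw [ksign_smul] at this
      simp only [mul_add, add_mul, Units.smul_def, mul_smul_comm, smul_mul_assoc, map_add,
        map_zsmul, mul_assoc] at this ⊢
      exact this
    | add_left _ ih => intro u v; simp only [mul_add, add_mul, map_add, ih]
    | mul_left _ ih => intro u v; simpa only [mul_assoc] using ih u (_ * v)
    | mul_right _ ih => intro u v; simpa only [mul_assoc] using ih (u * _) v
  have hker : LinearMap.ker L.mkU.toLinearMap ≤ LinearMap.ker P := by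
    intro t ht
    have h0 : L.mkU t = L.mkU 0 := by rw [map_zero]; exact ht
    have := L.eq_of_mkU_eq P (fun a b h => by simpa using hrel a b h 1 1) h0
    rwa [map_zero] at this
  refine ⟨(LinearMap.ker L.mkU.toLinearMap).liftQ P hker ∘ₗ
    (L.mkU.toLinearMap.quotKerEquivOfSurjective L.mkU_surjective).symm.toLinearMap, fun t => ?_⟩
  have : (L.mkU.toLinearMap.quotKerEquivOfSurjective L.mkU_surjective).symm (L.mkU t) =
      (LinearMap.ker L.mkU.toLinearMap).mkQ t := by
    rw [LinearEquiv.symm_apply_eq]; rfl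
  simp [this]

theorem mkU_mem_fil {n : ℕ} {t : TensorAlgebra k g} (ht : t ∈ tensorDeg k g n) :
    L.mkU t ∈ L.fil (n + 1) := by
  induction n generalizing t with
  | zero =>
    rw [tensorDeg, pow_zero, Submodule.one_eq_span] at ht
    obtain ⟨c, rfl⟩ := Submodule.mem_span_singleton.1 ht
    rw [map_smul, map_one]
    exact Submodule.smul_mem _ _ (L.prodι_mem_fil (l := []) isHomog_nil (by simp))
  | succ n ih =>
    rw [tensorDeg, pow_succ'] at ht
    induction ht using Submodule.mul_induction_on' with
    | mem_mul_mem a ha b hb =>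
      obtain ⟨x, rfl⟩ := ha
      rw [map_mul, mkU_ι, add_comm, add_comm n 1, ← add_assoc]
      exact L.mul_mem_fil (L.ι_mem_fil x) (ih hb)
    | add a _ b _ ha hb => rw [map_add]; exact add_mem ha hb

variable (L) in
/-- The Poincaré–Birkhoff–Witt theorem: a linear map from `U(g)` to `Sym(g)` which sends a product
of homogeneous elements to their product in `Sym(g)`, up to shorter products. -/
theorem exists_pbw [CharZero k] : ∃ P : L.U →ₗ[k] L.toGradedSuperspace.Sym,
    ∀ l, L.IsHomog l → P (L.prodι l) - L.toGradedSuperspace.abelian.prodι l ∈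
      L.toGradedSuperspace.abelian.fil l.length := by
  obtain ⟨B⟩ := L.exists_homogBasis
  let A := L.toGradedSuperspace.abelian
  obtain ⟨P, hP, hPF⟩ := B.exists_respectsRel A.fil A.fil_mono A.mkU.toLinearMap
    (fun u v i j x y hx hy => by
      simp only [AlgHom.toLinearMap_apply, map_mul, mkU_ι]
      rw [← mul_assoc (A.ι x), A.ι_mul_ι_eq (i := i) (j := j) hx hy]
      have : A.bracket x y = 0 := rfl
      rw [this, map_zero, add_zero, smul_mul_assoc, mul_smul_comm, mul_assoc])
    (fun n t ht => A.mkU_mem_fil ht)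
  have htop : ∀ u : TensorAlgebra k g, u ∈
      Submodule.span k {t | ∃ w : List _, t = tensorWord B.basis w} := fun u => by
    rw [span_tensorWord]; trivial
  obtain ⟨P', hP'⟩ := L.exists_linearMap_mkU P (by
    intro u v i j x y hx hy
    induction htop u using Submodule.span_induction with
    | zero => simp
    | add u u' _ _ hu hu' => simp only [add_mul, map_add, hu, hu']; module
    | smul c u _ hu => simp only [smul_mul_assoc, map_smul, hu]; module
    | mem u hu =>
    obtain ⟨u, rfl⟩ := hu
    induction htop v using Submodule.span_induction with
    | zero => simp
    | add u u' _ _ hu hu' => simp only [mul_add, map_add, hu, hu']; module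
    | smul c u _ hu => simp only [mul_smul_comm, map_smul, hu]; module
    | mem v hv =>
    obtain ⟨v, rfl⟩ := hv
    exact hP _ u.length v.length le_rfl _ (tensorWord_mem _ _) _ (tensorWord_mem _ _)
      i j x y hx hy)
  refine ⟨P', fun l hl => ?_⟩
  have hl1 : ∀ (L' : GradedLieSuperalgebra k g) (l : List (Bideg × g)),
      L'.prodι l = L'.mkU (l.map fun a => TensorAlgebra.ι k a.2).prod := fun L' l => by
    rw [map_list_prod, List.map_map]; rfl
  have hl2 : (l.map fun a => TensorAlgebra.ι k a.2).prod ∈ tensorDeg k g l.length := by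
    clear hl
    induction l with
    | nil => simp [tensorDeg]
    | cons a l ih =>
      rw [List.map_cons, List.prod_cons, List.length_cons]
      exact ι_mul_mem_tensorDeg _ ih
  rw [hl1, hl1, hP']
  exact hPF _ _ hl2

end GradedLieSuperalgebra

/-! ### Sign operators and products in graded tensor products -/

section Twist

variable {k A B : Type*} [Field k] [Ring A] [Algebra k A] [Ring B] [Algebra k B]
  (𝒜 : Bideg → Submodule k A) [GradedAlgebra 𝒜] (ℬ : Bideg → Submodule k B) [GradedAlgebra ℬ]

/-- The operator which multiplies a homogeneous element `a` by the Koszul sign of `a` with an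
element of bidegree `d`. -/
def twist (d : Bideg) : A →ₗ[k] A :=
  (DirectSum.toModule k Bideg A fun e => ksign k d e • (𝒜 e).subtype) ∘ₗ
    (DirectSum.decomposeLinearEquiv 𝒜).toLinearMap

variable {𝒜} in
theorem twist_of_mem (d : Bideg) {e : Bideg} {a : A} (ha : a ∈ 𝒜 e) :
    twist 𝒜 d a = ksign k d e • a := by
  simp only [twist, LinearMap.comp_apply, LinearEquiv.coe_coe,
    DirectSum.decomposeLinearEquiv_apply, DirectSum.decompose_of_mem 𝒜 ha]
  rw [← DirectSum.lof_eq_of k, DirectSum.toModule_lof]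
  simp

theorem linearMap_ext_homogeneous {M : Type*} [AddCommGroup M] [Module k M] {f f' : A →ₗ[k] M}
    (h : ∀ (e : Bideg) (a : A), a ∈ 𝒜 e → f a = f' a) : f = f' := by
  ext a
  induction a using DirectSum.Decomposition.inductionOn 𝒜 with
  | zero => simp
  | homogeneous a => exact h _ _ a.2
  | add a b ha hb => rw [map_add, map_add, ha, hb]

theorem twist_one (d : Bideg) : twist 𝒜 d 1 = 1 := by
  rw [twist_of_mem d (SetLike.GradedOne.one_mem (A := 𝒜)), ksign_zero_right, one_smul]

theorem twist_twist (d d' : Bideg) (a : A) :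
    twist 𝒜 d (twist 𝒜 d' a) = twist 𝒜 d' (twist 𝒜 d a) := by
  revert a
  refine LinearMap.congr_fun (f := twist 𝒜 d ∘ₗ twist 𝒜 d') (g := twist 𝒜 d' ∘ₗ twist 𝒜 d)
    (linearMap_ext_homogeneous 𝒜 fun e a ha => ?_)
  simp only [LinearMap.comp_apply, twist_of_mem _ ha, map_smul, smul_smul]
  rw [mul_comm]

theorem twist_mul_of_mem (d : Bideg) {i : Bideg} {x : A} (hx : x ∈ 𝒜 i) (a : A) :
    twist 𝒜 d (x * a) = ksign k d i • (x * twist 𝒜 d a) := by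
  revert a
  refine LinearMap.congr_fun (f := twist 𝒜 d ∘ₗ LinearMap.mulLeft k x)
    (g := ksign k d i • (LinearMap.mulLeft k x ∘ₗ twist 𝒜 d))
    (linearMap_ext_homogeneous 𝒜 fun e a ha => ?_)
  simp only [LinearMap.comp_apply, LinearMap.smul_apply, LinearMap.mulLeft_apply,
    twist_of_mem _ ha, twist_of_mem _ (SetLike.mul_mem_graded hx ha), ksign_add_right,
    mul_smul_comm, smul_smul]

theorem map_twist {f : A →ₗ[k] B} (hf : ∀ (d : Bideg) (a : A), a ∈ 𝒜 d → f a ∈ ℬ d) (d : Bideg)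
    (a : A) : f (twist 𝒜 d a) = twist ℬ d (f a) := by
  revert a
  refine LinearMap.congr_fun (f := f ∘ₗ twist 𝒜 d) (g := twist ℬ d ∘ₗ f)
    (linearMap_ext_homogeneous 𝒜 fun e a ha => ?_)
  simp only [LinearMap.comp_apply, twist_of_mem _ ha, twist_of_mem _ (hf _ _ ha), map_smul]

open GradedTensorProduct in
theorem gradedTensor_mul_of_mem {j i : Bideg} (a : A) {b : B} (hb : b ∈ ℬ j) {a' : A}
    (ha' : a' ∈ 𝒜 i) (b' : B) :
    (a ᵍ⊗ₜ[k] b * a' ᵍ⊗ₜ[k] b' : 𝒜 ᵍ⊗[k] ℬ) = ksign k j i • (a * a') ᵍ⊗ₜ[k] (b * b') := by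
  have := tmul_coe_mul_coe_tmul (R := k) 𝒜 ℬ a ⟨b, hb⟩ ⟨a', ha'⟩ b'
  rw [this, uzpow_bideg, ksign_smul]

open GradedTensorProduct in
theorem gradedTensor_left_mul (x : A) (z : A ⊗[k] B) :
    (x ᵍ⊗ₜ[k] 1 * of k 𝒜 ℬ z : 𝒜 ᵍ⊗[k] ℬ) =
      of k 𝒜 ℬ (TensorProduct.map (LinearMap.mulLeft k x) LinearMap.id z) := by
  induction z using TensorProduct.induction_on with
  | zero => simp
  | add z z' hz hz' => simp only [map_add, mul_add, hz, hz']
  | tmul a b =>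
    induction a using DirectSum.Decomposition.inductionOn 𝒜 with
    | zero => simp
    | add a a' ha ha' => simp only [TensorProduct.add_tmul, map_add, mul_add, ha, ha']
    | homogeneous a =>
      have := gradedTensor_mul_of_mem 𝒜 ℬ x (SetLike.GradedOne.one_mem (A := ℬ)) a.2 b
      rw [ksign_zero_left, one_smul, one_mul] at this
      exact this

open GradedTensorProduct in
theorem gradedTensor_right_mul {d : Bideg} {x : B} (hx : x ∈ ℬ d) (z : A ⊗[k] B) :
    (1 ᵍ⊗ₜ[k] x * of k 𝒜 ℬ z : 𝒜 ᵍ⊗[k] ℬ) =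
      of k 𝒜 ℬ (TensorProduct.map (twist 𝒜 d) (LinearMap.mulLeft k x) z) := by
  induction z using TensorProduct.induction_on with
  | zero => simp
  | add z z' hz hz' => simp only [map_add, mul_add, hz, hz']
  | tmul a b =>
    induction a using DirectSum.Decomposition.inductionOn 𝒜 with
    | zero => simp
    | add a a' ha ha' => simp only [TensorProduct.add_tmul, map_add, mul_add, ha, ha']
    | homogeneous a =>
      have := gradedTensor_mul_of_mem 𝒜 ℬ 1 hx a.2 b
      rw [one_mul] at this
      rw [this, TensorProduct.map_tmul, twist_of_mem d a.2, ← TensorProduct.smul_tmul', map_smul]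
      rfl

end Twist

/-! ### The coalgebra axioms for the enveloping algebra -/

namespace GradedLieSuperalgebra

variable {k g : Type*} [Field k] [AddCommGroup g] [Module k g] (L : GradedLieSuperalgebra k g)

open CoalgebraStruct

/-- The operator on `U(g) ⊗ U(g)` of left multiplication by `x ⊗ 1 + 1 ⊗ x`, for `x ∈ g`
homogeneous of bidegree `d`. -/
def primMul (d : Bideg) (x : g) : L.U ⊗[k] L.U →ₗ[k] L.U ⊗[k] L.U :=
  TensorProduct.map (LinearMap.mulLeft k (L.ι x)) LinearMap.id +
    TensorProduct.map (twist L.grading d) (LinearMap.mulLeft k (L.ι x))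

theorem primMul_tmul (d : Bideg) (x : g) (a b : L.U) : L.primMul d x (a ⊗ₜ b) =
    (L.ι x * a) ⊗ₜ b + twist L.grading d a ⊗ₜ (L.ι x * b) := rfl

theorem comul_def (a : L.U) : comul (R := k) a =
    (GradedTensorProduct.of k L.grading L.grading).symm (L.comulAlgHom a) := rfl

theorem comul_one : comul (R := k) (1 : L.U) = 1 ⊗ₜ 1 := by
  rw [comul_def, map_one]; rfl

/-- This recursion, written with operators on the ordinary tensor product, lets coalgebra identities
be proved by induction on the number of factors. -/
theorem comul_ι_mul {d : Bideg} {x : g} (hx : x ∈ L.comp d) (a : L.U) :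
    comul (R := k) (L.ι x * a) = L.primMul d x (comul a) := by
  have h1 := gradedTensor_left_mul L.grading L.grading (L.ι x) (comul (R := k) a)
  have h2 := gradedTensor_right_mul L.grading L.grading (L.ι_mem hx) (comul (R := k) a)
  rw [comul_def, GradedTensorProduct.symm_of_of] at h1 h2
  rw [comul_def, map_mul, comulAlgHom_ι, primitive, LinearMap.add_apply, add_mul]
  simp only [LinearMap.comp_apply, AlgHom.toLinearMap_apply,
    GradedTensorProduct.includeLeft_apply, GradedTensorProduct.includeRight_apply]
  rw [h1, h2]
  rfl

theorem counit_one : counit (R := k) (1 : L.U) = 1 := map_one L.counitAlgHom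

theorem counit_ι_mul (x : g) (a : L.U) : counit (R := k) (L.ι x * a) = 0 := by
  change L.counitAlgHom (L.ι x * a) = 0
  rw [map_mul, show L.counitAlgHom (L.ι x) = 0 from
    L.lift_ι (0 : g →ₗ[k] k) (by intros; simp) x, zero_mul]

theorem twist_ι_mul (d : Bideg) {i : Bideg} {x : g} (hx : x ∈ L.comp i) (a : L.U) :
    twist L.grading d (L.ι x * a) = ksign k d i • (L.ι x * twist L.grading d a) :=
  twist_mul_of_mem L.grading d (L.ι_mem hx) a

theorem counit_twist (d : Bideg) (a : L.U) :
    counit (R := k) (twist L.grading d a) = counit (R := k) a := by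
  revert a
  refine LinearMap.congr_fun (f := counit ∘ₗ twist L.grading d) (g := counit)
    (L.linearMap_ext_mul ?_ fun i e x a hx _ _ => ?_)
  · simp [twist_one]
  · simp [twist_ι_mul L d hx, counit_ι_mul]

theorem comul_twist (d : Bideg) (a : L.U) : comul (R := k) (twist L.grading d a) =
    TensorProduct.map (twist L.grading d) (twist L.grading d) (comul a) := by
  revert a
  refine LinearMap.congr_fun (f := comul ∘ₗ twist L.grading d)
    (g := TensorProduct.map (twist L.grading d) (twist L.grading d) ∘ₗ comul)
    (L.linearMap_ext_mul ?_ fun i e x a hx _ h => ?_)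
  · simp [twist_one, comul_one]
  · simp only [LinearMap.comp_apply] at h ⊢
    rw [twist_ι_mul L d hx, map_smul, comul_ι_mul L hx, comul_ι_mul L hx, h]
    generalize comul (R := k) a = z
    induction z using TensorProduct.induction_on with
    | zero => simp
    | add z z' hz hz' => simp only [map_add, smul_add, hz, hz']
    | tmul a b =>
      simp only [TensorProduct.map_tmul, primMul_tmul, map_add, twist_ι_mul L d hx,
        TensorProduct.smul_tmul', TensorProduct.tmul_smul, smul_add]
      rw [twist_twist]

/-- Both sides of each axiom agree on `1` and intertwine left multiplication by `ι x` with the same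
operator on the target. -/
instance : Coalgebra k L.U where
  coassoc := by
    refine L.linearMap_ext_mul ?_ fun i e x a hx _ h => ?_
    · simp [comul_one]
    -- Left multiplication by `x ⊗ 1 ⊗ 1 + 1 ⊗ x ⊗ 1 + 1 ⊗ 1 ⊗ x`, with Koszul signs.
    · let D : L.U ⊗[k] (L.U ⊗[k] L.U) →ₗ[k] L.U ⊗[k] (L.U ⊗[k] L.U) :=
        TensorProduct.map (LinearMap.mulLeft k (L.ι x)) LinearMap.id +
          TensorProduct.map (twist L.grading i) (L.primMul i x)
      have h1 : ∀ z : L.U ⊗[k] L.U, TensorProduct.assoc k L.U L.U L.U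
          (comul.rTensor L.U (L.primMul i x z)) =
            D (TensorProduct.assoc k L.U L.U L.U (comul.rTensor L.U z)) := by
        intro z
        induction z using TensorProduct.induction_on with
        | zero => simp
        | add z z' hz hz' => simp only [map_add, hz, hz']
        | tmul a b =>
          simp only [primMul_tmul, map_add, LinearMap.rTensor_tmul, comul_twist, comul_ι_mul L hx]
          generalize comul (R := k) a = w
          induction w using TensorProduct.induction_on with
          | zero => simp
          | add z z' hz hz' =>
            simp only [map_add, TensorProduct.add_tmul, ← hz, ← hz']
            abel
          | tmul a a' =>
            simp [D, primMul_tmul, TensorProduct.add_tmul, TensorProduct.tmul_add, add_assoc]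
      have h2 : ∀ z : L.U ⊗[k] L.U, comul.lTensor L.U (L.primMul i x z) =
          D (comul.lTensor L.U z) := by
        intro z
        induction z using TensorProduct.induction_on with
        | zero => simp
        | add z z' hz hz' => simp only [map_add, hz, hz']
        | tmul a b => simp [D, primMul_tmul, comul_ι_mul L hx]
      simp only [LinearMap.comp_apply, LinearEquiv.coe_coe] at h ⊢
      rw [comul_ι_mul L hx, h1, h2, h]
  rTensor_counit_comp_comul := by
    refine L.linearMap_ext_mul ?_ fun i e x a hx _ h => ?_
    · simp [comul_one, counit_one]
    · have h1 : ∀ z : L.U ⊗[k] L.U, counit.rTensor L.U (L.primMul i x z) =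
          (LinearMap.mulLeft k (L.ι x)).lTensor k (counit.rTensor L.U z) := by
        intro z
        induction z using TensorProduct.induction_on with
        | zero => simp
        | add z z' hz hz' => simp only [map_add, hz, hz']
        | tmul a b => simp [primMul_tmul, counit_ι_mul, counit_twist]
      simp only [LinearMap.comp_apply] at h ⊢
      rw [comul_ι_mul L hx, h1, h]
      simp
  lTensor_counit_comp_comul := by
    refine L.linearMap_ext_mul ?_ fun i e x a hx _ h => ?_
    · simp [comul_one, counit_one]
    · have h1 : ∀ z : L.U ⊗[k] L.U, counit.lTensor L.U (L.primMul i x z) =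
          (LinearMap.mulLeft k (L.ι x)).rTensor k (counit.lTensor L.U z) := by
        intro z
        induction z using TensorProduct.induction_on with
        | zero => simp
        | add z z' hz hz' => simp only [map_add, hz, hz']
        | tmul a b => simp [primMul_tmul, counit_ι_mul]
      simp only [LinearMap.comp_apply] at h ⊢
      rw [comul_ι_mul L hx, h1, h]
      simp

end GradedLieSuperalgebra

/-! ### Permutations and their Koszul signs, by the image of `0` -/

section Permutations

/-- The permutation of `Fin (p + 1)` which sends `0` to `i` and is otherwise given by `τ`. -/
def insertPerm {p : ℕ} (i : Fin (p + 1)) (τ : Equiv.Perm (Fin p)) : Equiv.Perm (Fin (p + 1)) :=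
  Equiv.ofBijective (Fin.cases i fun j => i.succAbove (τ j)) <| by
    rw [← Finite.injective_iff_bijective]
    intro a b
    refine Fin.cases ?_ (fun a => ?_) a <;> refine Fin.cases ?_ (fun b => ?_) b
    · simp
    · intro h; exact absurd h.symm (Fin.succAbove_ne i _)
    · intro h; exact absurd h (Fin.succAbove_ne i _)
    · intro h
      simpa using h

@[simp] theorem insertPerm_zero {p : ℕ} (i : Fin (p + 1)) (τ : Equiv.Perm (Fin p)) :
    insertPerm i τ 0 = i := rfl

@[simp] theorem insertPerm_succ {p : ℕ} (i : Fin (p + 1)) (τ : Equiv.Perm (Fin p)) (j : Fin p) :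
    insertPerm i τ j.succ = i.succAbove (τ j) := rfl

theorem insertPerm_bijective (p : ℕ) : Function.Bijective
    fun a : Fin (p + 1) × Equiv.Perm (Fin p) => insertPerm a.1 a.2 := by
  rw [Fintype.bijective_iff_injective_and_card]
  refine ⟨?_, ?_⟩
  · rintro ⟨i, τ⟩ ⟨i', τ'⟩ h
    have h0 : i = i' := congrArg (fun σ => σ 0) h
    subst h0
    refine Prod.ext rfl (Equiv.ext fun j => ?_)
    have := congrArg (fun σ => σ j.succ) h
    simpa using this
  · rw [Fintype.card_prod, Fintype.card_perm, Fintype.card_perm, Fintype.card_fin,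
      Fintype.card_fin, Nat.factorial_succ]

theorem sum_perm_succ {p : ℕ} {M : Type*} [AddCommMonoid M]
    (f : Equiv.Perm (Fin (p + 1)) → M) :
    ∑ σ, f σ = ∑ i, ∑ τ : Equiv.Perm (Fin p), f (insertPerm i τ) := by
  rw [← Fintype.sum_prod_type' (f := fun i τ => f (insertPerm i τ))]
  exact (Function.Bijective.sum_comp (insertPerm_bijective p) f).symm

theorem koszulSign_comm (i j : Bideg) : koszulSign i j = koszulSign j i := by
  rw [koszulSign, koszulSign, mul_comm]

/-- The sign of moving the homogeneous element in position `i` to the front. -/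
def frontSign {p : ℕ} (d : Fin p → Bideg) (i : Fin p) : ℤˣ :=
  ∏ j : Fin p, if j < i then koszulSign (d i) (d j) else 1

theorem frontSign_zero {p : ℕ} (d : Fin (p + 1) → Bideg) : frontSign d 0 = 1 := by
  simp [frontSign]

theorem frontSign_succ {p : ℕ} (d : Fin (p + 1) → Bideg) (i : Fin p) :
    frontSign d i.succ = koszulSign (d 0) (d i.succ) * frontSign (d ∘ Fin.succ) i := by
  rw [frontSign, Fin.prod_univ_succ, if_pos (Fin.succ_pos i)]
  simp only [Fin.succ_lt_succ_iff]
  rw [koszulSign_comm]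
  rfl

/-- The inversions involving position `0` contribute the sign of moving the `i`-th element to the
front; the others are those of `τ`, since `i.succAbove` is increasing. -/
theorem permSign_insertPerm {p : ℕ} (d : Fin (p + 1) → Bideg) (i : Fin (p + 1))
    (τ : Equiv.Perm (Fin p)) :
    permSign d (insertPerm i τ) = frontSign d i * permSign (d ∘ i.succAbove) τ := by
  rw [permSign, Fin.prod_univ_succ, Fin.prod_univ_succ]
  simp only [lt_self_iff_false, false_and, if_false, one_mul, insertPerm_zero, insertPerm_succ,
    Fin.succ_pos, true_and]
  congr 1
  · rw [Equiv.prod_comp τ fun j => if i.succAbove j < i then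
      koszulSign (d i) (d (i.succAbove j)) else 1, frontSign, Fin.prod_univ_succAbove _ i]
    simp
  · refine Finset.prod_congr rfl fun a _ => ?_
    rw [Fin.prod_univ_succ]
    simp [Fin.succ_lt_succ_iff, Fin.succAbove_lt_succAbove_iff]

end Permutations

/-! ### Convolution with infinitesimal maps -/

namespace GradedLieSuperalgebra

open CoalgebraStruct WithConv

variable {k g A : Type*} [Field k] [AddCommGroup g] [Module k g] (L : GradedLieSuperalgebra k g)
  [Ring A] [Algebra k A]

/-- The product in `U(g)` of a family of elements of `g`. -/
def finProd {p : ℕ} (y : Fin p → g) : L.U := (List.ofFn fun i => L.ι (y i)).prod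

theorem finProd_zero (y : Fin 0 → g) : L.finProd y = 1 := by simp [finProd]

theorem finProd_succ {p : ℕ} (y : Fin (p + 1) → g) :
    L.finProd y = L.ι (y 0) * L.finProd (y ∘ Fin.succ) := by
  simp [finProd, List.ofFn_succ]

theorem finProd_eq_prodι {p : ℕ} (d : Fin p → Bideg) (y : Fin p → g) :
    L.finProd y = L.prodι (List.ofFn fun i => (d i, y i)) := by
  simp [finProd, prodι, List.map_ofFn, Function.comp_def]

theorem prodι_eq_finProd (l : List (Bideg × g)) :
    L.prodι l = L.finProd fun i => (l.get i).2 := by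
  rw [L.finProd_eq_prodι fun i => (l.get i).1]
  congr 1
  exact (List.ofFn_get l).symm

theorem isHomog_ofFn {p : ℕ} {d : Fin p → Bideg} {y : Fin p → g} (hy : ∀ i, y i ∈ L.comp (d i)) :
    L.IsHomog (List.ofFn fun i => (d i, y i)) := by
  intro a ha
  obtain ⟨i, rfl⟩ := List.mem_ofFn.1 ha
  exact hy i

theorem finProd_mem_fil {p n : ℕ} {d : Fin p → Bideg} {y : Fin p → g}
    (hy : ∀ i, y i ∈ L.comp (d i)) (h : p < n) : L.finProd y ∈ L.fil n := by
  rw [L.finProd_eq_prodι d]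
  exact L.prodι_mem_fil (L.isHomog_ofFn hy) (by simpa using h)

theorem linearMap_ext_finProd {M : Type*} [AddCommGroup M] [Module k M] {f f' : L.U →ₗ[k] M}
    (h : ∀ (p : ℕ) (d : Fin p → Bideg) (y : Fin p → g), (∀ i, y i ∈ L.comp (d i)) →
      f (L.finProd y) = f' (L.finProd y)) : f = f' :=
  L.linearMap_ext fun l hl => by
    rw [prodι_eq_finProd]
    exact h _ (fun i => (l.get i).1) _ fun i => hl _ (List.get_mem l i)

/-- A linear map on `U(g)` which vanishes on products of length other than `1`, in the sense that
`F (x a) = ε(a) F x` for `x ∈ g`. -/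
structure IsInfinitesimal (F : L.U →ₗ[k] A) : Prop where
  apply_one : F 1 = 0
  apply_ι_mul : ∀ {d : Bideg} {x : g}, x ∈ L.comp d → ∀ a,
    F (L.ι x * a) = counit (R := k) a • F (L.ι x)

variable {L}

theorem IsInfinitesimal.comp_twist {F : L.U →ₗ[k] A} (hF : L.IsInfinitesimal F) (d : Bideg) :
    L.IsInfinitesimal (F ∘ₗ twist L.grading d) where
  apply_one := by simp [twist_one, hF.apply_one]
  apply_ι_mul hx a := by
    simp only [LinearMap.comp_apply]
    rw [twist_ι_mul L d hx, map_smul, hF.apply_ι_mul hx, counit_twist,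
      twist_of_mem d (L.ι_mem hx), map_smul, smul_comm]

theorem IsInfinitesimal.conv_one {F : L.U →ₗ[k] A} (hF : L.IsInfinitesimal F)
    (h : WithConv (L.U →ₗ[k] A)) : (toConv F * h) (1 : L.U) = 0 := by
  rw [LinearMap.convMul_apply, comul_one]
  simp [hF.apply_one]

/-- In `Δ(x a)` the factor `x` goes either to the left, where `F` reduces the left part of `Δ a` to
its counit, or to the right, past the left part of `Δ a`, which produces the twist. -/
theorem IsInfinitesimal.conv_ι_mul {F : L.U →ₗ[k] A} (hF : L.IsInfinitesimal F)
    (h : WithConv (L.U →ₗ[k] A)) {d : Bideg} {x : g} (hx : x ∈ L.comp d) (a : L.U) :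
    (toConv F * h) (L.ι x * a) = F (L.ι x) * h a +
      (toConv (F ∘ₗ twist L.grading d) *
        toConv (h.ofConv ∘ₗ LinearMap.mulLeft k (L.ι x))) a := by
  have h1 : ∀ z : L.U ⊗[k] L.U, LinearMap.mul' k A (TensorProduct.map F h.ofConv
      (TensorProduct.map (LinearMap.mulLeft k (L.ι x)) LinearMap.id z)) =
        F (L.ι x) * h.ofConv (TensorProduct.lid k L.U (counit.rTensor L.U z)) := by
    intro z
    induction z using TensorProduct.induction_on with
    | zero => simp
    | add z z' hz hz' => simp only [map_add, hz, hz', mul_add]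
    | tmul a b => simp [hF.apply_ι_mul hx]
  rw [LinearMap.convMul_apply, LinearMap.convMul_apply, comul_ι_mul L hx, primMul,
    LinearMap.add_apply, map_add, map_add]
  congr 1
  · refine (h1 _).trans ?_
    rw [Coalgebra.rTensor_counit_comul, TensorProduct.lid_tmul, one_smul]
  · exact congrArg (LinearMap.mul' k A)
      (LinearMap.congr_fun (TensorProduct.map_comp _ _ _ _) (comul a)).symm

/-- `F` picks out one factor and `h` receives the rest. The recursion replaces `F` by a twist of
itself and `h` by its composite with a multiplication, so the induction must allow both to vary. -/
theorem IsInfinitesimal.conv_finProd {F : L.U →ₗ[k] A} (hF : L.IsInfinitesimal F)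
    (h : WithConv (L.U →ₗ[k] A)) {p : ℕ} {d : Fin (p + 1) → Bideg} {y : Fin (p + 1) → g}
    (hy : ∀ i, y i ∈ L.comp (d i)) :
    (toConv F * h) (L.finProd y) = ∑ i, unitCast k (frontSign d i) •
      (F (L.ι (y i)) * h (L.finProd (y ∘ i.succAbove))) := by
  induction p generalizing F h with
  | zero =>
    rw [finProd_succ, finProd_zero, hF.conv_ι_mul h (hy 0), (hF.comp_twist _).conv_one,
      Fin.sum_univ_one, finProd_zero, frontSign_zero,
      (unitCast k).map_one, one_smul, add_zero]
  | succ p ih =>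
    rw [finProd_succ, hF.conv_ι_mul h (hy 0), ih (hF.comp_twist _) _ (d := d ∘ Fin.succ)
      (y := y ∘ Fin.succ) (fun i => hy i.succ), Fin.sum_univ_succ (n := p + 1), frontSign_zero, map_one,
      one_smul]
    congr 1
    refine Finset.sum_congr rfl fun i _ => ?_
    have e : L.finProd (y ∘ i.succ.succAbove) =
        L.ι (y 0) * L.finProd ((y ∘ Fin.succ) ∘ i.succAbove) := by
      rw [finProd_succ]
      congr 2
      funext j
      simp
    rw [e, frontSign_succ, map_mul]
    simp only [LinearMap.comp_apply, Function.comp_apply]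
    rw [twist_of_mem _ (L.ι_mem (hy i.succ)), map_smul, smul_mul_assoc, smul_smul, mul_comm]
    rfl

/-- A linear map on `U(g)` which vanishes on products of length other than `n`. -/
def IsConcentrated (L : GradedLieSuperalgebra k g) (n : ℕ) (h : WithConv (L.U →ₗ[k] A)) : Prop :=
  ∀ p ≠ n, ∀ (d : Fin p → Bideg) (y : Fin p → g), (∀ i, y i ∈ L.comp (d i)) → h (L.finProd y) = 0

theorem isConcentrated_one : L.IsConcentrated 0 (1 : WithConv (L.U →ₗ[k] A)) := by
  intro p hp d y hy
  obtain ⟨p, rfl⟩ := Nat.exists_eq_succ_of_ne_zero hp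
  rw [finProd_succ, LinearMap.convOne_apply, counit_ι_mul, map_zero]

/-- `F` consumes exactly one factor; this is what makes the exponential series locally finite. -/
theorem IsInfinitesimal.conv_isConcentrated {F : L.U →ₗ[k] A} (hF : L.IsInfinitesimal F) {n : ℕ}
    {h : WithConv (L.U →ₗ[k] A)} (hh : L.IsConcentrated n h) :
    L.IsConcentrated (n + 1) (toConv F * h) := by
  intro p hp d y hy
  cases p with
  | zero => rw [finProd_zero, hF.conv_one]
  | succ p =>
    rw [hF.conv_finProd h hy]
    refine Finset.sum_eq_zero fun i _ => ?_
    rw [hh p (by omega) (d ∘ i.succAbove) (y ∘ i.succAbove) fun j => hy _, mul_zero, smul_zero]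

theorem IsInfinitesimal.pow_mul_isConcentrated {F : L.U →ₗ[k] A} (hF : L.IsInfinitesimal F)
    {n : ℕ} {h : WithConv (L.U →ₗ[k] A)} (hh : L.IsConcentrated n h) (m : ℕ) :
    L.IsConcentrated (m + n) (toConv F ^ m * h) := by
  induction m with
  | zero => simpa using hh
  | succ m ih =>
    rw [pow_succ', mul_assoc, add_right_comm]
    exact hF.conv_isConcentrated ih

theorem IsInfinitesimal.pow_isConcentrated {F : L.U →ₗ[k] A} (hF : L.IsInfinitesimal F) (m : ℕ) :
    L.IsConcentrated m (toConv F ^ m) := by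
  simpa using hF.pow_mul_isConcentrated isConcentrated_one m

/-- Each convolution factor chooses one of the remaining elements, so the successive choices run
over all permutations. Up to the factor `1 / p!`, this is symmetrization. -/
theorem IsInfinitesimal.pow_finProd {F : L.U →ₗ[k] A} (hF : L.IsInfinitesimal F) {p : ℕ}
    {d : Fin p → Bideg} {y : Fin p → g} (hy : ∀ i, y i ∈ L.comp (d i)) :
    (toConv F ^ p) (L.finProd y) = ∑ σ : Equiv.Perm (Fin p), unitCast k (permSign d σ) •
      (List.ofFn fun i => F (L.ι (y (σ i)))).prod := by
  induction p with
  | zero =>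
    rw [pow_zero, finProd_zero, LinearMap.convOne_apply, counit_one]
    simp [permSign]
  | succ p ih =>
    rw [pow_succ', hF.conv_finProd _ hy, sum_perm_succ]
    refine Finset.sum_congr rfl fun i _ => ?_
    rw [ih (d := d ∘ i.succAbove) (y := y ∘ i.succAbove) fun j => hy _, Finset.mul_sum,
      Finset.smul_sum]
    refine Finset.sum_congr rfl fun τ _ => ?_
    rw [permSign_insertPerm, List.ofFn_succ, List.prod_cons, map_mul, mul_smul, mul_smul_comm]
    rfl

theorem IsConcentrated.eq_zero_of_mem_fil {m N : ℕ} {h : WithConv (L.U →ₗ[k] A)}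
    (hh : L.IsConcentrated m h) (hN : N ≤ m) {u : L.U} (hu : u ∈ L.fil N) : h u = 0 := by
  have : L.fil N ≤ LinearMap.ker h.ofConv := by
    rw [fil, Submodule.span_le]
    rintro _ ⟨l, hl, hlN, rfl⟩
    rw [prodι_eq_finProd]
    exact hh _ (by omega) (fun i => (l.get i).1) _ fun i => hl _ (List.get_mem l i)
  exact this hu

theorem IsInfinitesimal.finProd_of_ne {F : L.U →ₗ[k] A} (hF : L.IsInfinitesimal F) {p : ℕ}
    (hp : p ≠ 1) {d : Fin p → Bideg} {y : Fin p → g} (hy : ∀ i, y i ∈ L.comp (d i)) :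
    F (L.finProd y) = 0 := by
  have := hF.pow_isConcentrated 1 p hp d y hy
  rwa [pow_one] at this

/-- Infinitesimal linear maps whose values on `g` supercommute commute for the convolution. -/
theorem IsInfinitesimal.commute {F F' : L.U →ₗ[k] A} (hF : L.IsInfinitesimal F)
    (hF' : L.IsInfinitesimal F')
    (h : ∀ {i j : Bideg} {x y : g}, x ∈ L.comp i → y ∈ L.comp j →
      F (L.ι x) * F' (L.ι y) = ksign k i j • (F' (L.ι y) * F (L.ι x))) :
    Commute (toConv F) (toConv F') := by
  refine WithConv.ofConv_injective (L.linearMap_ext_finProd fun p d y hy => ?_)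
  change (toConv F * toConv F') _ = (toConv F' * toConv F) _
  match p, d, y, hy with
  | 0, d, y, hy => rw [finProd_zero, hF.conv_one, hF'.conv_one]
  | 1, d, y, hy =>
    rw [hF.conv_finProd _ hy, hF'.conv_finProd _ hy]
    simp [finProd_zero, hF.apply_one, hF'.apply_one]
  -- The only length with content: the two terms of one side are those of the other in the opposite
  -- order.
  | 2, d, y, hy =>
    rw [hF.conv_finProd _ hy, hF'.conv_finProd _ hy]
    refine (Fin.sum_univ_two _).trans (Eq.trans ?_ (Fin.sum_univ_two _).symm)
    simp only [show (1 : Fin 2) = Fin.succ 0 from rfl, frontSign_succ,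
      frontSign_zero, map_one, one_smul, mul_one, finProd_succ, finProd_zero]
    simp only [Function.comp_apply, Fin.succAbove_zero, Fin.succ_succAbove_zero]
    have e1 : unitCast k (koszulSign (d 0) (d (Fin.succ 0))) =
      ksign k (d 0) (d (Fin.succ 0)) := rfl
    have h1 := h (hy 0) (hy (Fin.succ 0))
    have h2 := h (hy (Fin.succ 0)) (hy 0)
    rw [e1, h1, h2, ksign_comm k (d (Fin.succ 0)), smul_smul, ksign_mul_self]
    module
  | p + 3, d, y, hy =>
    have h0 : ∀ {F : L.U →ₗ[k] A} (_ : L.IsInfinitesimal F) (i : Fin (p + 3)),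
        F (L.finProd (y ∘ i.succAbove)) = 0 := fun hF i =>
      hF.finProd_of_ne (by omega) (d := d ∘ i.succAbove) fun j => hy _
    rw [hF.conv_finProd _ hy, hF'.conv_finProd _ hy]
    simp [h0 hF, h0 hF']

end GradedLieSuperalgebra

/-! ### Convolution and the filtration -/

namespace GradedLieSuperalgebra

open CoalgebraStruct WithConv

variable {k g A : Type*} [Field k] [AddCommGroup g] [Module k g] {L : GradedLieSuperalgebra k g}
  [Ring A] [Algebra k A]

theorem twist_mem_fil (d : Bideg) {N : ℕ} {a : L.U} (ha : a ∈ L.fil N) :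
    twist L.grading d a ∈ L.fil N := by
  suffices h : L.fil N ≤ (L.fil N).comap (twist L.grading d) from h ha
  conv_lhs => rw [fil]
  rw [Submodule.span_le]
  rintro _ ⟨l, hl, hN, rfl⟩
  simp only [SetLike.mem_coe, Submodule.mem_comap]
  rw [twist_of_mem d (L.prodι_mem_grading hl)]
  exact Submodule.smul_mem _ _ (L.prodι_mem_fil hl hN)

/-- The comultiplication is compatible with the filtration by the number of factors. -/
theorem comul_mem_span {N : ℕ} {a : L.U} (ha : a ∈ L.fil N) : comul (R := k) a ∈
    Submodule.span k {z : L.U ⊗[k] L.U | ∃ b ∈ L.fil N, ∃ c ∈ L.fil N, z = b ⊗ₜ c} := by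
  suffices h : L.fil N ≤ (Submodule.span k {z : L.U ⊗[k] L.U | ∃ b ∈ L.fil N, ∃ c ∈ L.fil N,
      z = b ⊗ₜ c}).comap comul from h ha
  conv_lhs => rw [fil]
  rw [Submodule.span_le]
  rintro _ ⟨l, hl, hN, rfl⟩
  simp only [SetLike.mem_coe, Submodule.mem_comap]
  clear ha
  induction l generalizing N with
  | nil =>
    rw [prodι_nil, comul_one]
    have := L.prodι_mem_fil isHomog_nil hN
    exact Submodule.subset_span ⟨1, this, 1, this, rfl⟩
  | cons a l ih =>
    rw [isHomog_cons] at hl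
    obtain ⟨N, rfl⟩ : ∃ M, N = M + 1 := ⟨N - 1, by omega⟩
    rw [prodι_cons, comul_ι_mul L hl.1]
    have h := ih hl.2 (N := N) (by simpa using hN)
    have hι : ∀ b ∈ L.fil N, L.ι a.2 * b ∈ L.fil (N + 1) := fun b hb => by
      rw [add_comm]; exact L.mul_mem_fil' (L.ι_mem_fil _) hb
    have hm := L.fil_mono (Nat.le_succ N)
    generalize comul (R := k) (L.prodι l) = z at h ⊢
    induction h using Submodule.span_induction with
    | zero => simp
    | add z z' _ _ hz hz' => rw [map_add]; exact add_mem hz hz'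
    | smul c z _ hz => rw [map_smul]; exact Submodule.smul_mem _ _ hz
    | mem z hz =>
      obtain ⟨b, hb, c, hc, rfl⟩ := hz
      rw [primMul_tmul]
      exact add_mem (Submodule.subset_span ⟨_, hι b hb, _, hm hc, rfl⟩)
        (Submodule.subset_span ⟨_, hm (twist_mem_fil _ hb), _, hι c hc, rfl⟩)

/-- Comultiplication does not leave the filtration step, so inside a convolution product the
exponentials may be replaced by their truncations. -/
theorem conv_congr_of_mem_fil {f f' h h' : WithConv (L.U →ₗ[k] A)} {N : ℕ}
    (hf : ∀ a ∈ L.fil N, f a = f' a) (hh : ∀ a ∈ L.fil N, h a = h' a) {a : L.U}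
    (ha : a ∈ L.fil N) : (f * h) a = (f' * h') a := by
  rw [LinearMap.convMul_apply, LinearMap.convMul_apply]
  congr 1
  refine LinearMap.eqOn_span ?_ (comul_mem_span ha)
  rintro _ ⟨b, hb, c, hc, rfl⟩
  rw [TensorProduct.map_tmul, TensorProduct.map_tmul]
  exact congrArg₂ (· ⊗ₜ[k] ·) (hf b hb) (hh c hc)

end GradedLieSuperalgebra

/-! ### Symmetrization as a convolution exponential -/

namespace GradedSuperspace

open CoalgebraStruct WithConv GradedLieSuperalgebra

variable {k V A B : Type*} [Field k] [AddCommGroup V] [Module k V] (G : GradedSuperspace k V)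
  [Ring A] [Algebra k A] [Ring B] [Algebra k B]

/-- The operators `(c, v) ↦ (0, c y)` on `k × V`, for `y ∈ V`. -/
def firstOrderMap (k V : Type*) [Field k] [AddCommGroup V] [Module k V] :
    V →ₗ[k] Module.End k (k × V) :=
  LinearMap.mk₂ k (fun y p => (0, p.1 • y)) (by intros; simp)
    (fun c y p => Prod.ext (by simp) (smul_comm _ _ _)) (by intros; simp [add_smul])
    (by intros; simp [mul_smul])

theorem firstOrderMap_apply (y : V) (p : k × V) : firstOrderMap k V y p = (0, p.1 • y) := rfl

theorem firstOrderMap_mul (x y : V) : firstOrderMap k V x * firstOrderMap k V y = 0 := by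
  refine LinearMap.ext fun p => ?_
  rw [Module.End.mul_apply, firstOrderMap_apply, firstOrderMap_apply, zero_smul]
  rfl

theorem firstOrderMap_rel {i j : Bideg} {x y : V} (_ : x ∈ G.abelian.comp i)
    (_ : y ∈ G.abelian.comp j) : firstOrderMap k V x * firstOrderMap k V y =
      koszulSign i j • (firstOrderMap k V y * firstOrderMap k V x) +
        firstOrderMap k V (G.abelian.bracket x y) := by
  rw [firstOrderMap_mul, firstOrderMap_mul, smul_zero, zero_add,
    show G.abelian.bracket x y = 0 from rfl, map_zero]

/-- The action of `Sym(V)` on `k × V`, in which `y ∈ V` acts by `(c, v) ↦ (0, c y)`. -/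
def firstOrderRep : G.Sym →ₐ[k] Module.End k (k × V) :=
  G.abelian.lift (firstOrderMap k V) G.firstOrderMap_rel

theorem firstOrderRep_ι (y : V) (p : k × V) :
    G.firstOrderRep (G.symι y) p = (0, p.1 • y) :=
  LinearMap.congr_fun (G.abelian.lift_ι _ G.firstOrderMap_rel y) p

/-- The projection of `Sym(V)` to `V`. -/
def symProj : G.Sym →ₗ[k] V :=
  LinearMap.snd k k V ∘ₗ LinearMap.applyₗ ((1, 0) : k × V) ∘ₗ G.firstOrderRep.toLinearMap

theorem symProj_one : G.symProj 1 = 0 := by simp [symProj]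

/-- Acting by an element of `V` kills the first coordinate, just as the counit kills every product
with a factor in `V`. So `a` sends `(1, 0)` to its constant and linear parts. -/
theorem firstOrderRep_fst (a : G.Sym) :
    (G.firstOrderRep a ((1, 0) : k × V)).1 = counit (R := k) a := by
  revert a
  refine LinearMap.congr_fun (f := LinearMap.fst k k V ∘ₗ LinearMap.applyₗ ((1, 0) : k × V) ∘ₗ
    G.firstOrderRep.toLinearMap) (g := counit) (G.abelian.linearMap_ext_mul ?_ ?_)
  · simp [counit_one]
  · intro d e x a _ _ _
    rw [counit_ι_mul]
    simp only [LinearMap.comp_apply, AlgHom.toLinearMap_apply, map_mul]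
    exact congrArg Prod.fst (G.firstOrderRep_ι x _)

theorem symProj_ι_mul (x : V) (a : G.Sym) :
    G.symProj (G.symι x * a) = counit (R := k) a • x := by
  rw [← firstOrderRep_fst]
  simp only [symProj, LinearMap.comp_apply, AlgHom.toLinearMap_apply, map_mul]
  exact congrArg Prod.snd (G.firstOrderRep_ι x _)

theorem symProj_ι (x : V) : G.symProj (G.symι x) = x := by
  rw [← mul_one (G.symι x), symProj_ι_mul, counit_one, one_smul]

theorem isInfinitesimal_symProj (f : V →ₗ[k] A) :
    G.abelian.IsInfinitesimal (f ∘ₗ G.symProj) where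
  apply_one := by simp [symProj_one]
  apply_ι_mul {d x} _ a := by
    change f (G.symProj (G.symι x * a)) = _ • f (G.symProj (G.symι x))
    rw [symProj_ι_mul, symProj_ι, map_smul]

variable {G}

theorem expTerm_eq_zero (f : V →ₗ[k] A) {n N : ℕ} (hN : N ≤ n) {s : G.Sym}
    (hs : s ∈ G.abelian.fil N) : (toConv (f ∘ₗ G.symProj) ^ n) s = 0 :=
  ((G.isInfinitesimal_symProj f).pow_isConcentrated n).eq_zero_of_mem_fil hN hs

/-- The truncated exponential series of `f : V → A`, for the convolution product. -/
def expTrunc (G : GradedSuperspace k V) (f : V →ₗ[k] A) (N : ℕ) : WithConv (G.Sym →ₗ[k] A) :=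
  ∑ n ∈ Finset.range N, ((n.factorial : k)⁻¹) • toConv (f ∘ₗ G.symProj) ^ n

theorem expTrunc_apply (f : V →ₗ[k] A) (N : ℕ) (s : G.Sym) : G.expTrunc f N s =
    ∑ n ∈ Finset.range N, ((n.factorial : k)⁻¹) • (toConv (f ∘ₗ G.symProj) ^ n) s := by
  rw [expTrunc]
  induction N with
  | zero => rfl
  | succ N ih => rw [Finset.sum_range_succ, Finset.sum_range_succ, ← ih]; rfl

theorem finsum_expTerm (f : V →ₗ[k] A) {N : ℕ} {s : G.Sym} (hs : s ∈ G.abelian.fil N) :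
    ∑ᶠ n : ℕ, ((n.factorial : k)⁻¹) • (toConv (f ∘ₗ G.symProj) ^ n) s = G.expTrunc f N s := by
  rw [expTrunc_apply]
  refine finsum_eq_sum_of_support_subset _ fun n hn => ?_
  by_contra h
  simp only [Finset.coe_range, Set.mem_Iio, not_lt] at h
  exact hn (by simp only [expTerm_eq_zero f h hs, smul_zero])

/-- The symmetrization map `Sym(V) → A` of a linear map `f : V → A` to an algebra: the exponential
of `f` for the convolution product. -/
def symmetrize (G : GradedSuperspace k V) (f : V →ₗ[k] A) : G.Sym →ₗ[k] A where
  toFun s := ∑ᶠ n : ℕ, ((n.factorial : k)⁻¹) • (toConv (f ∘ₗ G.symProj) ^ n) s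
  map_add' s t := by
    obtain ⟨m, hm⟩ := G.abelian.exists_mem_fil s
    obtain ⟨n, hn⟩ := G.abelian.exists_mem_fil t
    have hm' := G.abelian.fil_mono (le_max_left m n) hm
    have hn' := G.abelian.fil_mono (le_max_right m n) hn
    rw [finsum_expTerm f hm', finsum_expTerm f hn', finsum_expTerm f (add_mem hm' hn')]
    exact map_add (G.expTrunc f _).ofConv s t
  map_smul' c s := by
    obtain ⟨m, hm⟩ := G.abelian.exists_mem_fil s
    rw [finsum_expTerm f hm, finsum_expTerm f (Submodule.smul_mem _ c hm)]
    exact map_smul (G.expTrunc f _).ofConv c s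

theorem symmetrize_eq_expTrunc (f : V →ₗ[k] A) {N : ℕ} {s : G.Sym} (hs : s ∈ G.abelian.fil N) :
    G.symmetrize f s = G.expTrunc f N s := finsum_expTerm f hs

theorem symmetrize_finProd_eq_pow (f : V →ₗ[k] A) {p : ℕ} {d : Fin p → Bideg} {y : Fin p → V}
    (hy : ∀ i, y i ∈ G.comp (d i)) : G.symmetrize f (G.abelian.finProd y) =
      ((p.factorial : k)⁻¹) • (toConv (f ∘ₗ G.symProj) ^ p) (G.abelian.finProd y) := by
  rw [symmetrize_eq_expTrunc f (G.abelian.finProd_mem_fil (d := d) hy (Nat.lt_succ_self p)),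
    expTrunc_apply]
  refine Finset.sum_eq_single p (fun n _ hn => ?_) fun h => ?_
  · rw [(G.isInfinitesimal_symProj f).pow_isConcentrated n p hn.symm d y hy, smul_zero]
  · exact absurd (Finset.mem_range.2 (Nat.lt_succ_self p)) h

theorem symmetrize_finProd (f : V →ₗ[k] A) {p : ℕ} {d : Fin p → Bideg} {y : Fin p → V}
    (hy : ∀ i, y i ∈ G.comp (d i)) : G.symmetrize f (G.abelian.finProd y) =
      ((p.factorial : k)⁻¹) • ∑ σ : Equiv.Perm (Fin p), unitCast k (permSign d σ) •
        (List.ofFn fun i => f (y (σ i))).prod := by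
  rw [symmetrize_finProd_eq_pow f hy, (G.isInfinitesimal_symProj f).pow_finProd (d := d) hy]
  congr 1
  refine Finset.sum_congr rfl fun σ _ => ?_
  congr 3
  funext i
  exact congrArg f (G.symProj_ι _)

/-- The explicit formula uses only linear combinations and products. -/
theorem symmetrize_comp (f : V →ₗ[k] A) (h : A →ₐ[k] B) :
    G.symmetrize (h.toLinearMap ∘ₗ f) = h.toLinearMap ∘ₗ G.symmetrize f := by
  refine G.abelian.linearMap_ext_finProd fun p d y hy => ?_
  rw [LinearMap.comp_apply, symmetrize_finProd (G := G) _ hy, symmetrize_finProd (G := G) _ hy]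
  simp only [map_smul, map_sum, AlgHom.toLinearMap_apply, map_list_prod, List.map_ofFn]
  rfl

/-- The exponential of a sum of supercommuting linear maps. -/
theorem symmetrize_add [CharZero k] (f f' : V →ₗ[k] A)
    (h : ∀ {i j : Bideg} {x y : V}, x ∈ G.comp i → y ∈ G.comp j →
      f x * f' y = ksign k i j • (f' y * f x)) :
    toConv (G.symmetrize (f + f')) = toConv (G.symmetrize f) * toConv (G.symmetrize f') := by
  refine WithConv.ofConv_injective (G.abelian.linearMap_ext_finProd fun p d y hy => ?_)
  have hF := G.isInfinitesimal_symProj f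
  have hF' := G.isInfinitesimal_symProj f'
  have hcomm : Commute (toConv (f ∘ₗ G.symProj)) (toConv (f' ∘ₗ G.symProj)) :=
    hF.commute hF' fun {i j x y} hx hy => by
      simp only [LinearMap.comp_apply]
      rw [show G.symProj (G.abelian.ι x) = x from G.symProj_ι x,
        show G.symProj (G.abelian.ι y) = y from G.symProj_ι y]
      exact h hx hy
  have hs := G.abelian.finProd_mem_fil (d := d) hy (Nat.lt_succ_self p)
  change G.symmetrize (f + f') _ = (toConv (G.symmetrize f) * toConv (G.symmetrize f')) _
  -- Truncation turns the identity into the binomial theorem for two commuting elements, in finite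
  -- sums.
  rw [conv_congr_of_mem_fil (f := toConv (G.symmetrize f)) (h := toConv (G.symmetrize f'))
    (f' := G.expTrunc f (p + 1)) (h' := G.expTrunc f' (p + 1))
    (fun a ha => symmetrize_eq_expTrunc f ha) (fun a ha => symmetrize_eq_expTrunc f' ha) hs,
    symmetrize_finProd_eq_pow (G := G) _ hy, LinearMap.add_comp, toConv_add, hcomm.add_pow,
    expTrunc,
    expTrunc, Finset.sum_mul_sum]
  have hsum : ∀ (t : Finset ℕ) (φ : ℕ → WithConv (G.Sym →ₗ[k] A)) (s : G.Sym),
      (∑ i ∈ t, φ i) s = ∑ i ∈ t, φ i s := fun t φ s => by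
    classical
    induction t using Finset.induction_on with
    | empty => rfl
    | insert a t ha ih => rw [Finset.sum_insert ha, Finset.sum_insert ha, ← ih]; rfl
  have hsmul : ∀ (c : k) (φ : WithConv (G.Sym →ₗ[k] A)) (s : G.Sym), (c • φ) s = c • φ s :=
    fun _ _ _ => rfl
  rw [hsum, hsum, Finset.smul_sum]
  refine Finset.sum_congr rfl fun i hi => ?_
  have hip : i ≤ p := by simpa [Nat.lt_succ_iff] using hi
  -- On a product of `p` factors, only the terms with exponents adding up to `p` survive.
  rw [hsum, Finset.sum_eq_single (p - i)]
  · rw [smul_mul_smul_comm, ← nsmul_eq_mul', ← Nat.cast_smul_eq_nsmul k]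
    rw [hsmul, hsmul, smul_smul]
    congr 1
    rw [Nat.cast_choose k hip]
    have h1 : (p.factorial : k) ≠ 0 := Nat.cast_ne_zero.2 p.factorial_ne_zero
    field_simp
  · intro j _ hj
    have := hF.pow_mul_isConcentrated (hF'.pow_isConcentrated j) i p (by omega) d y hy
    rw [smul_mul_smul_comm, hsmul, this, smul_zero]
  · intro hj
    exact absurd (Finset.mem_range.2 (by omega)) hj

end GradedSuperspace

/-! ### Multiplication and the braided middle swap -/

section GradedTensor

variable {k A B : Type*} [Field k] [Ring A] [Ring B] [Algebra k A] [Algebra k B]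
  (𝒜 : Bideg → Submodule k A) (ℬ : Bideg → Submodule k B) [GradedAlgebra 𝒜] [GradedAlgebra ℬ]

theorem superSwap_tmul {i j : Bideg} {a : A} {b : B} (ha : a ∈ 𝒜 i) (hb : b ∈ ℬ j) :
    superSwap 𝒜 ℬ (a ⊗ₜ b) = ksign k i j • b ⊗ₜ[k] a := by
  have h := GradedTensorProduct.comm_coe_tmul_coe (R := k) 𝒜 ℬ ⟨a, ha⟩ ⟨b, hb⟩
  rw [uzpow_bideg, ← ksign_smul k, ksign_comm] at h
  exact h

theorem superMiddleSwap_tmul {i j : Bideg} (a : A) {a' : A} {b : B} (b' : B) (ha : a' ∈ 𝒜 i)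
    (hb : b ∈ ℬ j) : superMiddleSwap 𝒜 ℬ ((a ⊗ₜ a') ⊗ₜ (b ⊗ₜ b')) =
      ksign k i j • ((a ⊗ₜ[k] b) ⊗ₜ[k] (a' ⊗ₜ[k] b')) := by
  simp [superMiddleSwap, superSwap_tmul 𝒜 ℬ ha hb, TensorProduct.smul_tmul',
    TensorProduct.tmul_smul]

variable {C : Type*} [Ring C] [Algebra k C] (𝒞 : Bideg → Submodule k C) [GradedAlgebra 𝒞]

open GradedTensorProduct in
/-- The product in `C ⊗ C` of the images of elements of `A ⊗ A` and `B ⊗ B`. -/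
theorem gradedTensor_map_mul_map {f : A →ₗ[k] C} {h : B →ₗ[k] C}
    (hf : ∀ (d : Bideg) (a : A), a ∈ 𝒜 d → f a ∈ 𝒞 d)
    (hh : ∀ (d : Bideg) (b : B), b ∈ ℬ d → h b ∈ 𝒞 d) (z : A ⊗[k] A) (w : B ⊗[k] B) :
    (of k 𝒞 𝒞 (TensorProduct.map f f z) * of k 𝒞 𝒞 (TensorProduct.map h h w) : 𝒞 ᵍ⊗[k] 𝒞) =
      of k 𝒞 𝒞 (TensorProduct.map (LinearMap.mul' k C ∘ₗ TensorProduct.map f h)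
        (LinearMap.mul' k C ∘ₗ TensorProduct.map f h) (superMiddleSwap 𝒜 ℬ (z ⊗ₜ w))) := by
  induction z using TensorProduct.induction_on with
  | zero => simp
  | add z z' hz hz' => simp only [map_add, add_mul, TensorProduct.add_tmul, hz, hz']
  | tmul a a' =>
  induction w using TensorProduct.induction_on with
  | zero => simp
  | add z z' hz hz' => simp only [map_add, mul_add, TensorProduct.tmul_add, hz, hz']
  | tmul b b' =>
  induction a' using DirectSum.Decomposition.inductionOn 𝒜 with
  | zero => simp
  | add z z' hz hz' =>
    simp only [map_add, add_mul, TensorProduct.add_tmul, TensorProduct.tmul_add, hz, hz']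
  | homogeneous a' =>
  induction b using DirectSum.Decomposition.inductionOn ℬ with
  | zero => simp
  | add z z' hz hz' =>
    simp only [map_add, mul_add, TensorProduct.add_tmul, TensorProduct.tmul_add, hz, hz']
  | homogeneous b =>
  rw [superMiddleSwap_tmul 𝒜 ℬ a b' a'.2 b.2, TensorProduct.map_tmul, TensorProduct.map_tmul]
  refine (gradedTensor_mul_of_mem 𝒞 𝒞 (f a) (hf _ _ a'.2) (hh _ _ b.2) (h b')).trans ?_
  rw [map_smul, map_smul]
  rfl

end GradedTensor

/-! ### Symmetrization respects grading, counit and comultiplication -/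

namespace GradedSuperspace

open CoalgebraStruct WithConv GradedLieSuperalgebra

variable {k V g : Type*} [Field k] [AddCommGroup V] [Module k V] {G : GradedSuperspace k V}
  [AddCommGroup g] [Module k g] {L : GradedLieSuperalgebra k g}

theorem symmetrize_one {A : Type*} [Ring A] [Algebra k A] (f : V →ₗ[k] A) :
    G.symmetrize f 1 = 1 := by
  have := symmetrize_finProd (G := G) f (p := 0) (d := Fin.elim0) (y := Fin.elim0) (by simp)
  rw [finProd_zero] at this
  rw [this]
  simp [permSign]

theorem symmetrize_mem_grading {f : V →ₗ[k] g} (hf : ∀ d y, y ∈ G.comp d → f y ∈ L.comp d)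
    (d : Bideg) (s : G.Sym) (hs : s ∈ G.symGrading d) :
    G.symmetrize (L.ι ∘ₗ f) s ∈ L.grading d := by
  suffices h : G.symGrading d ≤ (L.grading d).comap (G.symmetrize (L.ι ∘ₗ f)) from h hs
  conv_lhs => rw [symGrading, grading]
  rw [Submodule.span_le]
  rintro _ ⟨l, hl, rfl, rfl⟩
  simp only [SetLike.mem_coe, Submodule.mem_comap]
  have hy : ∀ i, (l.get i).2 ∈ G.comp (l.get i).1 := fun i => hl _ (List.get_mem l i)
  rw [← prodι, prodι_eq_finProd, symmetrize_finProd _ hy]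
  refine Submodule.smul_mem _ _ (Submodule.sum_mem _ fun σ _ => Submodule.smul_mem _ _ ?_)
  have h1 := L.finProd_eq_prodι (fun i => (l.get (σ i)).1) (fun i => f (l.get (σ i)).2)
  have h2 := L.prodι_mem_grading (L.isHomog_ofFn fun i => hf _ _ (hy (σ i)))
  rw [← h1, List.map_ofFn, List.sum_ofFn] at h2
  have h3 : ∑ i, (Prod.fst ∘ fun i => ((l.get (σ i)).1, f (l.get (σ i)).2)) i =
      (l.map Prod.fst).sum := by
    refine (Equiv.sum_comp σ fun i => (l.get i).1).trans ?_
    rw [← List.sum_ofFn]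
    congr 1
    conv_rhs => rw [← List.ofFn_get l, List.map_ofFn]
    rfl
  rw [h3] at h2
  exact h2

theorem counit_symmetrize (f : V →ₗ[k] g) (s : G.Sym) :
    counit (R := k) (G.symmetrize (L.ι ∘ₗ f) s) = counit (R := k) s := by
  revert s
  refine LinearMap.congr_fun (f := counit ∘ₗ G.symmetrize (L.ι ∘ₗ f)) (g := counit)
    (G.abelian.linearMap_ext_finProd fun p d y hy => ?_)
  rw [LinearMap.comp_apply]
  cases p with
  | zero => rw [finProd_zero, symmetrize_one, counit_one, counit_one]
  | succ p =>
    rw [symmetrize_finProd (G := G) _ hy, finProd_succ, counit_ι_mul]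
    simp only [map_smul, map_sum, List.ofFn_succ, List.prod_cons, LinearMap.comp_apply,
      counit_ι_mul, smul_zero, Finset.sum_const_zero]

/-- `Δ` is an algebra map, so it carries the exponential of `ι ∘ f` to that of `ι f ⊗ 1 + 1 ⊗ ι f`.
The two summands supercommute, so this is a convolution product of exponentials, which unfolds to
the right-hand side. -/
theorem comul_symmetrize [CharZero k] {f : V →ₗ[k] g}
    (hf : ∀ d y, y ∈ G.comp d → f y ∈ L.comp d) (s : G.Sym) :
    comul (R := k) (G.symmetrize (L.ι ∘ₗ f) s) =
      TensorProduct.map (G.symmetrize (L.ι ∘ₗ f)) (G.symmetrize (L.ι ∘ₗ f)) (comul s) := by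
  let iL := GradedTensorProduct.includeLeft (R := k) L.grading L.grading
  let iR := GradedTensorProduct.includeRight (R := k) L.grading L.grading
  have h1 : L.comulAlgHom.toLinearMap ∘ₗ (L.ι ∘ₗ f) =
      iL.toLinearMap ∘ₗ (L.ι ∘ₗ f) + iR.toLinearMap ∘ₗ (L.ι ∘ₗ f) := by
    ext x
    exact L.comulAlgHom_ι (f x)
  have h2 := symmetrize_add (G := G) (iL.toLinearMap ∘ₗ (L.ι ∘ₗ f)) (iR.toLinearMap ∘ₗ (L.ι ∘ₗ f))
    (fun {i j x y} hx hy => by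
      have h := gradedTensor_mul_of_mem L.grading L.grading 1 (L.ι_mem (hf _ _ hy))
        (L.ι_mem (hf _ _ hx)) 1
      have h' := GradedTensorProduct.tmul_one_mul_one_tmul (R := k) L.grading L.grading
        (L.ι (f x)) (L.ι (f y))
      rw [one_mul, mul_one] at h
      change L.ι (f x) ᵍ⊗ₜ[k] 1 * 1 ᵍ⊗ₜ[k] L.ι (f y) = _ • (1 ᵍ⊗ₜ[k] L.ι (f y) *
        L.ι (f x) ᵍ⊗ₜ[k] 1)
      rw [h, h', smul_smul, ksign_comm k j, ksign_mul_self, one_smul])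
  rw [← h1, symmetrize_comp, symmetrize_comp, symmetrize_comp] at h2
  have h3 : L.comulAlgHom (G.symmetrize (L.ι ∘ₗ f) s) = LinearMap.mul' k _ (TensorProduct.map
      (iL.toLinearMap ∘ₗ G.symmetrize (L.ι ∘ₗ f)) (iR.toLinearMap ∘ₗ G.symmetrize (L.ι ∘ₗ f))
        (comul s)) := LinearMap.congr_fun (congrArg WithConv.ofConv h2) s
  rw [comul_def, h3]
  generalize comul (R := k) s = z
  rw [LinearEquiv.symm_apply_eq]
  induction z using TensorProduct.induction_on with
  | zero => simp
  | add z z' hz hz' => simp only [map_add, hz, hz']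
  | tmul a b =>
    rw [TensorProduct.map_tmul, TensorProduct.map_tmul, LinearMap.mul'_apply]
    exact GradedTensorProduct.tmul_one_mul_one_tmul (R := k) L.grading L.grading _ _

end GradedSuperspace

/-! ### The comparison map is a map of coalgebras -/

namespace GradedLieSubalgebra

open CoalgebraStruct GradedLieSuperalgebra GradedSuperspace

variable {k g : Type*} [Field k] [AddCommGroup g] [Module k g] {L : GradedLieSuperalgebra k g}
  (H : GradedLieSubalgebra L)

theorem incl_ι (x : H.carrier) : H.incl (H.toLie.ι x) = L.ι x :=
  H.toLie.lift_ι (L.ι ∘ₗ H.carrier.subtype) (fun hx hy => L.ι_mul_ι hx hy) x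

theorem incl_prodι (l : List (Bideg × H.carrier)) :
    H.incl (H.toLie.prodι l) = L.prodι (l.map (Prod.map id Subtype.val)) := by
  induction l with
  | nil => simp
  | cons a l ih => simp [ih, incl_ι]

theorem isHomog_map_val {l : List (Bideg × H.carrier)} (hl : H.toLie.IsHomog l) :
    L.IsHomog (l.map (Prod.map id Subtype.val)) := by
  intro a ha
  obtain ⟨b, hb, rfl⟩ := List.mem_map.1 ha
  exact hl b hb

theorem incl_mem_grading (d : Bideg) (a : H.toLie.U) (ha : a ∈ H.toLie.grading d) :
    H.incl a ∈ L.grading d := by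
  suffices h : H.toLie.grading d ≤ (L.grading d).comap H.incl.toLinearMap from h ha
  conv_lhs => rw [grading]
  rw [Submodule.span_le]
  rintro _ ⟨l, hl, rfl, rfl⟩
  simp only [SetLike.mem_coe, Submodule.mem_comap, AlgHom.toLinearMap_apply]
  rw [← prodι, incl_prodι]
  have := L.prodι_mem_grading (H.isHomog_map_val hl)
  rwa [List.map_map] at this

theorem counit_incl (a : H.toLie.U) : counit (R := k) (H.incl a) = counit (R := k) a := by
  revert a
  refine LinearMap.congr_fun (f := counit ∘ₗ H.incl.toLinearMap) (g := counit)
    (H.toLie.linearMap_ext_mul ?_ fun d e x a hx _ h => ?_)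
  · simp [counit_one]
  · simp only [LinearMap.comp_apply, AlgHom.toLinearMap_apply, map_mul, incl_ι, counit_ι_mul]

theorem comul_incl (a : H.toLie.U) : comul (R := k) (H.incl a) =
    TensorProduct.map H.incl.toLinearMap H.incl.toLinearMap (comul a) := by
  revert a
  refine LinearMap.congr_fun (f := comul ∘ₗ H.incl.toLinearMap)
    (g := TensorProduct.map H.incl.toLinearMap H.incl.toLinearMap ∘ₗ comul)
    (H.toLie.linearMap_ext_mul ?_ fun d e x a hx _ h => ?_)
  · simp [comul_one]
  · simp only [LinearMap.comp_apply, AlgHom.toLinearMap_apply, map_mul, incl_ι] at h ⊢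
    rw [comul_ι_mul L (x := (x : g)) hx, comul_ι_mul H.toLie hx, h]
    generalize comul (R := k) a = z
    induction z using TensorProduct.induction_on with
    | zero => simp
    | add z z' hz hz' => simp only [map_add, hz, hz']
    | tmul a b =>
      have ht := map_twist H.toLie.grading L.grading (f := H.incl.toLinearMap) H.incl_mem_grading
      simp only [TensorProduct.map_tmul, primMul_tmul, map_add, ht]
      simp [incl_ι]

variable (M : GradedSubspace L.toGradedSuperspace)

/-- The map `a ⊗ y₁ ⊙ ⋯ ⊙ y_p ↦ a · (1 / p!) ∑ ± y_σ(1) ⋯ y_σ(p)` from `U(h) ⊗ Sym(m)` to `U(g)`,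
for a graded subalgebra `h` and a graded subspace `m` of `g`. -/
def mulSymmetrize : H.toLie.grading ᵍ⊗[k] M.toSuperspace.symGrading →ₗ[k] L.U :=
  LinearMap.mul' k L.U ∘ₗ TensorProduct.map H.incl.toLinearMap
    (M.toSuperspace.symmetrize (L.ι ∘ₗ M.carrier.subtype)) ∘ₗ
      (GradedTensorProduct.of k H.toLie.grading M.toSuperspace.symGrading).symm.toLinearMap

theorem mulSymmetrize_tmul (a : H.toLie.U) (s : M.toSuperspace.Sym) :
    H.mulSymmetrize M (a ᵍ⊗ₜ[k] s) =
      H.incl a * M.toSuperspace.symmetrize (L.ι ∘ₗ M.carrier.subtype) s := rfl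

theorem counit_comp_mulSymmetrize : counit ∘ₗ H.mulSymmetrize M = counit (R := k) := by
  refine GradedTensorProduct.hom_ext _ _ (TensorProduct.ext' fun a s => ?_)
  change L.counitAlgHom (H.incl a * _) = counit a * counit s
  rw [map_mul, ← H.counit_incl a, ← counit_symmetrize (L := L) M.carrier.subtype s]
  rfl

/-- `Δ` is multiplicative on `U(g)`, and both `incl` and symmetrization preserve comultiplication
and bidegrees. Hence the sign in the product of `U(g) ⊗ U(g)` is the sign of the middle swap. -/
theorem map_comp_comul_mulSymmetrize [CharZero k] :
    TensorProduct.map (H.mulSymmetrize M) (H.mulSymmetrize M) ∘ₗ comul =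
      comul ∘ₗ H.mulSymmetrize M := by
  refine GradedTensorProduct.hom_ext _ _ (TensorProduct.ext' fun a s => ?_)
  have h := gradedTensor_map_mul_map H.toLie.grading M.toSuperspace.symGrading L.grading
    (f := H.incl.toLinearMap) H.incl_mem_grading
    (h := M.toSuperspace.symmetrize (L.ι ∘ₗ M.carrier.subtype))
    (symmetrize_mem_grading fun d y hy => hy) (comul a) (comul s)
  rw [← comul_incl, ← comul_symmetrize fun d y hy => hy] at h
  have h' : comul (R := k) (H.mulSymmetrize M (a ᵍ⊗ₜ[k] s)) =
      (GradedTensorProduct.of k L.grading L.grading).symm (L.comulAlgHom (H.incl a) *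
        L.comulAlgHom (M.toSuperspace.symmetrize (L.ι ∘ₗ M.carrier.subtype) s)) := by
    rw [comul_def, mulSymmetrize_tmul, map_mul]
  refine Eq.trans ?_ h'.symm
  rw [LinearEquiv.eq_symm_apply]
  refine Eq.trans ?_ h.symm
  exact congrArg (GradedTensorProduct.of k L.grading L.grading) (LinearMap.congr_fun
    (TensorProduct.map_comp (H.mulSymmetrize M) (H.mulSymmetrize M)
      (GradedTensorProduct.of k H.toLie.grading M.toSuperspace.symGrading).toLinearMap
      (GradedTensorProduct.of k H.toLie.grading M.toSuperspace.symGrading).toLinearMap) _).symm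

end GradedLieSubalgebra

/-! ### Leading terms of reordered products and of symmetrizations -/

namespace GradedLieSuperalgebra

variable {k g : Type*} [Field k] [AddCommGroup g] [Module k g] {L : GradedLieSuperalgebra k g}

theorem ι_mul_mem_fil (x : g) {n : ℕ} {a : L.U} (ha : a ∈ L.fil n) : L.ι x * a ∈ L.fil (n + 1) := by
  rw [add_comm]; exact L.mul_mem_fil' (L.ι_mem_fil _) ha

/-- Moving `y i` to the front passes each earlier factor once, at the cost of a Koszul sign and a
shorter product. -/
theorem frontSign_smul_sub_mem_fil {p : ℕ} {d : Fin (p + 1) → Bideg} {y : Fin (p + 1) → g}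
    (hy : ∀ i, y i ∈ L.comp (d i)) (i : Fin (p + 1)) :
    unitCast k (frontSign d i) • (L.ι (y i) * L.finProd (y ∘ i.succAbove)) - L.finProd y ∈
      L.fil (p + 1) := by
  induction p with
  | zero =>
    rw [Fin.fin_one_eq_zero i, frontSign_zero, map_one, one_smul, finProd_succ L y]
    simp [finProd_zero]
  | succ p ih =>
    refine Fin.cases ?_ (fun i => ?_) i
    · rw [frontSign_zero, map_one, one_smul, finProd_succ L y]
      have : y ∘ Fin.succAbove 0 = y ∘ Fin.succ := by funext j; simp
      rw [this, sub_self]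
      exact zero_mem _
    · have e : L.finProd (y ∘ i.succ.succAbove) =
          L.ι (y 0) * L.finProd ((y ∘ Fin.succ) ∘ i.succAbove) := by
        rw [finProd_succ]
        congr 2
        funext j
        simp
      have hR := L.finProd_mem_fil (d := (d ∘ Fin.succ) ∘ i.succAbove)
        (y := (y ∘ Fin.succ) ∘ i.succAbove) (fun j => hy _) (Nat.lt_succ_self p)
      have h1 := L.ι_mul_swap_mem_fil (hy i.succ) (hy 0) hR
      have h2 := ι_mul_mem_fil (y 0) (ih (d := d ∘ Fin.succ) (y := y ∘ Fin.succ)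
        (fun j => hy _) i)
      have h3 := add_mem (Submodule.smul_mem _ (unitCast k (frontSign (d ∘ Fin.succ) i)) h1) h2
      rw [frontSign_succ, map_mul, e, finProd_succ L y]
      rw [ksign_comm, ksign] at h3
      convert h3 using 1
      rw [mul_sub, mul_smul_comm, smul_sub, smul_smul, mul_comm (unitCast k (koszulSign _ _))]
      simp only [Function.comp_apply]
      abel

theorem permSign_smul_sub_mem_fil {p : ℕ} {d : Fin p → Bideg} {y : Fin p → g}
    (hy : ∀ i, y i ∈ L.comp (d i)) (σ : Equiv.Perm (Fin p)) :
    unitCast k (permSign d σ) • L.finProd (y ∘ σ) - L.finProd y ∈ L.fil p := by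
  induction p with
  | zero => simp [finProd_zero, permSign]
  | succ p ih =>
    obtain ⟨⟨i, τ⟩, rfl⟩ := (insertPerm_bijective p).2 σ
    have h1 := frontSign_smul_sub_mem_fil hy i
    have h2 := Submodule.smul_mem _ (unitCast k (frontSign d i)) (ι_mul_mem_fil (y i)
      (ih (d := d ∘ i.succAbove) (y := y ∘ i.succAbove) (fun j => hy _) τ))
    have e : L.finProd (y ∘ insertPerm i τ) =
        L.ι (y i) * L.finProd ((y ∘ i.succAbove) ∘ τ) := by
      rw [finProd_succ]; rfl
    have h3 := add_mem h2 h1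
    simp only at h3 ⊢
    rw [permSign_insertPerm, e, map_mul]
    convert h3 using 1
    rw [mul_sub, mul_smul_comm, smul_sub, smul_smul]
    abel

end GradedLieSuperalgebra

namespace GradedSuperspace

/-- The image of a list of elements of `V` under a map `f`. -/
def mapList {V g : Type*} (f : V → g) (l : List (Bideg × V)) : List (Bideg × g) :=
  l.map (Prod.map id f)

theorem length_mapList {V g : Type*} (f : V → g) (l : List (Bideg × V)) :
    (mapList f l).length = l.length := by
  simp [mapList]

open GradedLieSuperalgebra

variable {k V g : Type*} [Field k] [AddCommGroup V] [Module k V] {G : GradedSuperspace k V}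
  [AddCommGroup g] [Module k g] {L : GradedLieSuperalgebra k g}

theorem isHomog_mapList {f : V → g} (hf : ∀ d y, y ∈ G.comp d → f y ∈ L.comp d)
    {l : List (Bideg × V)} (hl : G.abelian.IsHomog l) : L.IsHomog (mapList f l) := by
  intro a ha
  obtain ⟨b, hb, rfl⟩ := List.mem_map.1 ha
  exact hf _ _ (hl b hb)

/-- Symmetrization agrees with the product up to shorter products. -/
theorem symmetrize_sub_mem_fil [CharZero k] {f : V →ₗ[k] g}
    (hf : ∀ d y, y ∈ G.comp d → f y ∈ L.comp d) {l : List (Bideg × V)}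
    (hl : G.abelian.IsHomog l) :
    G.symmetrize (L.ι ∘ₗ f) (G.abelian.prodι l) - L.prodι (mapList f l) ∈ L.fil l.length := by
  have hy : ∀ i, (l.get i).2 ∈ G.comp (l.get i).1 := fun i => hl _ (List.get_mem l i)
  have e : L.prodι (mapList f l) = L.finProd fun i => f (l.get i).2 := by
    rw [L.finProd_eq_prodι fun i => (l.get i).1]
    congr 1
    conv_lhs => rw [← List.ofFn_get l, mapList, List.map_ofFn]
    rfl
  have hc : (l.length.factorial : k) ≠ 0 := Nat.cast_ne_zero.2 (Nat.factorial_ne_zero _)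
  -- The product is written as an average of equal terms, to be compared with the symmetrization
  -- permutation by permutation.
  have e' : L.prodι (mapList f l) = ((l.length.factorial : k)⁻¹) •
      ∑ _σ : Equiv.Perm (Fin l.length), L.finProd fun i => f (l.get i).2 := by
    rw [Finset.sum_const, Finset.card_univ, Fintype.card_perm, Fintype.card_fin,
      ← Nat.cast_smul_eq_nsmul k, smul_smul, inv_mul_cancel₀ hc, one_smul, e]
  rw [e', prodι_eq_finProd, symmetrize_finProd _ hy, ← smul_sub, ← Finset.sum_sub_distrib]
  exact Submodule.smul_mem _ _ (Submodule.sum_mem _ fun σ _ =>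
    permSign_smul_sub_mem_fil (fun i => hf _ _ (hy i)) σ)

theorem symmetrize_mem_fil [CharZero k] {f : V →ₗ[k] g}
    (hf : ∀ d y, y ∈ G.comp d → f y ∈ L.comp d) {l : List (Bideg × V)}
    (hl : G.abelian.IsHomog l) :
    G.symmetrize (L.ι ∘ₗ f) (G.abelian.prodι l) ∈ L.fil (l.length + 1) := by
  rw [← sub_add_cancel (G.symmetrize (L.ι ∘ₗ f) (G.abelian.prodι l)) (L.prodι (mapList f l))]
  exact add_mem (L.fil_mono (Nat.le_succ _) (symmetrize_sub_mem_fil hf hl))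
    (L.prodι_mem_fil (isHomog_mapList hf hl) (by rw [length_mapList]; exact Nat.lt_succ_self _))

end GradedSuperspace

namespace GradedLieSuperalgebra

open GradedSuperspace

variable {k g : Type*} [Field k] [AddCommGroup g] [Module k g] {L : GradedLieSuperalgebra k g}

variable (L) in
/-- Symmetrization `Sym(g) → U(g)` is surjective. -/
theorem symmetrize_surjective [CharZero k] :
    Function.Surjective (L.toGradedSuperspace.symmetrize L.ι) := by
  have h : ∀ N, L.fil N ≤ LinearMap.range (L.toGradedSuperspace.symmetrize L.ι) := by
    intro N
    induction N with
    | zero => rw [fil_zero]; exact bot_le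
    | succ N ih =>
      conv_lhs => rw [fil]
      rw [Submodule.span_le]
      rintro _ ⟨l, hl, hN, rfl⟩
      have := symmetrize_sub_mem_fil (G := L.toGradedSuperspace) (L := L) (f := LinearMap.id)
        (fun d y hy => hy) (l := l) hl
      rw [show mapList (LinearMap.id : g →ₗ[k] g) l = l from List.map_id _] at this
      have := ih (L.fil_mono (by omega) this)
      rw [← neg_mem_iff, neg_sub] at this
      exact (Submodule.sub_mem_iff_left _ (LinearMap.mem_range_self _ _)).1 this
  intro u
  obtain ⟨N, hN⟩ := L.exists_mem_fil u
  exact h N hN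

end GradedLieSuperalgebra

/-! ### Homogeneous elements and complements -/

section Complement

variable {k g : Type*} [Field k] [AddCommGroup g] [Module k g]

/-- The homogeneous elements of a direct sum of graded subspaces have homogeneous components. -/
theorem GradedSuperspace.exists_add_eq {G : GradedSuperspace k g} {H M : GradedSubspace G}
    (h : IsCompl H.carrier M.carrier) {d : Bideg} {x : g} (hx : x ∈ G.comp d) :
    ∃ y ∈ H.carrier ⊓ G.comp d, ∃ z ∈ M.carrier ⊓ G.comp d, y + z = x := by
  let C : Bideg → Submodule k g := fun d => (H.carrier ⊓ G.comp d) ⊔ (M.carrier ⊓ G.comp d)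
  have hC : ∀ d, C d ≤ G.comp d := fun d => sup_le inf_le_right inf_le_right
  have htop : ⨆ d, C d = ⊤ := by
    rw [eq_top_iff, ← h.sup_eq_top, iSup_sup_eq]
    exact sup_le_sup H.graded M.graded
  have hind := G.isInternal.submodule_iSupIndep d
  -- Writing `x` as a part in `C d` plus a part in the other components, the second part also has
  -- bidegree `d` and therefore vanishes.
  have hle : (⊤ : Submodule k g) ≤ C d ⊔ ⨆ (e) (_ : e ≠ d), G.comp e := by
    rw [← htop]
    refine iSup_le fun e => ?_
    by_cases he : e = d
    · subst he; exact le_sup_left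
    · exact le_sup_of_le_right ((hC e).trans (le_iSup₂_of_le e he le_rfl))
  obtain ⟨c, hc, e, he, hce⟩ := Submodule.mem_sup.1 (hle (Submodule.mem_top (x := x)))
  have he' : e ∈ G.comp d := by
    rw [← add_sub_cancel_left c e, hce]
    exact sub_mem hx (hC d hc)
  have he0 : e = 0 := (Submodule.disjoint_def.1 hind) e he' he
  rw [he0, add_zero] at hce
  subst hce
  exact Submodule.mem_sup.1 hc

theorem GradedSubspace.exists_lift {G : GradedSuperspace k g} (W : GradedSubspace G)
    (l : List (Bideg × g)) (h : ∀ a ∈ l, a.2 ∈ W.carrier ∧ a.2 ∈ G.comp a.1) :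
    ∃ l' : List (Bideg × W.carrier), W.toSuperspace.abelian.IsHomog l' ∧
      GradedSuperspace.mapList W.carrier.subtype l' = l := by
  induction l with
  | nil => exact ⟨[], GradedLieSuperalgebra.isHomog_nil, rfl⟩
  | cons a l ih =>
    obtain ⟨l', hl', rfl⟩ := ih fun b hb => h b (List.mem_cons_of_mem _ hb)
    obtain ⟨h1, h2⟩ := h a List.mem_cons_self
    exact ⟨(a.1, ⟨a.2, h1⟩) :: l', GradedLieSuperalgebra.isHomog_cons.2 ⟨h2, hl'⟩, rfl⟩

end Complement

/-! ### Surjectivity -/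

namespace GradedLieSubalgebra

open GradedLieSuperalgebra GradedSuperspace

variable {k g : Type*} [Field k] [AddCommGroup g] [Module k g] {L : GradedLieSuperalgebra k g}
  (H : GradedLieSubalgebra L) (M : GradedSubspace L.toGradedSuperspace)

theorem incl_mem_fil {N : ℕ} {a : H.toLie.U} (ha : a ∈ H.toLie.fil N) : H.incl a ∈ L.fil N := by
  suffices h : H.toLie.fil N ≤ (L.fil N).comap H.incl.toLinearMap from h ha
  conv_lhs => rw [fil]
  rw [Submodule.span_le]
  rintro _ ⟨l, hl, hN, rfl⟩
  simp only [SetLike.mem_coe, Submodule.mem_comap, AlgHom.toLinearMap_apply]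
  rw [incl_prodι]
  exact L.prodι_mem_fil (H.isHomog_map_val hl) (by simpa using hN)

/-- Products of homogeneous elements of a direct sum are combinations of products whose factors
lie in one of the summands. -/
theorem prodι_mem_span_split (h : IsCompl H.carrier M.carrier) {l : List (Bideg × g)}
    (hl : L.IsHomog l) : L.prodι l ∈ Submodule.span k {u | ∃ l' : List (Bideg × g),
      L.IsHomog l' ∧ l'.length = l.length ∧ (∀ a ∈ l', a.2 ∈ H.carrier ∨ a.2 ∈ M.carrier) ∧
        u = L.prodι l'} := by
  induction l with
  | nil => exact Submodule.subset_span ⟨[], isHomog_nil, rfl, by simp, rfl⟩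
  | cons a l ih =>
    rw [isHomog_cons] at hl
    obtain ⟨y, hy, z, hz, hyz⟩ := exists_add_eq (H := H.toGradedSubspace) h hl.1
    have h1 : ∀ w : g, w ∈ L.comp a.1 → (w ∈ H.carrier ∨ w ∈ M.carrier) →
        L.ι w * L.prodι l ∈ Submodule.span k {u | ∃ l' : List (Bideg × g),
          L.IsHomog l' ∧ l'.length = (a :: l).length ∧
            (∀ a ∈ l', a.2 ∈ H.carrier ∨ a.2 ∈ M.carrier) ∧ u = L.prodι l'} := by
      intro w hw hw'
      have := Submodule.mem_map_of_mem (f := LinearMap.mulLeft k (L.ι w)) (ih hl.2)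
      rw [Submodule.map_span] at this
      refine Submodule.span_mono ?_ this
      rintro _ ⟨_, ⟨l', h1, h2, h3, rfl⟩, rfl⟩
      exact ⟨(a.1, w) :: l', isHomog_cons.2 ⟨hw, h1⟩, by simp [h2],
        by simpa [hw'] using h3, by simp⟩
    rw [prodι_cons, ← hyz, map_add, add_mul]
    exact add_mem (h1 y hy.2 (Or.inl hy.1)) (h1 z hz.2 (Or.inr hz.1))

/-- Up to shorter products, already in the range by induction, a product may be split into factors
from `h` or `m`, reordered with those from `h` first, and its `m`-part replaced by a symmetrization.
The result is a multiple of a value of the map. -/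
theorem mulSymmetrize_surjective [CharZero k] (h : IsCompl H.carrier M.carrier) :
    Function.Surjective (H.mulSymmetrize M) := by
  classical
  have hN : ∀ N, L.fil N ≤ LinearMap.range (H.mulSymmetrize M) := by
    intro N
    induction N with
    | zero => rw [fil_zero]; exact bot_le
    | succ N ih =>
      conv_lhs => rw [fil]
      rw [Submodule.span_le]
      rintro _ ⟨l, hl, hN, rfl⟩
      refine Submodule.span_le.2 ?_ (H.prodι_mem_span_split M h hl)
      rintro _ ⟨l', hl', hlen, hsplit, rfl⟩
      have hperm :=
        (List.filter_append_perm (fun a : Bideg × g => decide (a.2 ∈ H.carrier)) l').symm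
      obtain ⟨c, hc⟩ := L.exists_smul_prodι_sub_mem_fil hperm hl'
      obtain ⟨l₁, h1, e1⟩ := H.toGradedSubspace.exists_lift
        (l'.filter fun a : Bideg × g => decide (a.2 ∈ H.carrier)) (fun a ha => by
          rw [List.mem_filter] at ha
          exact ⟨by simpa using ha.2, hl' a ha.1⟩)
      obtain ⟨l₂, h2, e2⟩ := M.exists_lift
        (l'.filter fun a : Bideg × g => !decide (a.2 ∈ H.carrier)) (fun a ha => by
          rw [List.mem_filter] at ha
          exact ⟨(hsplit a ha.1).resolve_left (by simpa using ha.2), hl' a ha.1⟩)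
      have hlen' := hperm.length_eq
      rw [List.length_append, ← e1, ← e2, length_mapList, length_mapList] at hlen'
      rw [← e1, ← e2, prodι_append] at hc
      have h1' : L.prodι (mapList H.carrier.subtype l₁) = H.incl (H.toLie.prodι l₁) :=
        (H.incl_prodι l₁).symm
      have h2' := symmetrize_sub_mem_fil (L := L) (f := M.carrier.subtype) (fun d y hy => hy) h2
      have h3 := L.mul_mem_fil' (m := l₁.length) (L.prodι_mem_fil (isHomog_mapList (L := L)
        (f := H.carrier.subtype) (fun d y hy => hy) h1)
        (by rw [length_mapList]; exact Nat.lt_succ_self _)) h2'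
      rw [mul_sub, h1', ← mulSymmetrize_tmul] at h3
      rw [h1'] at hc
      have h4 := ih (L.fil_mono (by omega) hc)
      have h5 := ih (L.fil_mono (by omega) h3)
      rw [← neg_mem_iff, neg_sub] at h5
      have h6 := (Submodule.sub_mem_iff_left _ (LinearMap.mem_range_self _ _)).1 h5
      exact (Submodule.sub_mem_iff_left _ (Submodule.smul_mem _ c h6)).1 h4
  intro u
  obtain ⟨N, hu⟩ := L.exists_mem_fil u
  exact hN N hu

end GradedLieSubalgebra

/-! ### Splitting the symmetric algebra, and injectivity -/

namespace GradedLieSubalgebra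

open GradedLieSuperalgebra GradedSuperspace

variable {k g : Type*} [Field k] [AddCommGroup g] [Module k g] {L : GradedLieSuperalgebra k g}
  (H : GradedLieSubalgebra L) (M : GradedSubspace L.toGradedSuperspace)

/-- The map `g → Sym(h) ⊗ Sym(m)` given by the projections of `g` to `h` and `m`. -/
def splitMap (h : IsCompl H.carrier M.carrier) :
    g →ₗ[k] H.toGradedSubspace.toSuperspace.symGrading ᵍ⊗[k] M.toSuperspace.symGrading :=
  (GradedTensorProduct.includeLeft H.toGradedSubspace.toSuperspace.symGrading
      M.toSuperspace.symGrading).toLinearMap ∘ₗ H.toGradedSubspace.toSuperspace.symι ∘ₗ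
        H.carrier.projectionOnto M.carrier h +
    (GradedTensorProduct.includeRight H.toGradedSubspace.toSuperspace.symGrading
      M.toSuperspace.symGrading).toLinearMap ∘ₗ M.toSuperspace.symι ∘ₗ
        M.carrier.projectionOnto H.carrier h.symm

theorem splitMap_apply (h : IsCompl H.carrier M.carrier) (y : H.carrier) (z : M.carrier) :
    H.splitMap M h (y + z) = H.toGradedSubspace.toSuperspace.symι y ᵍ⊗ₜ[k] 1 +
      1 ᵍ⊗ₜ[k] M.toSuperspace.symι z := by
  simp [splitMap]

theorem exists_splitMap_eq (h : IsCompl H.carrier M.carrier) {d : Bideg} {x : g}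
    (hx : x ∈ L.comp d) : ∃ (y : H.carrier) (z : M.carrier), (y : g) ∈ L.comp d ∧
      (z : g) ∈ L.comp d ∧ H.splitMap M h x =
        H.toGradedSubspace.toSuperspace.symι y ᵍ⊗ₜ[k] 1 + 1 ᵍ⊗ₜ[k] M.toSuperspace.symι z := by
  obtain ⟨y, hy, z, hz, rfl⟩ := exists_add_eq (H := H.toGradedSubspace) h hx
  exact ⟨⟨y, hy.1⟩, ⟨z, hz.1⟩, hy.2, hz.2, H.splitMap_apply M h ⟨y, hy.1⟩ ⟨z, hz.1⟩⟩

/-- Within `Sym(h)` and within `Sym(m)` elements supercommute by definition; between the two factors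
they do so by the sign rule of the graded tensor product. -/
theorem splitMap_mul (h : IsCompl H.carrier M.carrier) {i j : Bideg} {x y : g}
    (hx : x ∈ L.toGradedSuperspace.abelian.comp i) (hy : y ∈ L.toGradedSuperspace.abelian.comp j) :
    H.splitMap M h x * H.splitMap M h y =
      koszulSign i j • (H.splitMap M h y * H.splitMap M h x) +
        H.splitMap M h (L.toGradedSuperspace.abelian.bracket x y) := by
  obtain ⟨a, b, ha, hb, e⟩ := H.exists_splitMap_eq M h hx
  obtain ⟨a', b', ha', hb', e'⟩ := H.exists_splitMap_eq M h hy
  rw [show L.toGradedSuperspace.abelian.bracket x y = 0 from rfl, map_zero, add_zero, e, e',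
    ← ksign_smul k]
  have h1 := H.toGradedSubspace.toSuperspace.abelian.ι_mul_ι_eq (i := i) (j := j) ha ha'
  have h2 := M.toSuperspace.abelian.ι_mul_ι_eq (i := i) (j := j) hb hb'
  rw [show H.toGradedSubspace.toSuperspace.abelian.bracket a a' = 0 from rfl, map_zero,
    add_zero] at h1
  rw [show M.toSuperspace.abelian.bracket b b' = 0 from rfl, map_zero, add_zero] at h2
  have hm : ∀ (p q : H.toGradedSubspace.toSuperspace.Sym), (p ᵍ⊗ₜ[k] 1 * q ᵍ⊗ₜ[k] 1 :
      H.toGradedSubspace.toSuperspace.symGrading ᵍ⊗[k] M.toSuperspace.symGrading) =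
        (p * q) ᵍ⊗ₜ[k] 1 := fun p q => (map_mul (GradedTensorProduct.includeLeft (R := k)
      H.toGradedSubspace.toSuperspace.symGrading M.toSuperspace.symGrading) p q).symm
  have hm' : ∀ (p q : M.toSuperspace.Sym), (1 ᵍ⊗ₜ[k] p * 1 ᵍ⊗ₜ[k] q :
      H.toGradedSubspace.toSuperspace.symGrading ᵍ⊗[k] M.toSuperspace.symGrading) =
        1 ᵍ⊗ₜ[k] (p * q) := fun p q => (map_mul (GradedTensorProduct.includeRight (R := k)
      H.toGradedSubspace.toSuperspace.symGrading M.toSuperspace.symGrading) p q).symm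
  have hlr : ∀ (p : H.toGradedSubspace.toSuperspace.Sym) (q : M.toSuperspace.Sym),
      (p ᵍ⊗ₜ[k] 1 * 1 ᵍ⊗ₜ[k] q :
        H.toGradedSubspace.toSuperspace.symGrading ᵍ⊗[k] M.toSuperspace.symGrading) =
          p ᵍ⊗ₜ[k] q := fun p q => GradedTensorProduct.tmul_one_mul_one_tmul (R := k)
      H.toGradedSubspace.toSuperspace.symGrading M.toSuperspace.symGrading p q
  have hrl : ∀ {i j : Bideg} {p : H.carrier} {q : M.carrier}, (p : g) ∈ L.comp i →
      (q : g) ∈ L.comp j → (1 ᵍ⊗ₜ[k] M.toSuperspace.symι q *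
        H.toGradedSubspace.toSuperspace.symι p ᵍ⊗ₜ[k] 1 :
          H.toGradedSubspace.toSuperspace.symGrading ᵍ⊗[k] M.toSuperspace.symGrading) =
        ksign k j i • H.toGradedSubspace.toSuperspace.symι p ᵍ⊗ₜ[k] M.toSuperspace.symι q := by
    intro i j p q hp hq
    have := gradedTensor_mul_of_mem (k := k) H.toGradedSubspace.toSuperspace.symGrading
      M.toSuperspace.symGrading 1 (M.toSuperspace.abelian.ι_mem hq)
      (H.toGradedSubspace.toSuperspace.abelian.ι_mem hp) 1
    rwa [one_mul, mul_one] at this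
  simp only [mul_add, add_mul, hm, hm', hlr, hrl ha hb', hrl ha' hb, smul_add, smul_smul]
  rw [h1, h2, ksign_comm k j i, ksign_mul_self, one_smul]
  have hs : ∀ (c : k) (p : H.toGradedSubspace.toSuperspace.Sym), ((c • p) ᵍ⊗ₜ[k] 1 :
      H.toGradedSubspace.toSuperspace.symGrading ᵍ⊗[k] M.toSuperspace.symGrading) =
        c • p ᵍ⊗ₜ[k] 1 := fun c p => rfl
  have hs' : ∀ (c : k) (p : M.toSuperspace.Sym), (1 ᵍ⊗ₜ[k] (c • p) :
      H.toGradedSubspace.toSuperspace.symGrading ᵍ⊗[k] M.toSuperspace.symGrading) =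
        c • 1 ᵍ⊗ₜ[k] p := fun c p => map_smul (GradedTensorProduct.includeRight (R := k)
      H.toGradedSubspace.toSuperspace.symGrading M.toSuperspace.symGrading) c p
  rw [hs, hs']
  abel

/-- The algebra map `Sym(g) → Sym(h) ⊗ Sym(m)` for a decomposition `g = h ⊕ m`. -/
def symSplit (h : IsCompl H.carrier M.carrier) : L.toGradedSuperspace.Sym →ₐ[k]
    H.toGradedSubspace.toSuperspace.symGrading ᵍ⊗[k] M.toSuperspace.symGrading :=
  L.toGradedSuperspace.abelian.lift
    (A := H.toGradedSubspace.toSuperspace.symGrading ᵍ⊗[k] M.toSuperspace.symGrading)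
    (H.splitMap M h) fun hx hy => H.splitMap_mul M h hx hy

theorem symSplit_ι (h : IsCompl H.carrier M.carrier) (x : g) :
    H.symSplit M h (L.toGradedSuperspace.symι x) = H.splitMap M h x :=
  L.toGradedSuperspace.abelian.lift_ι
    (A := H.toGradedSubspace.toSuperspace.symGrading ᵍ⊗[k] M.toSuperspace.symGrading) _
    (fun hx hy => H.splitMap_mul M h hx hy) x

/-- The span in `Sym(h) ⊗ Sym(m)` of the products of fewer than `N` homogeneous elements. -/
def splitFil (N : ℕ) : Submodule k
    (H.toGradedSubspace.toSuperspace.symGrading ᵍ⊗[k] M.toSuperspace.symGrading) :=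
  Submodule.span k {t | ∃ l l', H.toGradedSubspace.toSuperspace.abelian.IsHomog l ∧
    M.toSuperspace.abelian.IsHomog l' ∧ l.length + l'.length < N ∧
      t = H.toGradedSubspace.toSuperspace.abelian.prodι l ᵍ⊗ₜ[k]
        M.toSuperspace.abelian.prodι l'}

theorem left_mul_tmul (x : H.carrier) (a : H.toGradedSubspace.toSuperspace.Sym)
    (b : M.toSuperspace.Sym) : (H.toGradedSubspace.toSuperspace.symι x ᵍ⊗ₜ[k] 1 * a ᵍ⊗ₜ[k] b :
      H.toGradedSubspace.toSuperspace.symGrading ᵍ⊗[k] M.toSuperspace.symGrading) =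
        (H.toGradedSubspace.toSuperspace.symι x * a) ᵍ⊗ₜ[k] b :=
  gradedTensor_left_mul H.toGradedSubspace.toSuperspace.symGrading M.toSuperspace.symGrading
    (H.toGradedSubspace.toSuperspace.symι x) (a ⊗ₜ b)

theorem right_mul_tmul {d e : Bideg} {x : M.carrier} (hx : (x : g) ∈ L.comp d)
    {a : H.toGradedSubspace.toSuperspace.Sym}
    (ha : a ∈ H.toGradedSubspace.toSuperspace.symGrading e) (b : M.toSuperspace.Sym) :
    (1 ᵍ⊗ₜ[k] M.toSuperspace.symι x * a ᵍ⊗ₜ[k] b :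
      H.toGradedSubspace.toSuperspace.symGrading ᵍ⊗[k] M.toSuperspace.symGrading) =
        ksign k d e • a ᵍ⊗ₜ[k] (M.toSuperspace.symι x * b) := by
  have := gradedTensor_mul_of_mem (k := k) H.toGradedSubspace.toSuperspace.symGrading
    M.toSuperspace.symGrading 1 (M.toSuperspace.abelian.ι_mem hx) ha b
  rwa [one_mul] at this

theorem splitMap_mul_mem (h : IsCompl H.carrier M.carrier) {d : Bideg} {x : g}
    (hx : x ∈ L.comp d) {N : ℕ}
    {t : H.toGradedSubspace.toSuperspace.symGrading ᵍ⊗[k] M.toSuperspace.symGrading}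
    (ht : t ∈ H.splitFil M N) : H.splitMap M h x * t ∈ H.splitFil M (N + 1) := by
  obtain ⟨y, z, hy, hz, e⟩ := H.exists_splitMap_eq M h hx
  rw [e]
  induction ht using Submodule.span_induction with
  | zero => rw [mul_zero]; exact zero_mem _
  | add t t' _ _ ht ht' => rw [mul_add]; exact add_mem ht ht'
  | smul c t _ ht => rw [mul_smul_comm]; exact Submodule.smul_mem _ _ ht
  | mem t ht =>
    obtain ⟨l, l', hl, hl', hN, rfl⟩ := ht
    rw [add_mul, left_mul_tmul,
      H.right_mul_tmul M hz (H.toGradedSubspace.toSuperspace.abelian.prodι_mem_grading hl)]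
    refine add_mem (Submodule.subset_span ⟨(d, y) :: l, l', isHomog_cons.2 ⟨hy, hl⟩, hl', ?_, ?_⟩)
      (Submodule.smul_mem _ _ (Submodule.subset_span
        ⟨l, (d, z) :: l', hl, isHomog_cons.2 ⟨hz, hl'⟩, ?_, ?_⟩))
    · rw [List.length_cons]; omega
    · rw [prodι_cons]
    · rw [List.length_cons]; omega
    · rw [prodι_cons]

theorem symSplit_mem (h : IsCompl H.carrier M.carrier) {N : ℕ} {s : L.toGradedSuperspace.Sym}
    (hs : s ∈ L.toGradedSuperspace.abelian.fil N) : H.symSplit M h s ∈ H.splitFil M N := by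
  suffices h' : L.toGradedSuperspace.abelian.fil N ≤
    (H.splitFil M N).comap (H.symSplit M h).toLinearMap from h' hs
  conv_lhs => rw [fil]
  rw [Submodule.span_le]
  rintro _ ⟨l, hl, hN, rfl⟩
  simp only [SetLike.mem_coe, Submodule.mem_comap, AlgHom.toLinearMap_apply]
  clear hs
  induction l generalizing N with
  | nil =>
    rw [prodι_nil, map_one]
    exact Submodule.subset_span ⟨[], [], isHomog_nil, isHomog_nil, hN, rfl⟩
  | cons a l ih =>
    rw [isHomog_cons] at hl
    obtain ⟨N, rfl⟩ : ∃ m, N = m + 1 := ⟨N - 1, by rw [List.length_cons] at hN; omega⟩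
    rw [prodι_cons, map_mul, symSplit_ι]
    exact H.splitMap_mul_mem M h hl.1 (ih hl.2 (by simpa using hN))

/-- With the `h`-factors first, each `1 ⊗ z` only passes the unit of `Sym(h)`, so no sign appears.
-/
theorem symSplit_prodι (h : IsCompl H.carrier M.carrier) (l : List (Bideg × H.carrier))
    {l' : List (Bideg × M.carrier)} (hl' : M.toSuperspace.abelian.IsHomog l') :
    H.symSplit M h (L.toGradedSuperspace.abelian.prodι
      (mapList H.carrier.subtype l ++ mapList M.carrier.subtype l')) =
        H.toGradedSubspace.toSuperspace.abelian.prodι l ᵍ⊗ₜ[k]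
          M.toSuperspace.abelian.prodι l' := by
  induction l with
  | nil =>
    induction l' with
    | nil => exact map_one _
    | cons a l' ih =>
      rw [isHomog_cons] at hl'
      have ih := ih hl'.2
      have e := H.splitMap_apply M h 0 a.2
      rw [map_zero, ZeroMemClass.coe_zero, zero_add] at e
      have e0 : ((0 : H.toGradedSubspace.toSuperspace.Sym) ᵍ⊗ₜ[k] 1 :
        H.toGradedSubspace.toSuperspace.symGrading ᵍ⊗[k] M.toSuperspace.symGrading) = 0 :=
          map_zero (GradedTensorProduct.includeLeft (R := k) _ _)
      rw [e0, zero_add] at e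
      simp only [mapList, List.map_nil, List.nil_append, List.map_cons, prodι_cons, map_mul,
        Prod.map_snd, Submodule.coe_subtype, prodι_nil] at ih ⊢
      rw [ih, symSplit_ι, e, H.right_mul_tmul M hl'.1 (SetLike.GradedOne.one_mem
        (A := H.toGradedSubspace.toSuperspace.symGrading)), ksign_zero_right, one_smul]
  | cons a l ih =>
    have e := H.splitMap_apply M h a.2 0
    rw [map_zero, ZeroMemClass.coe_zero, add_zero] at e
    have e0 : (1 ᵍ⊗ₜ[k] (0 : M.toSuperspace.Sym) :
      H.toGradedSubspace.toSuperspace.symGrading ᵍ⊗[k] M.toSuperspace.symGrading) = 0 :=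
        map_zero (GradedTensorProduct.includeRight (R := k) _ _)
    rw [e0, add_zero] at e
    simp only [mapList, List.cons_append, List.map_cons, prodι_cons, map_mul,
      Prod.map_snd, Submodule.coe_subtype] at ih ⊢
    rw [ih, symSplit_ι, e, left_mul_tmul]

/-- The surjection `Sym(h) ⊗ Sym(m) → U(h) ⊗ Sym(m)` given by symmetrization. -/
def symToU : H.toGradedSubspace.toSuperspace.symGrading ᵍ⊗[k] M.toSuperspace.symGrading →ₗ[k]
    H.toLie.grading ᵍ⊗[k] M.toSuperspace.symGrading :=
  (GradedTensorProduct.of k H.toLie.grading M.toSuperspace.symGrading).toLinearMap ∘ₗ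
    TensorProduct.map (H.toGradedSubspace.toSuperspace.symmetrize H.toLie.ι) LinearMap.id ∘ₗ
      (GradedTensorProduct.of k H.toGradedSubspace.toSuperspace.symGrading
        M.toSuperspace.symGrading).symm.toLinearMap

theorem symToU_tmul (a : H.toGradedSubspace.toSuperspace.Sym) (b : M.toSuperspace.Sym) :
    H.symToU M (a ᵍ⊗ₜ[k] b) =
      H.toGradedSubspace.toSuperspace.symmetrize H.toLie.ι a ᵍ⊗ₜ[k] b := rfl

theorem symToU_surjective [CharZero k] : Function.Surjective (H.symToU M) :=
  TensorProduct.map_surjective H.toLie.symmetrize_surjective Function.surjective_id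

theorem exists_mem_splitFil
    (t : H.toGradedSubspace.toSuperspace.symGrading ᵍ⊗[k] M.toSuperspace.symGrading) :
    ∃ N, t ∈ H.splitFil M N := by
  have hmono : Monotone (H.splitFil M) := fun m n hmn => Submodule.span_mono (by
    rintro _ ⟨l, l', hl, hl', hN, rfl⟩
    exact ⟨l, l', hl, hl', hN.trans_le hmn, rfl⟩)
  induction t using TensorProduct.induction_on with
  | zero => exact ⟨0, zero_mem _⟩
  | add s t hs ht =>
    obtain ⟨m, hm⟩ := hs
    obtain ⟨n, hn⟩ := ht
    exact ⟨max m n, add_mem (hmono (le_max_left ..) hm) (hmono (le_max_right ..) hn)⟩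
  | tmul a b =>
    obtain ⟨m, hm⟩ := H.toGradedSubspace.toSuperspace.abelian.exists_mem_fil a
    obtain ⟨n, hn⟩ := M.toSuperspace.abelian.exists_mem_fil b
    refine ⟨m + n, ?_⟩
    have h1 := Submodule.apply_mem_map₂ (TensorProduct.mk k _ _) hm hn
    rw [fil, fil, Submodule.map₂_span_span] at h1
    refine Submodule.span_mono ?_ h1
    rintro _ ⟨_, ⟨l, hl, hlm, rfl⟩, _, ⟨l', hl', hln, rfl⟩, rfl⟩
    exact ⟨l, l', hl, hl', by omega, rfl⟩

/-- An element of the kernel is lifted along the surjection `symToU` to some `t` in `Sym(h) ⊗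
Sym(m)`. By `key`, the composite back to `Sym(h) ⊗ Sym(m)` fixes leading terms; as it kills `t`, the
filtration index of `t` can be lowered until `t = 0`. Injectivity of `symToU` is not needed. -/
theorem mulSymmetrize_injective [CharZero k] (h : IsCompl H.carrier M.carrier) :
    Function.Injective (H.mulSymmetrize M) := by
  obtain ⟨P, hP⟩ := L.exists_pbw
  have hPfil : ∀ N, ∀ u ∈ L.fil N, P u ∈ L.toGradedSuperspace.abelian.fil N := by
    intro N u hu
    suffices h' : L.fil N ≤ (L.toGradedSuperspace.abelian.fil N).comap P from h' hu
    conv_lhs => rw [fil]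
    rw [Submodule.span_le]
    rintro _ ⟨l, hl, hN, rfl⟩
    simp only [SetLike.mem_coe, Submodule.mem_comap]
    rw [← sub_add_cancel (P (L.prodι l)) (L.toGradedSuperspace.abelian.prodι l)]
    exact add_mem (L.toGradedSuperspace.abelian.fil_mono hN.le (hP l hl))
      (L.toGradedSuperspace.abelian.prodι_mem_fil hl hN)
  have key : ∀ N, ∀ t ∈ H.splitFil M (N + 1),
      H.symSplit M h (P (H.mulSymmetrize M (H.symToU M t))) - t ∈ H.splitFil M N := by
    intro N t ht
    suffices h' : H.splitFil M (N + 1) ≤ (H.splitFil M N).comap ((H.symSplit M h).toLinearMap ∘ₗ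
      P ∘ₗ H.mulSymmetrize M ∘ₗ H.symToU M - LinearMap.id) from h' ht
    conv_lhs => rw [splitFil]
    rw [Submodule.span_le]
    rintro _ ⟨l, l', hl, hl', hN, rfl⟩
    simp only [SetLike.mem_coe, Submodule.mem_comap, LinearMap.sub_apply, LinearMap.comp_apply,
      AlgHom.toLinearMap_apply, LinearMap.id_apply]
    rw [symToU_tmul, mulSymmetrize_tmul, ← H.symSplit_prodι M h l hl', ← map_sub]
    refine H.symSplit_mem M h ?_
    have hH := symmetrize_sub_mem_fil (G := H.toGradedSubspace.toSuperspace) (L := H.toLie)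
      (f := LinearMap.id) (fun d y hy => hy) hl
    rw [show mapList (LinearMap.id : H.carrier →ₗ[k] H.carrier) l = l from List.map_id _] at hH
    have hH' := H.incl_mem_fil hH
    rw [map_sub, incl_prodι] at hH'
    have hM := symmetrize_sub_mem_fil (L := L) (f := M.carrier.subtype) (fun d y hy => hy) hl'
    have hM' := symmetrize_mem_fil (L := L) (f := M.carrier.subtype) (fun d y hy => hy) hl'
    -- Both symmetrizations are replaced by plain products in `U(g)`, modulo shorter ones; `P` then
    -- replaces the product in `U(g)` by the one in `Sym(g)`.
    have h1 := L.mul_sub_mul_mem_fil hM' (L.prodι_mem_fil (H.isHomog_map_val hl)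
      (by rw [List.length_map]; exact Nat.lt_succ_self _)) hH' hM
    have hhom : L.IsHomog (mapList H.carrier.subtype l ++ mapList M.carrier.subtype l') :=
      isHomog_append.2 ⟨H.isHomog_map_val hl, isHomog_mapList (G := M.toSuperspace) (L := L)
        (f := M.carrier.subtype) (fun d y hy => hy) hl'⟩
    have h2 := hP _ hhom
    rw [List.length_append, length_mapList, length_mapList, prodι_append] at h2
    have h3 := add_mem (hPfil _ _ h1) h2
    rw [map_sub] at h3
    refine L.toGradedSuperspace.abelian.fil_mono (Nat.lt_succ_iff.1 hN) ?_
    convert h3 using 1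
    exact (sub_add_sub_cancel _ _ _).symm
  rw [injective_iff_map_eq_zero]
  intro u hu
  obtain ⟨t, rfl⟩ := H.symToU_surjective M u
  suffices t = 0 by rw [this, map_zero]
  obtain ⟨N, hN⟩ := H.exists_mem_splitFil M t
  induction N with
  | zero => simpa [splitFil] using hN
  | succ N ih =>
    refine ih ?_
    have := key N t hN
    rw [hu, map_zero, map_zero, zero_sub, neg_mem_iff] at this
    exact this

end GradedLieSubalgebra

/-! ### Module structure and the coalgebra isomorphism -/

namespace GradedLieSubalgebra

variable {k g : Type*} [Field k] [AddCommGroup g] [Module k g] {L : GradedLieSuperalgebra k g}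

theorem mulSymmetrize_smul (H : GradedLieSubalgebra L) (M : GradedSubspace L.toGradedSuperspace)
    (a : H.toLie.U) (x : H.toLie.grading ᵍ⊗[k] M.toSuperspace.symGrading) :
    H.mulSymmetrize M (a • x) = a • H.mulSymmetrize M x := by
  -- The module structure is that of the ordinary tensor product, so the induction on tensors takes
  -- place there.
  let e : H.toLie.U ⊗[k] M.toSuperspace.Sym →+ L.U := (H.mulSymmetrize M).toAddMonoidHom
  suffices h : ∀ x : H.toLie.U ⊗[k] M.toSuperspace.Sym, e (a • x) = H.incl a * e x from h x
  intro x
  induction x using TensorProduct.induction_on with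
  | zero => rw [smul_zero, map_zero, mul_zero]
  | add x y hx hy => rw [smul_add, map_add, hx, hy, map_add, mul_add]
  | tmul a' s =>
    change H.incl (a * a') * _ = H.incl a * (H.incl a' * _)
    rw [map_mul, mul_assoc]

/-- The map `a ⊗ s ↦ j(a) · symmetrize(s)` as an isomorphism of coalgebras. -/
def pbwEquiv [CharZero k] (H : GradedLieSubalgebra L) (M : GradedSubspace L.toGradedSuperspace)
    (h : IsCompl H.carrier M.carrier) :
    (H.toLie.grading ᵍ⊗[k] M.toSuperspace.symGrading) ≃ₗc[k] L.U :=
  CoalgEquiv.ofBijective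
    (f := ({ H.mulSymmetrize M with
      counit_comp := H.counit_comp_mulSymmetrize M
      map_comp_comul := H.map_comp_comul_mulSymmetrize M } :
        (H.toLie.grading ᵍ⊗[k] M.toSuperspace.symGrading) →ₗc[k] L.U))
    ⟨H.mulSymmetrize_injective M h, H.mulSymmetrize_surjective M h⟩

theorem pbwEquiv_apply [CharZero k] (H : GradedLieSubalgebra L)
    (M : GradedSubspace L.toGradedSuperspace) (h : IsCompl H.carrier M.carrier)
    (x : H.toLie.grading ᵍ⊗[k] M.toSuperspace.symGrading) :
    H.pbwEquiv M h x = H.mulSymmetrize M x :=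
  rfl

end GradedLieSubalgebra

end

theorem mainTheorem1 {k g I : Type*} [Field k] [CharZero k] [AddCommGroup g] [Module k g]
    (L : GradedLieSuperalgebra k g)
    [Countable I] (b : Module.Basis I k g) (hb : ∀ i, ∃ d, b i ∈ L.comp d)
    (H : GradedLieSubalgebra L) (M : GradedSubspace L.toGradedSuperspace)
    (hHM : IsCompl H.carrier M.carrier) :
    ∃ φ : (H.toLie.grading ᵍ⊗[k] M.toSuperspace.symGrading) ≃ₗc[k] L.U,
      -- the explicit formula, which determines `φ`
      (∀ (a : H.toLie.U) (p : ℕ) (d : Fin p → Bideg) (y : Fin p → M.carrier),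
        (∀ i, (y i : g) ∈ L.comp (d i)) →
        φ (a ᵍ⊗ₜ[k] (List.ofFn fun i => M.toSuperspace.symι (y i)).prod) =
          H.incl a * ((p.factorial : k)⁻¹ • ∑ σ : Equiv.Perm (Fin p),
            permSign d σ • (List.ofFn fun i => L.ι (y (σ i) : g)).prod)) ∧
      -- `φ` is a morphism of left `U(h)`-modules
      (∀ (a : H.toLie.U) (x : H.toLie.grading ᵍ⊗[k] M.toSuperspace.symGrading),
        φ (a • x) = a • φ x) ∧
      -- `φ` preserves degree and parity
      (∀ (i j : Bideg) (a : H.toLie.U) (s : M.toSuperspace.Sym),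
        a ∈ H.toLie.grading i → s ∈ M.toSuperspace.symGrading j →
        φ (a ᵍ⊗ₜ[k] s) ∈ L.grading (i + j)) := by
  refine ⟨H.pbwEquiv M hHM, fun a p d y hy => ?_, fun a x => H.mulSymmetrize_smul M a x,
    fun i j a s ha hs => ?_⟩
  · rw [GradedLieSubalgebra.pbwEquiv_apply, GradedLieSubalgebra.mulSymmetrize_tmul]
    congr 1
    refine (GradedSuperspace.symmetrize_finProd (G := M.toSuperspace)
      (L.ι ∘ₗ M.carrier.subtype) hy).trans ?_
    simp only [unitCast_smul]
    rfl
  · rw [GradedLieSubalgebra.pbwEquiv_apply, GradedLieSubalgebra.mulSymmetrize_tmul]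
    exact SetLike.mul_mem_graded (H.incl_mem_grading i a ha)
      (GradedSuperspace.symmetrize_mem_grading (fun d y hy => hy) j s hs)
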